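/- **Setting.** All registers consist of qubits; $D=2^\ell$. A *lab oracle* on registers $N,L$ is a pair $(\mathcal E,\rho)$ of a quantum channel $\mathcal E$ on $N\otimes L$ and a density matrix $\rho$ on $N$. A *QUALM* over a set $\mathcal G$ of admissible gates (channels on $L\otimes W$) consists of a finite working register $W$, a finite sequence of symbols, each of which is a gate of $\mathcal G$ or the query symbol $\square$, and designated input and output qubits of $W$. Run on a lab oracle, it starts in $\rho\otimes|x\rangle\langle x|\otimes|0\rangle\langle 0|$ ($x$ on the input qubits, $0$ on all other qubits of $L\otimes W$), applies the gates in order with $\mathcal E$ in place of each $\square$, and its output is the reduced state on the output qubits. Its *complexity* is the total number of symbols, its *query complexity* the number of symbols $\square$. *Coherent access* means that $\mathcal G$ is a universal gate set and that there is no other restriction; here "universal" means that each of the gates $H$, $T$, CNOT, on any qubits of $L\otimes W$, is a composition of at most $K$ gates of $\mathcal G$, where $K$ does not depend on the sizes of $L$ and $W$. Let $G_0=U(D)$, $G_1=O(D)$ and $G_2=\mathrm{Sp}(D/2)=\{U\in U(D): -JU^TJ=U^{-1}\}$ with $J=\begin{pmatrix}0&1_{D/2}\\-1_{D/2}&0\end{pmatrix}$.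 The lab oracle $\mathsf{LO}_\ell^{(i)}$, for $i=0,1,2$ (the fixed Haar-random unitary, orthogonal and symplectic oracle), has $L$ of $\ell$ qubits, $\mathcal E$ the unitary $|U\rangle\otimes|\alpha\rangle\mapsto|U\rangle\otimes U|\alpha\rangle$ and $\rho=\int_{G_i}|U\rangle\langle U|\,dU$ with respect to Haar probability measure, where $|U\rangle$ is a classical description of $U$: so one element of $G_i$ is drawn and the same element is applied in all queries. The description may be exact (the output is then the Haar average over $U\in G_i$ of the outputs for the oracle that applies $U$), or it may be given by finitely many bits of $N$ with an error of at most $2^{-b}$ in each matrix entry. A QUALM without input qubits and with two output qubits *solves the symmetry distinction problem* if, for each $i\in\{0,1,2\}$, its output $\rho_{\rm out}^{(i)}$ on $\mathsf{LO}_\ell^{(i)}$ satisfies $\big\|\rho_{\rm out}^{(i)}-|i\rangle\langle i|\big\|_1\le \tfrac13$, where $i$ is written in binary on the two qubits and $\|\cdot\|_1$ is the trace norm. **Theorem.** For every universal gate set $\mathcal G$ there is a constant $C$ such that for every $\ell\ge 2$ there is a coherent-access QUALM over $\mathcal G$ of complexity at most $C\ell$, with at most $C$ queries, that solves the symmetry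 distinction problem among the fixed Haar-random unitary, orthogonal and symplectic oracles on $\ell$ qubits. The same QUALM solves it for exact descriptions and for all finite descriptions with $b\ge C\,2^\ell$ bits of accuracy in each entry. -/

import Mathlib

open Matrix MeasureTheory
open scoped ComplexOrder

noncomputable section

/-! ### Qubit registers, states and channels -/

/-- The labels of the computational basis of the register whose qubits are indexed by `Q`. -/
abbrev Bits (Q : Type) : Type := Q → Fin 2

/-- A map on square matrices (operators) indexed by `ι`. -/
abbrev Superop (ι : Type) : Type := Matrix ι ι ℂ → Matrix ι ι ℂ

/-- Quantum channels: completely positive trace-preserving maps, in Kraus form. -/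
def IsChannel {ι : Type} [Fintype ι] [DecidableEq ι] (E : Superop ι) : Prop :=
  ∃ (k : ℕ) (A : Fin k → Matrix ι ι ℂ),
    ∑ α, (A α)ᴴ * A α = 1 ∧ ∀ M, E M = ∑ α, A α * M * (A α)ᴴ

/-- Conjugation `M ↦ U M U†`. -/
def conjBy {ι : Type} [Fintype ι] (U : Matrix ι ι ℂ) : Superop ι := fun M => U * M * Uᴴ

theorem isChannel_conjBy {ι : Type} [Fintype ι] [DecidableEq ι] {U : Matrix ι ι ℂ}
    (hU : Uᴴ * U = 1) : IsChannel (conjBy U) :=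
  ⟨1, fun _ => U, by simpa using hU, fun M => by simp [conjBy]⟩

/-- The projector `|s⟩⟨s|` on a computational basis state. -/
def ketBra {ι : Type} [DecidableEq ι] (s : ι) : Matrix ι ι ℂ := Matrix.single s s 1

/-- The trace norm `‖A‖₁`: the sum of the singular values of `A`, that is, of the square roots of
the eigenvalues of `A†A`. -/
def traceNorm {ι : Type} [Fintype ι] [DecidableEq ι] (A : Matrix ι ι ℂ) : ℝ :=
  ∑ i, Real.sqrt ((isHermitian_conjTranspose_mul_self A).eigenvalues i)

/-! ### Lab oracles -/

/-- A lab oracle on `N` (`n` qubits) and `L` (`ℓ` qubits): a channel on `N ⊗ L` and a density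
matrix on `N`. -/
structure LabOracle (n ℓ : ℕ) where
  channel : Superop (Bits (Fin n) × Bits (Fin ℓ))
  isChannel : IsChannel channel
  state : Matrix (Bits (Fin n)) (Bits (Fin n)) ℂ
  posSemidef : state.PosSemidef
  trace_eq_one : state.trace = 1

/-! ### Admissible gates -/

/-- The qubits of `L ⊗ W`, with `ℓ` lab qubits and `w` working qubits. -/
abbrev LW (ℓ w : ℕ) : Type := Fin ℓ ⊕ Fin w

/-- The matrix of the one-qubit gate `g` applied to qubit `i` of a register. -/
def oneQubitGate {Q : Type} [Fintype Q] [DecidableEq Q] (i : Q) (g : Matrix (Fin 2) (Fin 2) ℂ) :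
    Matrix (Bits Q) (Bits Q) ℂ :=
  Matrix.of fun x y => if ∀ j, j ≠ i → x j = y j then g (x i) (y i) else 0

/-- The matrix of the CNOT gate with control `i` and target `j`. -/
def cnotGate {Q : Type} [Fintype Q] [DecidableEq Q] (i j : Q) :
    Matrix (Bits Q) (Bits Q) ℂ :=
  Matrix.of fun x y => if x = Function.update y j (y j + y i) then 1 else 0

/-- The Hadamard gate. -/
def hadamard : Matrix (Fin 2) (Fin 2) ℂ := (1 / (Real.sqrt 2 : ℂ)) • !![1, 1; 1, -1]

/-- The gate `T = diag(1, exp(iπ/4))`. -/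
def tGate : Matrix (Fin 2) (Fin 2) ℂ := !![1, 0; 0, Complex.exp (Complex.I * Real.pi / 4)]

/-- The Hadamard, `T` and CNOT gates, on all qubits (pairs of qubits) of a register. -/
inductive IsHTCnot {Q : Type} [Fintype Q] [DecidableEq Q] : Superop (Bits Q) → Prop
  | hadamard (i : Q) : IsHTCnot (conjBy (oneQubitGate i hadamard))
  | t (i : Q) : IsHTCnot (conjBy (oneQubitGate i tGate))
  | cnot (i j : Q) (hij : i ≠ j) : IsHTCnot (conjBy (cnotGate i j))

/-- Admissible gates: a set of channels on `L ⊗ W`, for all sizes of `L` and `W`. -/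
structure GateFamily where
  gates : ∀ ℓ w : ℕ, Set (Superop (Bits (LW ℓ w)))
  isChannel : ∀ ℓ w, ∀ g ∈ gates ℓ w, IsChannel g

/-- Universality of a family of admissible gates: each gate of the standard universal set
`{H, T, CNOT}`, on any qubits of `L ⊗ W`, is the composition of boundedly many admissible gates,
with a bound that does not depend on the sizes of the registers. -/
def GateFamily.IsUniversal (𝒢 : GateFamily) : Prop :=
  ∃ K : ℕ, ∀ (ℓ w : ℕ) (g : Superop (Bits (LW ℓ w))), IsHTCnot g →
    ∃ c : List (Superop (Bits (LW ℓ w))), c.length ≤ K ∧ (∀ h ∈ c, h ∈ 𝒢.gates ℓ w) ∧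
      ∀ M, c.foldl (fun ρ h => h ρ) M = g M

/-! ### QUALMs -/

/-- A symbol of a program: an admissible gate, or `query`, a call of the lab oracle. -/
inductive Symb (𝒢 : GateFamily) (ℓ w : ℕ) where
  | gate (g : Superop (Bits (LW ℓ w))) (hg : g ∈ 𝒢.gates ℓ w)
  | query

/-- A QUALM with `ℓ` lab qubits, `p` input and `q` output qubits over the admissible gates `𝒢`: a
number `w` of working qubits, a sequence of symbols, and the input and output qubits in `W`. -/
structure QUALM (𝒢 : GateFamily) (ℓ p q : ℕ) where
  w : ℕ
  prog : List (Symb 𝒢 ℓ w)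
  inp : Fin p ↪ Fin w
  out : Fin q ↪ Fin w

/-- The channel `g` on `L ⊗ W`, extended to `N ⊗ (L ⊗ W)`. -/
def extendGate {n ℓ w : ℕ} (g : Superop (Bits (LW ℓ w))) :
    Superop (Bits (Fin n) × Bits (LW ℓ w)) :=
  fun M => Matrix.of fun i j => g (Matrix.of fun z z' => M (i.1, z) (j.1, z')) i.2 j.2

/-- The channel `E` on `N ⊗ L`, extended to `N ⊗ (L ⊗ W)`. -/
def extendOracle {n ℓ w : ℕ} (E : Superop (Bits (Fin n) × Bits (Fin ℓ))) :
    Superop (Bits (Fin n) × Bits (LW ℓ w)) :=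
  fun M => Matrix.of fun i j =>
    E (Matrix.of fun a b => M (a.1, Sum.elim a.2 (i.2 ∘ Sum.inr)) (b.1, Sum.elim b.2 (j.2 ∘ Sum.inr)))
      (i.1, i.2 ∘ Sum.inl) (j.1, j.2 ∘ Sum.inl)

namespace QUALM

variable {𝒢 : GateFamily} {n ℓ p q : ℕ}

/-- The QUALM complexity: the number of symbols (gates and oracle calls) in the program. -/
def complexity (Q : QUALM 𝒢 ℓ p q) : ℕ := Q.prog.length

open Classical in
/-- The number of oracle calls in the program. -/
def queryComplexity (Q : QUALM 𝒢 ℓ p q) : ℕ := Q.prog.count Symb.query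

/-- The action of one symbol on `N ⊗ (L ⊗ W)`, for a given lab oracle. -/
def step {w : ℕ} (LO : LabOracle n ℓ) : Symb 𝒢 ℓ w → Superop (Bits (Fin n) × Bits (LW ℓ w))
  | .gate g _ => extendGate g
  | .query => extendOracle LO.channel

/-- The initial basis state of `L ⊗ W`: the input string on the input qubits, `0` elsewhere. -/
def initBits (Q : QUALM 𝒢 ℓ p q) (x : Bits (Fin p)) : Bits (LW ℓ Q.w) :=
  Sum.elim 0 (Function.extend Q.inp x 0)

/-- The initial state on `N ⊗ (L ⊗ W)`: the tensor product of the oracle's state on `N` and the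
initial basis state of `L ⊗ W`. -/
def initState (Q : QUALM 𝒢 ℓ p q) (LO : LabOracle n ℓ) (x : Bits (Fin p)) :
    Matrix (Bits (Fin n) × Bits (LW ℓ Q.w)) (Bits (Fin n) × Bits (LW ℓ Q.w)) ℂ :=
  Matrix.kronecker LO.state (ketBra (Q.initBits x))

/-- The final state on `N ⊗ (L ⊗ W)`. -/
def finalState (Q : QUALM 𝒢 ℓ p q) (LO : LabOracle n ℓ) (x : Bits (Fin p)) :
    Matrix (Bits (Fin n) × Bits (LW ℓ Q.w)) (Bits (Fin n) × Bits (LW ℓ Q.w)) ℂ :=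
  Q.prog.foldl (fun ρ s => step LO s ρ) (Q.initState LO x)

/-- The output density matrix: the partial trace of the final state over all qubits other than the
output qubits. -/
def output (Q : QUALM 𝒢 ℓ p q) (LO : LabOracle n ℓ) (x : Bits (Fin p)) :
    Matrix (Bits (Fin q)) (Bits (Fin q)) ℂ :=
  Matrix.of fun s t => ∑ a : Bits (Fin n), ∑ z : Bits (LW ℓ Q.w), ∑ z' : Bits (LW ℓ Q.w),
    if (∀ k, z (Sum.inr (Q.out k)) = s k) ∧ (∀ k, z' (Sum.inr (Q.out k)) = t k) ∧
        (∀ j, (∀ k, j ≠ Sum.inr (Q.out k)) → z j = z' j)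
    then Q.finalState LO x (a, z) (a, z') else 0

/-- The QUALM implements, with error at most `ε`, the task of computing the function `f` of the
lab oracles `LO i` and the input strings. -/
def ImplementsWithError {ι : Type} (Q : QUALM 𝒢 ℓ p q) (LO : ι → LabOracle n ℓ)
    (f : ι → Bits (Fin p) → Bits (Fin q)) (ε : ℝ) : Prop :=
  ∀ i x, traceNorm (Q.output (LO i) x - ketBra (f i x)) ≤ ε

end QUALM

/-! ### The unitary, orthogonal and compact symplectic groups on `ℓ` qubits -/

/-- The group `U(D)`, `D = 2 ^ ℓ`. -/
abbrev UGroup (ℓ : ℕ) : Type := Matrix.unitaryGroup (Bits (Fin ℓ)) ℂ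

instance (ℓ : ℕ) : MeasurableSpace (UGroup ℓ) := borel _

instance (ℓ : ℕ) : BorelSpace (UGroup ℓ) := ⟨rfl⟩

instance (ℓ : ℕ) : CompactSpace (UGroup ℓ) := by
  apply isCompact_iff_compactSpace.mp
  have hb : IsCompact (Set.univ.pi fun _ => Set.univ.pi fun _ => Metric.closedBall 0 1 :
      Set (Matrix (Bits (Fin ℓ)) (Bits (Fin ℓ)) ℂ)) :=
    isCompact_univ_pi fun _ => isCompact_univ_pi fun _ => isCompact_closedBall _ _
  have hc := isClosed_unitary (R := Matrix (Bits (Fin ℓ)) (Bits (Fin ℓ)) ℂ)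
  refine hb.of_isClosed_subset hc ?_
  intro U hU i _ j _
  simpa using entry_norm_bound_of_unitary hU i j

/-- The group `O(D)`: the unitaries that commute with complex conjugation, `U^* = U`. -/
def orthogonalSubgroup (ℓ : ℕ) : Subgroup (UGroup ℓ) where
  carrier := {U | U.1.map star = U.1}
  one_mem' := by
    change (1 : Matrix _ _ ℂ).map star = 1
    simp
  mul_mem' := by
    intro U V hU hV
    change (U.1 * V.1).map (starRingEnd ℂ) = U.1 * V.1
    rw [Matrix.map_mul]
    exact congrArg₂ (· * ·) hU hV
  inv_mem' := by
    intro U hU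
    change (U.1ᴴ).map star = U.1ᴴ
    change U.1.map star = U.1 at hU
    conv_rhs => rw [← hU]
    rfl

/-- The matrix `J = [[0, 1], [-1, 0]]` in blocks of size `D / 2`; the block is given by the first
qubit, so that `J = iσ^y ⊗ 1`. -/
def matJ : (ℓ : ℕ) → Matrix (Bits (Fin ℓ)) (Bits (Fin ℓ)) ℂ
  | 0 => 0
  | _ + 1 => Matrix.of fun x y =>
      if Fin.tail x = Fin.tail y then !![(0 : ℂ), 1; -1, 0] (x 0) (y 0) else 0

/-- The compact symplectic group `Sp(D / 2)`: the unitaries with `-J U^T J = U⁻¹`. To see that this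
is a group also in the degenerate case of no qubits, the condition is written as
`U J U^T = J`. -/
def symplecticSubgroup (ℓ : ℕ) : Subgroup (UGroup ℓ) where
  carrier := {U | U.1 * matJ ℓ * U.1ᵀ = matJ ℓ}
  one_mem' := by
    change (1 : Matrix _ _ ℂ) * matJ ℓ * (1 : Matrix _ _ ℂ)ᵀ = matJ ℓ
    simp
  mul_mem' := by
    intro U V hU hV
    change (U.1 * V.1) * matJ ℓ * (U.1 * V.1)ᵀ = matJ ℓ
    change U.1 * matJ ℓ * U.1ᵀ = matJ ℓ at hU
    change V.1 * matJ ℓ * V.1ᵀ = matJ ℓ at hV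
    calc (U.1 * V.1) * matJ ℓ * (U.1 * V.1)ᵀ = U.1 * (V.1 * matJ ℓ * V.1ᵀ) * U.1ᵀ := by
          rw [Matrix.transpose_mul]; simp only [Matrix.mul_assoc]
      _ = matJ ℓ := by rw [hV, hU]
  inv_mem' := by
    intro U hU
    change U.1ᴴ * matJ ℓ * (U.1ᴴ)ᵀ = matJ ℓ
    change U.1 * matJ ℓ * U.1ᵀ = matJ ℓ at hU
    have h1 : U.1ᴴ * U.1 = 1 := Matrix.mem_unitaryGroup_iff'.mp U.2
    have h2 : U.1ᵀ * (U.1ᴴ)ᵀ = 1 := by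
      rw [← Matrix.transpose_mul, h1, Matrix.transpose_one]
    calc U.1ᴴ * matJ ℓ * (U.1ᴴ)ᵀ = U.1ᴴ * (U.1 * matJ ℓ * U.1ᵀ) * (U.1ᴴ)ᵀ := by rw [hU]
      _ = (U.1ᴴ * U.1) * matJ ℓ * (U.1ᵀ * (U.1ᴴ)ᵀ) := by simp only [Matrix.mul_assoc]
      _ = matJ ℓ := by rw [h1, h2, Matrix.one_mul, Matrix.mul_one]

theorem matJ_mul_matJ (ℓ : ℕ) (hℓ : ℓ ≠ 0) : matJ ℓ * matJ ℓ = -1 := by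
  obtain ⟨m, rfl⟩ := Nat.exists_eq_succ_of_ne_zero hℓ
  ext x y
  rw [Matrix.mul_apply, ← (Fin.consEquiv (fun _ : Fin (m + 1) => Fin 2)).sum_comp,
    Fintype.sum_prod_type]
  simp only [matJ, Matrix.of_apply, Fin.consEquiv, Equiv.coe_fn_mk, Fin.tail_cons, Fin.cons_zero,
    Fin.sum_univ_two, ite_mul, zero_mul, Finset.sum_ite_eq, Finset.mem_univ, if_true,
    Matrix.neg_apply, Matrix.one_apply]
  have key : x = y ↔ x 0 = y 0 ∧ Fin.tail x = Fin.tail y := by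
    constructor
    · rintro rfl; simp
    · rintro ⟨h0, ht⟩
      rw [← Fin.cons_self_tail x, ← Fin.cons_self_tail y, h0, ht]
  rw [if_congr key rfl rfl]
  by_cases ht : Fin.tail x = Fin.tail y <;>
    rcases Fin.exists_fin_two.mp ⟨x 0, rfl⟩ with hx | hx <;>
    rcases Fin.exists_fin_two.mp ⟨y 0, rfl⟩ with hy | hy <;> simp [ht, hx, hy]

theorem mem_symplecticSubgroup_iff (ℓ : ℕ) (hℓ : ℓ ≠ 0) (U : UGroup ℓ) :
    U ∈ symplecticSubgroup ℓ ↔ -(matJ ℓ * U.1ᵀ * matJ ℓ) = (U⁻¹ : UGroup ℓ).1 := by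
  have hJ := matJ_mul_matJ ℓ hℓ
  have h1 : (U⁻¹ : UGroup ℓ).1 * U.1 = 1 := Matrix.mem_unitaryGroup_iff'.mp U.2
  have h2 : U.1 * (U⁻¹ : UGroup ℓ).1 = 1 := Matrix.mem_unitaryGroup_iff.mp U.2
  change U.1 * matJ ℓ * U.1ᵀ = matJ ℓ ↔ _
  constructor
  · intro h
    calc -(matJ ℓ * U.1ᵀ * matJ ℓ)
        = -(((U⁻¹ : UGroup ℓ).1 * U.1) * matJ ℓ * U.1ᵀ * matJ ℓ) := by rw [h1, Matrix.one_mul]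
      _ = -((U⁻¹ : UGroup ℓ).1 * (U.1 * matJ ℓ * U.1ᵀ) * matJ ℓ) := by
          simp only [Matrix.mul_assoc]
      _ = (U⁻¹ : UGroup ℓ).1 := by rw [h, Matrix.mul_assoc, hJ]; simp
  · intro h
    calc U.1 * matJ ℓ * U.1ᵀ = U.1 * -(matJ ℓ * U.1ᵀ * matJ ℓ) * matJ ℓ := by
          simp only [Matrix.mul_assoc, Matrix.mul_neg, Matrix.neg_mul, hJ]; simp
      _ = matJ ℓ := by rw [h, h2, Matrix.one_mul]

/-- The three groups `U(D)`, `O(D)`, `Sp(D / 2)`, in this order. -/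
def symmetryGroup (ℓ : ℕ) : Fin 3 → Subgroup (UGroup ℓ) :=
  ![⊤, orthogonalSubgroup ℓ, symplecticSubgroup ℓ]

theorem isClosed_symmetryGroup (ℓ : ℕ) (i : Fin 3) :
    IsClosed (symmetryGroup ℓ i : Set (UGroup ℓ)) := by
  have hv : Continuous fun U : UGroup ℓ => U.1 := continuous_subtype_val
  fin_cases i
  · exact isClosed_univ
  · exact isClosed_eq (hv.matrix_map continuous_star) hv
  · exact isClosed_eq ((hv.mul continuous_const).mul hv.matrix_transpose) continuous_const

instance (ℓ : ℕ) (i : Fin 3) : CompactSpace (symmetryGroup ℓ i) :=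
  isCompact_iff_compactSpace.mp (isClosed_symmetryGroup ℓ i).isCompact

/-- The Haar probability measure on each of the three groups. -/
def haar (ℓ : ℕ) (i : Fin 3) : Measure (symmetryGroup ℓ i) := Measure.haarMeasure ⊤

instance (ℓ : ℕ) (i : Fin 3) : IsProbabilityMeasure (haar ℓ i) :=
  ⟨by simpa [haar] using
    Measure.haarMeasure_self (K₀ := (⊤ : TopologicalSpace.PositiveCompacts (symmetryGroup ℓ i)))⟩

/-! ### The fixed random unitary lab oracles -/

/-- A classical description of the unitaries on `ℓ` qubits by strings of `n` bits, up to an error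
`2 ^ (-b)` in each entry: `enc U` is the description of `U`, and `dec s` is the unitary
that the oracle applies when it reads the string `s`. -/
structure Description (ℓ n b : ℕ) where
  enc : UGroup ℓ → Bits (Fin n)
  dec : Bits (Fin n) → UGroup ℓ
  measurable_enc : Measurable enc
  accurate : ∀ (U : UGroup ℓ) (x y : Bits (Fin ℓ)),
    ‖(dec (enc U)).1 x y - U.1 x y‖ ≤ (1 / 2 : ℝ) ^ b

/-- The unitary `|s⟩ ⊗ |α⟩ ↦ |s⟩ ⊗ V s |α⟩` on `N ⊗ L`. -/
def controlled {n ℓ : ℕ} (V : Bits (Fin n) → UGroup ℓ) :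
    Matrix (Bits (Fin n) × Bits (Fin ℓ)) (Bits (Fin n) × Bits (Fin ℓ)) ℂ :=
  Matrix.of fun i j => if i.1 = j.1 then (V i.1).1 i.2 j.2 else 0

theorem controlled_unitary {n ℓ : ℕ} (V : Bits (Fin n) → UGroup ℓ) :
    (controlled V)ᴴ * controlled V = 1 := by
  ext ⟨s, x⟩ ⟨t, y⟩
  have h : ((V s).1ᴴ * (V s).1) x y = (1 : Matrix _ _ ℂ) x y := by
    rw [← Matrix.star_eq_conjTranspose, Matrix.mem_unitaryGroup_iff'.mp (V s).2]
  rw [Matrix.mul_apply] at h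
  rw [Matrix.mul_apply, Fintype.sum_prod_type, Finset.sum_eq_single s]
  · by_cases hst : s = t
    · subst hst
      simpa [controlled, Matrix.one_apply] using h
    · simp [controlled, hst]
  · intro r _ hr
    simp [controlled, hr]
  · simp

/-- The mixture `∫ |U⟩⟨U| dU` of the descriptions of the elements of a symmetry group, integrated
entrywise. -/
def describedState {ℓ n b : ℕ} (d : Description ℓ n b) (i : Fin 3) :
    Matrix (Bits (Fin n)) (Bits (Fin n)) ℂ :=
  Matrix.of fun s t => ∫ U, ketBra (d.enc U.1) s t ∂(haar ℓ i)

theorem describedState_eq {ℓ n b : ℕ} (d : Description ℓ n b) (i : Fin 3) :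
    describedState d i = Matrix.diagonal fun s =>
      (((haar ℓ i).real {U | d.enc U.1 = s} : ℝ) : ℂ) := by
  have hm : ∀ s, MeasurableSet {U : symmetryGroup ℓ i | d.enc U.1 = s} := fun s =>
    (d.measurable_enc.comp measurable_subtype_coe) (measurableSet_singleton s)
  ext s t
  rw [describedState, Matrix.of_apply, Matrix.diagonal_apply]
  split_ifs with h
  · subst h
    have : (fun U : symmetryGroup ℓ i => ketBra (d.enc U.1) s s) =
        {U : symmetryGroup ℓ i | d.enc U.1 = s}.indicator fun _ => (1 : ℂ) := by
      funext U
      simp [ketBra, Matrix.single_apply, Set.indicator_apply]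
    rw [this, integral_indicator_const _ (hm s)]
    simp
  · have : (fun U : symmetryGroup ℓ i => ketBra (d.enc U.1) s t) = fun _ => 0 := by
      funext U
      simp only [ketBra, Matrix.single_apply]
      rw [if_neg]
      rintro ⟨h1, h2⟩
      exact h (h1.symm.trans h2)
    rw [this, integral_zero]

/-- The lab oracle that holds in `N` the description of one Haar random element of the unitary,
orthogonal or symplectic group (`i = 0, 1, 2`), and applies it to `L` in every call. -/
def symmetryOracle {ℓ n b : ℕ} (d : Description ℓ n b) (i : Fin 3) : LabOracle n ℓ where
  channel := conjBy (controlled d.dec)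
  isChannel := isChannel_conjBy (controlled_unitary d.dec)
  state := describedState d i
  posSemidef := by
    rw [describedState_eq]
    refine Matrix.PosSemidef.diagonal fun s => ?_
    simp only [Pi.zero_apply]
    exact_mod_cast measureReal_nonneg
  trace_eq_one := by
    have hm : Measurable fun U : symmetryGroup ℓ i => d.enc U.1 :=
      d.measurable_enc.comp measurable_subtype_coe
    have h := sum_measureReal_preimage_singleton (μ := haar ℓ i) (f := fun U => d.enc U.1)
      Finset.univ (fun s _ => hm (measurableSet_singleton s))
    rw [describedState_eq, Matrix.trace_diagonal]
    have h2 : ∑ s, (haar ℓ i).real {U | d.enc U.1 = s} = 1 := by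
      refine Eq.trans h ?_
      simp
    exact_mod_cast h2

/-- The lab oracle with trivial `N` that applies the given unitary `U` to `L` in every call. -/
def unitaryOracle {ℓ : ℕ} (U : UGroup ℓ) : LabOracle 0 ℓ where
  channel := conjBy (controlled fun _ => U)
  isChannel := isChannel_conjBy (controlled_unitary _)
  state := 1
  posSemidef := Matrix.PosSemidef.one
  trace_eq_one := by rw [Matrix.trace_one]; simp

/-- The output of a QUALM on the ideal oracle, which holds an exact description of one Haar random
element of the unitary, orthogonal or symplectic group (`i = 0, 1, 2`): the Haar average of the
outputs for a known unitary. -/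
def idealOutput {𝒢 : GateFamily} {ℓ p q : ℕ} (Q : QUALM 𝒢 ℓ p q) (i : Fin 3) (x : Bits (Fin p)) :
    Matrix (Bits (Fin q)) (Bits (Fin q)) ℂ :=
  Matrix.of fun s t => ∫ U, Q.output (unitaryOracle U.1) x s t ∂(haar ℓ i)

/-- The answers `0`, `1`, `2` on two qubits. -/
def answer : Fin 3 → Bits (Fin 2) := ![![0, 0], ![0, 1], ![1, 0]]

end

/-! The test compares two uses of the same `U`. A matrix `B` stands for the state `2^(-ℓ/2) ∑ B x y
|x⟩|y⟩` on `L ⊗ A`. A query multiplies the matrix by `U` from the left, and exchanging `L` with `A`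
transposes it. Hence query, exchange, query turn `B` into `U Bᵀ Uᵀ`, and running the preparation
backwards brings `L` and `A` back to zero with amplitude `amp B U = 2^(-ℓ) tr(Bᵀ U Bᵀ Uᵀ)`. For `B =
1` this is 1 on the orthogonal group, since `U Uᵀ = 1`; for `B = J` it has modulus 1 on the
symplectic group, since `U J Uᵀ = J`.

In the remaining cases (both forms for the unitary group, `J` for the orthogonal, `1` for the
symplectic) a high power of `|amp|` has small Haar average, uniformly in `ℓ`. This needs only left
invariance and Bessel's inequality. The group contains rotations `g = cos θ + i sin θ P` with an
involution `P`, for which `amp B (g U) = cos 2θ α + sin 2θ β` (`amp_rotate`), and `|α|² + |β|² ≤ 1`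
(`norm_sq_amp_add_le`). A vector of length at most 1 cannot have nearly full projection on two
distinct lines. So among `m` equally spaced angles at most one gives a modulus above some `c < 1`
that depends on `m` alone, and the average of `|amp|^t` is at most `1/m + c^t`
(`exists_integral_amp_le`). Choosing `m` and then `t` fixes the number of comparisons once and for
all.

One program does `t` comparisons with `1` and then `t` with `J`. After each comparison a chain of OR
gates records in fresh flags whether `L` and `A` returned to zero. If they did, the initial state is
restored up to the factor `amp`, so all `t` comparisons succeed with probability `|amp|^(2t)`
(`run_stageOps`, `exists_program`). The two final flags, negated, are the binary answer.

The output differs entrywise from the pure answer by at most the square root of the error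
probability (`norm_reducedState_sub_le`), which `errorAmp` bounds up to a small remainder; this
bound is integrated over the group. A finite description enters only through the Lipschitz estimate
`norm_amp_sub_le`. -/

noncomputable section

/-! ### Elementary programs and their compilation -/

/-- Elementary operations on `L ⊗ W`: Hadamard, `T`, CNOT (the identity if control and target
agree), and a query. -/
inductive Op (Q : Type) where
  | h (i : Q)
  | t (i : Q)
  | cnot (i j : Q)
  | query

/-- The unitary `U` on `L`, extended to `L ⊗ W`. -/
def liftL {ℓ w : ℕ} (U : Matrix (Bits (Fin ℓ)) (Bits (Fin ℓ)) ℂ) :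
    Matrix (Bits (LW ℓ w)) (Bits (LW ℓ w)) ℂ :=
  Matrix.of fun z z' => if z ∘ Sum.inr = z' ∘ Sum.inr then U (z ∘ Sum.inl) (z' ∘ Sum.inl) else 0

theorem sum_liftL {ℓ w : ℕ} (U : Matrix (Bits (Fin ℓ)) (Bits (Fin ℓ)) ℂ) (z : Bits (LW ℓ w))
    (f : Bits (LW ℓ w) → ℂ) :
    ∑ z', liftL U z z' * f z' = ∑ y, U (z ∘ Sum.inl) y * f (Sum.elim y (z ∘ Sum.inr)) := by
  rw [← (Equiv.sumArrowEquivProdArrow (Fin ℓ) (Fin w) (Fin 2)).symm.sum_comp,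
    Fintype.sum_prod_type]
  refine Finset.sum_congr rfl fun y _ => ?_
  rw [Finset.sum_eq_single (z ∘ Sum.inr)]
  · have h1 : (Sum.elim y (z ∘ Sum.inr) : Bits (LW ℓ w)) ∘ Sum.inl = y := rfl
    have h2 : (Sum.elim y (z ∘ Sum.inr) : Bits (LW ℓ w)) ∘ Sum.inr = z ∘ Sum.inr := rfl
    simp [liftL, Equiv.sumArrowEquivProdArrow, h1]
  · intro r _ hr
    have h2 : (Sum.elim y r : Bits (LW ℓ w)) ∘ Sum.inr = r := rfl
    simp [liftL, Equiv.sumArrowEquivProdArrow, Ne.symm hr]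
  · simp

/-- The matrix of an elementary operation, with `U` in place of the query. -/
def Op.mat {ℓ w : ℕ} (U : Matrix (Bits (Fin ℓ)) (Bits (Fin ℓ)) ℂ) :
    Op (LW ℓ w) → Matrix (Bits (LW ℓ w)) (Bits (LW ℓ w)) ℂ
  | .h i => oneQubitGate i hadamard
  | .t i => oneQubitGate i tGate
  | .cnot i j => if i = j then 1 else cnotGate i j
  | .query => liftL U

/-- The state vector after a program of elementary operations. -/
def run {ℓ w : ℕ} (U : Matrix (Bits (Fin ℓ)) (Bits (Fin ℓ)) ℂ) (p : List (Op (LW ℓ w)))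
    (ψ : Bits (LW ℓ w) → ℂ) : Bits (LW ℓ w) → ℂ :=
  p.foldl (fun φ o => o.mat U *ᵥ φ) ψ

/-- The diagonal block of an operator on `N ⊗ (L ⊗ W)` at a basis state of `N`. -/
def diagBlock {n ℓ w : ℕ}
    (M : Matrix (Bits (Fin n) × Bits (LW ℓ w)) (Bits (Fin n) × Bits (LW ℓ w)) ℂ)
    (a : Bits (Fin n)) : Matrix (Bits (LW ℓ w)) (Bits (LW ℓ w)) ℂ :=
  Matrix.of fun z z' => M (a, z) (a, z')

/-- Queries and gates do not change the basis state of `N`, so the diagonal blocks evolve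
independently, each with its own unitary `V a`. The output traces out `N` and sees only these
blocks, which reduces everything to pure states and a known unitary. -/
theorem diagBlock_extendOracle {n ℓ w : ℕ} (V : Bits (Fin n) → UGroup ℓ)
    (M : Matrix (Bits (Fin n) × Bits (LW ℓ w)) (Bits (Fin n) × Bits (LW ℓ w)) ℂ)
    (a : Bits (Fin n)) :
    diagBlock (extendOracle (conjBy (controlled V)) M) a =
      conjBy (liftL (V a).1) (diagBlock M a) := by
  ext z z'
  have hR : conjBy (liftL (V a).1) (diagBlock M a) z z' =
      ∑ y', star ((V a).1 (z' ∘ Sum.inl) y') * ∑ y, (V a).1 (z ∘ Sum.inl) y *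
        M (a, Sum.elim y (z ∘ Sum.inr)) (a, Sum.elim y' (z' ∘ Sum.inr)) := by
    have h1 : ∀ ζ', (liftL (w := w) (V a).1 * diagBlock M a) z ζ' = ∑ y, (V a).1 (z ∘ Sum.inl) y *
        M (a, Sum.elim y (z ∘ Sum.inr)) (a, ζ') := fun ζ' => by
      rw [Matrix.mul_apply, sum_liftL]; rfl
    have h2 := congrArg star (sum_liftL (V a).1 z' fun ζ' =>
      star ((liftL (w := w) (V a).1 * diagBlock M a) z ζ'))
    simp only [star_sum, star_mul', star_star] at h2
    rw [conjBy, Matrix.mul_apply]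
    simp only [Matrix.conjTranspose_apply]
    rw [← Finset.sum_congr rfl fun y' _ => congrArg _ (h1 _), ← h2]
    exact Finset.sum_congr rfl fun _ _ => mul_comm _ _
  rw [hR]
  simp only [diagBlock, extendOracle, conjBy, Matrix.of_apply, Matrix.mul_apply,
    Fintype.sum_prod_type, Matrix.conjTranspose_apply, controlled]
  rw [Finset.sum_eq_single a]
  · refine Finset.sum_congr rfl fun y' _ => ?_
    rw [Finset.sum_eq_single a]
    · simp only [if_true]
      rw [mul_comm]
    · intro b _ hb
      simp [Ne.symm hb]
    · simp
  · intro b _ hb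
    simp [Ne.symm hb]
  · simp

theorem diagBlock_foldl_extendGate {n ℓ w : ℕ} (c : List (Superop (Bits (LW ℓ w))))
    (M : Matrix (Bits (Fin n) × Bits (LW ℓ w)) (Bits (Fin n) × Bits (LW ℓ w)) ℂ)
    (a : Bits (Fin n)) :
    diagBlock (c.foldl (fun ρ h => extendGate h ρ) M) a =
      c.foldl (fun ρ h => h ρ) (diagBlock M a) := by
  induction c generalizing M with
  | nil => rfl
  | cons h c ih => exact ih _

theorem conjBy_one {ι : Type} [Fintype ι] [DecidableEq ι] (M : Matrix ι ι ℂ) :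
    conjBy 1 M = M := by simp [conjBy]

/-- The number of queries in a program of elementary operations. -/
def numQueries {Q : Type} (p : List (Op Q)) : ℕ :=
  (p.map fun o => match o with | .query => 1 | _ => 0).sum

@[simp] theorem numQueries_nil {Q : Type} : numQueries ([] : List (Op Q)) = 0 := rfl

@[simp] theorem numQueries_append {Q : Type} (p p' : List (Op Q)) :
    numQueries (p ++ p') = numQueries p + numQueries p' := by simp [numQueries]

theorem numQueries_cons {Q : Type} (o : Op Q) (p : List (Op Q)) :
    numQueries (o :: p) = numQueries [o] + numQueries p := numQueries_append [o] p

open Classical in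
/-- Each elementary operation is implemented by boundedly many symbols. -/
theorem exists_compile_op {𝒢 : GateFamily} {K : ℕ}
    (hK : ∀ (ℓ w : ℕ) (g : Superop (Bits (LW ℓ w))), IsHTCnot g →
      ∃ c : List (Superop (Bits (LW ℓ w))), c.length ≤ K ∧ (∀ h ∈ c, h ∈ 𝒢.gates ℓ w) ∧
        ∀ M, c.foldl (fun ρ h => h ρ) M = g M)
    {ℓ w : ℕ} (o : Op (LW ℓ w)) :
    ∃ c : List (Symb 𝒢 ℓ w), c.length ≤ K + 1 ∧ c.count Symb.query = numQueries [o] ∧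
      ∀ (n : ℕ) (V : Bits (Fin n) → UGroup ℓ) (LO : LabOracle n ℓ),
        LO.channel = conjBy (controlled V) → ∀ M a,
        diagBlock (c.foldl (fun ρ s => QUALM.step LO s ρ) M) a =
          conjBy (o.mat (V a).1) (diagBlock M a) := by
  have gate : ∀ (g : Superop (Bits (LW ℓ w))), IsHTCnot g →
      ∃ c : List (Symb 𝒢 ℓ w), c.length ≤ K + 1 ∧ c.count Symb.query = 0 ∧
      ∀ (n : ℕ) (LO : LabOracle n ℓ) M a,
        diagBlock (c.foldl (fun ρ s => QUALM.step LO s ρ) M) a = g (diagBlock M a) := by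
    intro g hg
    obtain ⟨c, hc, hcg, hM⟩ := hK ℓ w g hg
    refine ⟨c.attach.map fun h => Symb.gate h.1 (hcg _ h.2), by simpa using hc.trans (by omega),
      ?_, ?_⟩
    · rw [List.count_eq_zero]
      simp
    · intro n LO M a
      rw [List.foldl_map, ← hM, ← diagBlock_foldl_extendGate]
      conv_rhs => rw [← List.attach_map_subtype_val c, List.foldl_map]
      rfl
  cases o with
  | h i =>
    obtain ⟨c, h1, h2, h3⟩ := gate _ (.hadamard i)
    exact ⟨c, h1, h2, fun n V LO _ M a => h3 n LO M a⟩
  | t i =>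
    obtain ⟨c, h1, h2, h3⟩ := gate _ (.t i)
    exact ⟨c, h1, h2, fun n V LO _ M a => h3 n LO M a⟩
  | cnot i j =>
    -- With equal control and target the operation is the identity by convention; the empty program
    -- implements it, and universality speaks only of `i ≠ j`.
    by_cases hij : i = j
    · refine ⟨[], by simp, by simp [numQueries], fun n V LO _ M a => ?_⟩
      simp [Op.mat, hij, conjBy_one]
    · obtain ⟨c, h1, h2, h3⟩ := gate _ (.cnot i j hij)
      refine ⟨c, h1, h2, fun n V LO _ M a => ?_⟩
      rw [h3, Op.mat, if_neg hij]
  | query =>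
    -- A query costs one symbol, which `K` alone need not allow; hence the bound `K + 1`.
    refine ⟨[Symb.query], by simp, by simp [numQueries], fun n V LO hLO M a => ?_⟩
    simp only [List.foldl_cons, List.foldl_nil, QUALM.step, Op.mat]
    rw [hLO, diagBlock_extendOracle]

open Classical in
/-- Each elementary program is implemented by a program over the universal gates. -/
theorem exists_compile {𝒢 : GateFamily} {K : ℕ}
    (hK : ∀ (ℓ w : ℕ) (g : Superop (Bits (LW ℓ w))), IsHTCnot g →
      ∃ c : List (Superop (Bits (LW ℓ w))), c.length ≤ K ∧ (∀ h ∈ c, h ∈ 𝒢.gates ℓ w) ∧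
        ∀ M, c.foldl (fun ρ h => h ρ) M = g M)
    {ℓ w : ℕ} (p : List (Op (LW ℓ w))) :
    ∃ c : List (Symb 𝒢 ℓ w), c.length ≤ (K + 1) * p.length ∧
      c.count Symb.query = numQueries p ∧
      ∀ (n : ℕ) (V : Bits (Fin n) → UGroup ℓ) (LO : LabOracle n ℓ),
        LO.channel = conjBy (controlled V) → ∀ M a (κ : ℂ) (ψ : Bits (LW ℓ w) → ℂ),
        diagBlock M a = κ • vecMulVec ψ (star ψ) →
        diagBlock (c.foldl (fun ρ s => QUALM.step LO s ρ) M) a =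
          κ • vecMulVec (run (V a).1 p ψ) (star (run (V a).1 p ψ)) := by
  induction p with
  | nil => exact ⟨[], by simp, by simp, fun n V LO _ M a κ ψ h => h⟩
  | cons o p ih =>
    obtain ⟨c₁, h1, h2, h3⟩ := exists_compile_op hK o
    obtain ⟨c₂, h4, h5, h6⟩ := ih
    refine ⟨c₁ ++ c₂, ?_, ?_, ?_⟩
    · simp only [List.length_append, List.length_cons]
      linarith
    · rw [List.count_append, h2, h5, numQueries_cons o p]
    · intro n V LO hLO M a κ ψ h
      rw [List.foldl_append]
      refine h6 n V LO hLO _ a κ (o.mat (V a).1 *ᵥ ψ) ?_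
      rw [h3 n V LO hLO, h, conjBy, Matrix.mul_smul, Matrix.smul_mul, mul_vecMulVec, vecMulVec_mul,
        star_mulVec]

/-- The reduced density matrix of a state vector on the output qubits. -/
def reducedState {ℓ w q : ℕ} (out : Fin q ↪ Fin w) (ψ : Bits (LW ℓ w) → ℂ) :
    Matrix (Bits (Fin q)) (Bits (Fin q)) ℂ :=
  Matrix.of fun s t => ∑ z : Bits (LW ℓ w), ∑ z' : Bits (LW ℓ w),
    if (∀ k, z (Sum.inr (out k)) = s k) ∧ (∀ k, z' (Sum.inr (out k)) = t k) ∧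
        (∀ j, (∀ k, j ≠ Sum.inr (out k)) → z j = z' j)
    then ψ z * star (ψ z') else 0

open Classical in
/-- A program of elementary operations gives a QUALM, whose output is a mixture of reduced states. -/
theorem exists_qualm {𝒢 : GateFamily} {K : ℕ}
    (hK : ∀ (ℓ w : ℕ) (g : Superop (Bits (LW ℓ w))), IsHTCnot g →
      ∃ c : List (Superop (Bits (LW ℓ w))), c.length ≤ K ∧ (∀ h ∈ c, h ∈ 𝒢.gates ℓ w) ∧
        ∀ M, c.foldl (fun ρ h => h ρ) M = g M)
    {ℓ w q : ℕ} (p : List (Op (LW ℓ w))) (out : Fin q ↪ Fin w) :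
    ∃ Q : QUALM 𝒢 ℓ 0 q, Q.complexity ≤ (K + 1) * p.length ∧
      Q.queryComplexity = numQueries p ∧
      ∀ (n : ℕ) (V : Bits (Fin n) → UGroup ℓ) (LO : LabOracle n ℓ) (x : Bits (Fin 0)),
        LO.channel = conjBy (controlled V) → Q.output LO x =
          ∑ a, LO.state a a • reducedState out (run (V a).1 p (Pi.single 0 1)) := by
  obtain ⟨c, h1, h2, h3⟩ := exists_compile hK p
  refine ⟨⟨w, c, ⟨Fin.elim0, fun a => a.elim0⟩, out⟩, h1, ?_, ?_⟩
  · rw [← h2]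
    simp only [QUALM.queryComplexity]
  · intro n V LO x hLO
    set Q : QUALM 𝒢 ℓ 0 q := ⟨w, c, ⟨Fin.elim0, fun a => a.elim0⟩, out⟩
    have hinit : Q.initBits x = 0 := by
      funext j
      rcases j with j | j
      · rfl
      · change Function.extend Q.inp x 0 j = 0
        rw [Function.extend_apply']
        · rfl
        · rintro ⟨k, _⟩
          exact k.elim0
    have key : ∀ a z z', Q.finalState LO x (a, z) (a, z') = LO.state a a *
        (run (V a).1 p (Pi.single 0 1) z * star (run (V a).1 p (Pi.single 0 1) z')) := by
      intro a z z'
      -- The initial block at `a` is the projector on the zero state with weight `κ = ρ a a`.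
      have := h3 n V LO hLO (Q.initState LO x) a (LO.state a a) (Pi.single 0 1) (by
        ext y y'
        simp only [diagBlock, QUALM.initState, hinit, Matrix.of_apply, Matrix.kronecker,
          Matrix.kroneckerMap_apply, ketBra, Matrix.single_apply, Matrix.smul_apply,
          vecMulVec_apply, Pi.star_apply, Pi.single_apply, smul_eq_mul]
        by_cases h : y = 0 <;> by_cases h' : y' = 0 <;> simp [h, h', eq_comm])
      have h4 := congrFun (congrFun this z) z'
      exact h4
    ext s t
    rw [Matrix.sum_apply]
    simp only [QUALM.output, Matrix.of_apply, Matrix.smul_apply, reducedState, smul_eq_mul,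
      Finset.mul_sum, key, mul_ite, mul_zero]
    rfl

/-! ### The action of elementary and derived gates on state vectors -/

section GateAction

variable {Q : Type} [Fintype Q] [DecidableEq Q]

theorem oneQubitGate_mulVec (i : Q) (g : Matrix (Fin 2) (Fin 2) ℂ) (ψ : Bits Q → ℂ) (z : Bits Q) :
    (oneQubitGate i g *ᵥ ψ) z = ∑ b, g (z i) b * ψ (Function.update z i b) := by
  rw [Matrix.mulVec, dotProduct]
  symm
  refine Finset.sum_of_injOn (fun b => Function.update z i b) ?_ ?_ ?_ ?_
  · intro b _ b' _ h
    simpa using congrFun h i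
  · intro b _
    simp
  · intro y _ hy
    rw [oneQubitGate, Matrix.of_apply, if_neg, zero_mul]
    intro h
    apply hy
    refine ⟨y i, by simp, ?_⟩
    funext j
    by_cases hj : j = i
    · subst hj; simp
    · simp [hj, h j hj]
  · intro b _
    rw [oneQubitGate, Matrix.of_apply, if_pos]
    · simp
    · intro j hj
      simp [hj]

theorem cnotGate_mulVec {i j : Q} (hij : i ≠ j) (ψ : Bits Q → ℂ) (z : Bits Q) :
    (cnotGate i j *ᵥ ψ) z = ψ (Function.update z j (z j + z i)) := by
  rw [Matrix.mulVec, dotProduct, Finset.sum_eq_single (Function.update z j (z j + z i))]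
  · rw [cnotGate, Matrix.of_apply, if_pos, one_mul]
    funext k
    by_cases hk : k = j
    · subst hk
      have : ∀ a b : Fin 2, a = a + b + b := by decide
      simp [hij, ← this]
    · simp [hk]
  · intro y _ hy
    rw [cnotGate, Matrix.of_apply, if_neg, zero_mul]
    rintro rfl
    apply hy
    funext k
    by_cases hk : k = j
    · subst hk
      have : ∀ a b : Fin 2, a = a + b + b := by decide
      simp [hij, ← this]
    · simp [hk]
  · simp

end GateAction

section Programs

variable {ℓ w : ℕ} (U : Matrix (Bits (Fin ℓ)) (Bits (Fin ℓ)) ℂ)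

theorem run_append (p p' : List (Op (LW ℓ w))) (ψ : Bits (LW ℓ w) → ℂ) :
    run U (p ++ p') ψ = run U p' (run U p ψ) := List.foldl_append

theorem run_cons (o : Op (LW ℓ w)) (p : List (Op (LW ℓ w))) (ψ : Bits (LW ℓ w) → ℂ) :
    run U (o :: p) ψ = run U p (o.mat U *ᵥ ψ) := rfl

@[simp] theorem run_nil (ψ : Bits (LW ℓ w) → ℂ) : run U [] ψ = ψ := rfl

theorem mat_h_mulVec (i : LW ℓ w) (ψ : Bits (LW ℓ w) → ℂ) :
    (Op.h i).mat U *ᵥ ψ = fun z => ∑ b, _root_.hadamard (z i) b * ψ (Function.update z i b) :=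
  funext fun z => oneQubitGate_mulVec i _ ψ z

theorem mat_t_mulVec (i : LW ℓ w) (ψ : Bits (LW ℓ w) → ℂ) :
    (Op.t i).mat U *ᵥ ψ = fun z => tGate (z i) (z i) * ψ z := by
  funext z
  refine (oneQubitGate_mulVec i _ ψ z).trans ?_
  have h0 : tGate 0 1 = 0 := rfl
  have h1 : tGate 1 0 = 0 := rfl
  conv_rhs => rw [← Function.update_eq_self i z]
  rcases Fin.exists_fin_two.mp ⟨z i, rfl⟩ with h | h <;> simp [h, h0, h1]

theorem mat_cnot_mulVec {i j : LW ℓ w} (hij : i ≠ j) (ψ : Bits (LW ℓ w) → ℂ) :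
    (Op.cnot i j).mat U *ᵥ ψ = fun z => ψ (Function.update z j (z j + z i)) := by
  funext z
  rw [Op.mat, if_neg hij, cnotGate_mulVec hij]

theorem mat_query_mulVec (ψ : Bits (LW ℓ w) → ℂ) :
    Op.query.mat U *ᵥ ψ =
      fun z => ∑ y, U (z ∘ Sum.inl) y * ψ (Sum.elim y (z ∘ Sum.inr)) :=
  funext fun z => sum_liftL U z ψ

theorem tGate_pow_four (a : Fin 2) : tGate a a ^ 4 = if a = 1 then -1 else 1 := by
  rcases Fin.exists_fin_two.mp ⟨a, rfl⟩ with rfl | rfl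
  · simp [tGate]
  · simp only [tGate, if_true]
    change Complex.exp _ ^ 4 = _
    rw [← Complex.exp_nat_mul, ← Complex.exp_pi_mul_I]
    congr 1
    push_cast
    ring

theorem run_t_replicate (i : LW ℓ w) (k : ℕ) (ψ : Bits (LW ℓ w) → ℂ) :
    run U (List.replicate k (.t i)) ψ = fun z => tGate (z i) (z i) ^ k * ψ z := by
  induction k generalizing ψ with
  | zero => simp
  | succ k ih =>
    rw [List.replicate_succ, run_cons, ih, mat_t_mulVec]
    funext z
    rw [pow_succ, mul_assoc]

/-- The Pauli `Z` gate. -/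
def pauliZ {Q : Type} (i : Q) : List (Op Q) := List.replicate 4 (.t i)

/-- The Pauli `X` gate. -/
def pauliX {Q : Type} (i : Q) : List (Op Q) := .h i :: (pauliZ i ++ [.h i])

theorem run_pauliZ (i : LW ℓ w) (ψ : Bits (LW ℓ w) → ℂ) :
    run U (pauliZ i) ψ = fun z => (if z i = 1 then -1 else 1) * ψ z := by
  rw [pauliZ, run_t_replicate]
  simp_rw [tGate_pow_four]

theorem hadamard_sq : (1 / (Real.sqrt 2 : ℂ)) * (1 / (Real.sqrt 2 : ℂ)) = 1 / 2 := by
  rw [div_mul_div_comm, ← Complex.ofReal_mul, Real.mul_self_sqrt (by norm_num)]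
  norm_num

theorem hadamard_apply (a b : Fin 2) :
    _root_.hadamard a b = (1 / (Real.sqrt 2 : ℂ)) * if a = 1 ∧ b = 1 then -1 else 1 := by
  rcases Fin.exists_fin_two.mp ⟨a, rfl⟩ with rfl | rfl <;>
    rcases Fin.exists_fin_two.mp ⟨b, rfl⟩ with rfl | rfl <;> simp [_root_.hadamard]

/-- Conjugating by Hadamard gates turns a sign that is controlled by the target into a flip. -/
theorem run_conj_h (i : LW ℓ w) (p : List (Op (LW ℓ w))) (f : Bits (LW ℓ w) → Fin 2)
    (hf : ∀ z b, f (Function.update z i b) = f z)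
    (hp : ∀ ψ, run U p ψ = fun z => (if z i = 1 ∧ f z = 1 then -1 else 1) * ψ z)
    (ψ : Bits (LW ℓ w) → ℂ) :
    run U (.h i :: (p ++ [.h i])) ψ = fun z => ψ (Function.update z i (z i + f z)) := by
  rw [run_cons, run_append, run_cons, run_nil, hp, mat_h_mulVec, mat_h_mulVec]
  funext z
  have hz : ψ (Function.update z i (z i + f z)) =
      (1 / (Real.sqrt 2 : ℂ)) * (1 / (Real.sqrt 2 : ℂ)) *
        (2 * ψ (Function.update z i (z i + f z))) := by
    rw [hadamard_sq]; ring
  rw [hz]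
  simp only [Fin.sum_univ_two, hadamard_apply, Function.update_self, Function.update_idem, hf]
  rcases Fin.exists_fin_two.mp ⟨z i, rfl⟩ with h | h <;>
    rcases Fin.exists_fin_two.mp ⟨f z, rfl⟩ with h' | h' <;> simp [h, h'] <;> ring

theorem run_pauliX (i : LW ℓ w) (ψ : Bits (LW ℓ w) → ℂ) :
    run U (pauliX i) ψ = fun z => ψ (Function.update z i (z i + 1)) :=
  run_conj_h U i _ (fun _ => 1) (fun _ _ => rfl) (fun ψ => by simp [run_pauliZ]) ψ

/-- The doubly controlled sign. -/
def ccz {Q : Type} (a b c : Q) : List (Op Q) :=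
  [.t a, .t b, .t c, .cnot a b] ++ (List.replicate 7 (.t b) ++ ([.cnot a b, .cnot a c] ++
    (List.replicate 7 (.t c) ++ ([.cnot b c, .t c, .cnot a c] ++
      (List.replicate 7 (.t c) ++ [.cnot b c])))))

/-- Phase polynomial: for bits, `4abc = a + b + c - (a⊕b) - (a⊕c) - (b⊕c) + (a⊕b⊕c)`. The CNOTs
write each parity on a wire, where `T` or `T⁷ = T⁻¹` adds its eighth of a turn. -/
theorem run_ccz {a b c : LW ℓ w} (hab : a ≠ b) (hac : a ≠ c) (hbc : b ≠ c)
    (ψ : Bits (LW ℓ w) → ℂ) :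
    run U (ccz a b c) ψ = fun z => (if z c = 1 ∧ z a * z b = 1 then -1 else 1) * ψ z := by
  have h4 : tGate 1 1 ^ 4 = -1 := tGate_pow_four 1
  have h0 : tGate 0 0 = 1 := rfl
  simp only [ccz, run_append, run_t_replicate, run_cons, run_nil, mat_t_mulVec,
    mat_cnot_mulVec U hab, mat_cnot_mulVec U hac, mat_cnot_mulVec U hbc]
  funext z
  have hz : ψ (Function.update (Function.update z b (z b)) c (z c)) = ψ z := by simp
  simp only [Function.update_idem, Function.update_self, Function.update_of_ne hab,
    Function.update_of_ne hac, Function.update_of_ne hbc, Function.update_of_ne hbc.symm,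
    Function.update_comm hbc.symm]
  rcases Fin.exists_fin_two.mp ⟨z a, rfl⟩ with ha | ha <;>
    rcases Fin.exists_fin_two.mp ⟨z b, rfl⟩ with hb | hb <;>
    rcases Fin.exists_fin_two.mp ⟨z c, rfl⟩ with hc | hc <;>
    rw [hb, hc] at hz <;> simp [ha, hb, hc, h0, hz]
  -- The accumulated phase is `x⁴ = -1` if all three bits are set and `x¹⁶ = 1` if one or two are,
  -- with `x¹⁶ - 1 = (x⁴ + 1)(x¹² - x⁸ + x⁴ - 1)`.
  all_goals
    generalize tGate 1 1 = x at h4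
    first
      | linear_combination (x ^ 12 - x ^ 8 + x ^ 4 - 1) * ψ z * h4
      | linear_combination ψ z * h4

/-- The Toffoli gate with controls `a`, `b` and target `c`. -/
def toffoli {Q : Type} (a b c : Q) : List (Op Q) := .h c :: (ccz a b c ++ [.h c])

theorem run_toffoli {a b c : LW ℓ w} (hab : a ≠ b) (hac : a ≠ c) (hbc : b ≠ c)
    (ψ : Bits (LW ℓ w) → ℂ) :
    run U (toffoli a b c) ψ = fun z => ψ (Function.update z c (z c + z a * z b)) :=
  run_conj_h U c _ (fun z => z a * z b) (fun z x => by simp [hac, hbc])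
    (fun ψ => run_ccz U hab hac hbc ψ) ψ

/-- The target `c` is flipped if one of `a`, `b` is set. -/
def orGate {Q : Type} (a b c : Q) : List (Op Q) := toffoli a b c ++ [.cnot a c, .cnot b c]

/-- Modulo 2, `a ∨ b = ab + a + b`: one Toffoli gate and two CNOTs. -/
theorem run_orGate {a b c : LW ℓ w} (hab : a ≠ b) (hac : a ≠ c) (hbc : b ≠ c)
    (ψ : Bits (LW ℓ w) → ℂ) :
    run U (orGate a b c) ψ =
      fun z => ψ (Function.update z c (z c + if z a = 0 ∧ z b = 0 then 0 else 1)) := by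
  rw [orGate, run_append, run_cons, run_cons, run_nil, run_toffoli U hab hac hbc,
    mat_cnot_mulVec U hac, mat_cnot_mulVec U hbc]
  funext z
  simp only [Function.update_idem, Function.update_self, Function.update_of_ne hac,
    Function.update_of_ne hbc]
  congr 2
  generalize z a = x, z b = y, z c = u
  revert x y u
  decide

end Programs

/-! ### Algebra of one-qubit gates, unitarity and symmetry of the elementary operations -/

section OneQubitAlgebra

variable {Q : Type} [Fintype Q] [DecidableEq Q]

theorem ext_mulVec {ι : Type} [Fintype ι] [DecidableEq ι] {A B : Matrix ι ι ℂ}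
    (h : ∀ v, A *ᵥ v = B *ᵥ v) : A = B :=
  Matrix.toLin'.injective (LinearMap.ext fun v => by simpa using h v)

theorem oneQubitGate_mul (i : Q) (g g' : Matrix (Fin 2) (Fin 2) ℂ) :
    oneQubitGate i g * oneQubitGate i g' = oneQubitGate i (g * g') := by
  refine ext_mulVec fun v => ?_
  rw [← Matrix.mulVec_mulVec]
  funext z
  simp only [oneQubitGate_mulVec, Function.update_self, Function.update_idem, Matrix.mul_apply,
    Finset.mul_sum, Finset.sum_mul]
  rw [Finset.sum_comm]
  simp only [mul_assoc]

theorem oneQubitGate_comm {i j : Q} (hij : i ≠ j) (g g' : Matrix (Fin 2) (Fin 2) ℂ) :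
    oneQubitGate i g * oneQubitGate j g' = oneQubitGate j g' * oneQubitGate i g := by
  refine ext_mulVec fun v => ?_
  rw [← Matrix.mulVec_mulVec, ← Matrix.mulVec_mulVec]
  funext z
  simp only [oneQubitGate_mulVec, Function.update_of_ne hij, Function.update_of_ne hij.symm,
    Finset.mul_sum]
  rw [Finset.sum_comm]
  refine Finset.sum_congr rfl fun b _ => Finset.sum_congr rfl fun b' _ => ?_
  rw [Function.update_comm hij]
  ring

theorem oneQubitGate_one (i : Q) : oneQubitGate i (1 : Matrix (Fin 2) (Fin 2) ℂ) = 1 := by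
  refine ext_mulVec fun v => ?_
  funext z
  rw [oneQubitGate_mulVec, Matrix.one_mulVec, Finset.sum_eq_single (z i)]
  · simp
  · intro b _ hb
    simp [Ne.symm hb]
  · simp

theorem oneQubitGate_neg (i : Q) (g : Matrix (Fin 2) (Fin 2) ℂ) :
    oneQubitGate i (-g) = -oneQubitGate i g := by
  ext x y
  simp only [oneQubitGate, Matrix.of_apply, Matrix.neg_apply]
  split_ifs <;> simp

theorem oneQubitGate_transpose (i : Q) (g : Matrix (Fin 2) (Fin 2) ℂ) :
    (oneQubitGate i g)ᵀ = oneQubitGate i gᵀ := by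
  ext x y
  simp only [oneQubitGate, Matrix.of_apply, Matrix.transpose_apply, eq_comm]

theorem oneQubitGate_conjTranspose (i : Q) (g : Matrix (Fin 2) (Fin 2) ℂ) :
    (oneQubitGate i g)ᴴ = oneQubitGate i gᴴ := by
  ext x y
  simp only [oneQubitGate, Matrix.of_apply, Matrix.conjTranspose_apply, eq_comm]
  split_ifs <;> simp

end OneQubitAlgebra

section Unitarity

variable {ℓ w : ℕ}

theorem hadamard_transpose : (_root_.hadamard)ᵀ = _root_.hadamard := by
  ext a b
  rw [Matrix.transpose_apply, hadamard_apply, hadamard_apply]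
  simp only [and_comm]

theorem tGate_transpose : tGateᵀ = tGate := by
  ext a b
  rcases Fin.exists_fin_two.mp ⟨a, rfl⟩ with rfl | rfl <;>
    rcases Fin.exists_fin_two.mp ⟨b, rfl⟩ with rfl | rfl <;> rfl

theorem cnotGate_transpose {Q : Type} [Fintype Q] [DecidableEq Q] {i j : Q} (hij : i ≠ j) :
    (cnotGate i j)ᵀ = cnotGate i j := by
  have h : ∀ x y : Bits Q, x = Function.update y j (y j + y i) →
      y = Function.update x j (x j + x i) := by
    rintro x y rfl
    have : ∀ a b : Fin 2, a + b + b = a := by decide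
    simp [hij, this]
  ext x y
  simp only [cnotGate, Matrix.transpose_apply, Matrix.of_apply]
  exact if_congr ⟨h _ _, h _ _⟩ rfl rfl

theorem hadamard_unitary : (_root_.hadamard)ᴴ * _root_.hadamard = 1 := by
  have hs : star (1 / (Real.sqrt 2 : ℂ)) = 1 / (Real.sqrt 2 : ℂ) := by simp
  have h2 : (1 / (Real.sqrt 2 : ℂ)) ^ 2 = 1 / 2 := by rw [pow_two, hadamard_sq]
  ext a b
  simp only [Matrix.mul_apply, Matrix.conjTranspose_apply, hadamard_apply, star_mul', hs,
    Fin.sum_univ_two]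
  rcases Fin.exists_fin_two.mp ⟨a, rfl⟩ with rfl | rfl <;>
    rcases Fin.exists_fin_two.mp ⟨b, rfl⟩ with rfl | rfl <;> simp at h2 ⊢ <;> ring_nf <;>
    simp [h2]

theorem tGate_unitary : tGateᴴ * tGate = 1 := by
  have h : star (Complex.exp (Complex.I * Real.pi / 4)) * Complex.exp (Complex.I * Real.pi / 4)
      = 1 := by
    rw [Complex.star_def, ← Complex.exp_conj, ← Complex.exp_add, ← Complex.exp_zero]
    congr 1
    have h4 : (starRingEnd ℂ) 4 = 4 := map_ofNat _ 4
    simp [h4]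
    ring
  ext a b
  rcases Fin.exists_fin_two.mp ⟨a, rfl⟩ with rfl | rfl <;>
    rcases Fin.exists_fin_two.mp ⟨b, rfl⟩ with rfl | rfl <;>
    simp [tGate, Matrix.mul_apply] at h ⊢
  exact h

/-- Because `H`, `T` and CNOT are symmetric, reversing the order of a query-free program transposes
it. This lets preparations be run backwards without inverse gates. -/
theorem Op.mat_transpose (U : Matrix (Bits (Fin ℓ)) (Bits (Fin ℓ)) ℂ) {o : Op (LW ℓ w)}
    (ho : o ≠ .query) : (o.mat U)ᵀ = o.mat U := by
  cases o with
  | h i => simp [Op.mat, oneQubitGate_transpose, hadamard_transpose]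
  | t i => simp [Op.mat, oneQubitGate_transpose, tGate_transpose]
  | cnot i j =>
    by_cases hij : i = j
    · simp [Op.mat, hij]
    · simp [Op.mat, hij, cnotGate_transpose]
  | query => exact absurd rfl ho

theorem liftL_unitary {U : Matrix (Bits (Fin ℓ)) (Bits (Fin ℓ)) ℂ} (hU : Uᴴ * U = 1) :
    (liftL (w := w) U)ᴴ * liftL U = 1 := by
  have hmul : ∀ V V' : Matrix (Bits (Fin ℓ)) (Bits (Fin ℓ)) ℂ,
      liftL (w := w) V * liftL V' = liftL (V * V') := by
    intro V V'
    refine ext_mulVec fun v => ?_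
    rw [← Matrix.mulVec_mulVec]
    funext z
    refine (sum_liftL V z _).trans (Eq.trans ?_ (sum_liftL (V * V') z v).symm)
    have : ∀ y, (liftL V' *ᵥ v) (Sum.elim y (z ∘ Sum.inr)) =
        ∑ y', V' y y' * v (Sum.elim y' (z ∘ Sum.inr)) := fun y => sum_liftL V' _ v
    simp only [this, Matrix.mul_apply, Finset.mul_sum, Finset.sum_mul]
    rw [Finset.sum_comm]
    simp only [mul_assoc]
  have hstar : (liftL (w := w) U)ᴴ = liftL Uᴴ := by
    ext z z'
    simp only [liftL, Matrix.conjTranspose_apply, Matrix.of_apply, eq_comm]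
    split_ifs <;> simp
  rw [hstar, hmul, hU]
  refine ext_mulVec fun v => ?_
  funext z
  refine (sum_liftL 1 z v).trans ?_
  simp [Matrix.one_apply]

theorem Op.mat_unitary {U : Matrix (Bits (Fin ℓ)) (Bits (Fin ℓ)) ℂ} (hU : Uᴴ * U = 1)
    (o : Op (LW ℓ w)) : (o.mat U)ᴴ * o.mat U = 1 := by
  cases o with
  | h i => simp [Op.mat, oneQubitGate_conjTranspose, oneQubitGate_mul, hadamard_unitary,
      oneQubitGate_one]
  | t i => simp [Op.mat, oneQubitGate_conjTranspose, oneQubitGate_mul, tGate_unitary,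
      oneQubitGate_one]
  | cnot i j =>
    by_cases hij : i = j
    · simp [Op.mat, hij]
    · have h1 : (cnotGate i j)ᴴ = cnotGate i j := by
        conv_rhs => rw [← cnotGate_transpose hij]
        ext x y
        simp only [cnotGate, Matrix.conjTranspose_apply, Matrix.transpose_apply, Matrix.of_apply]
        split_ifs <;> simp
      simp only [Op.mat, hij, if_false, h1]
      refine ext_mulVec fun v => ?_
      rw [← Matrix.mulVec_mulVec]
      funext z
      have : ∀ a b : Fin 2, a + b + b = a := by decide
      simp [cnotGate_mulVec hij, hij, this]
  | query => exact liftL_unitary hU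

/-- The squared norm of a state vector. -/
def normSq {ι : Type} [Fintype ι] (ψ : ι → ℂ) : ℝ := ∑ z, ‖ψ z‖ ^ 2

theorem ofReal_normSq {ι : Type} [Fintype ι] (ψ : ι → ℂ) : (normSq ψ : ℂ) = star ψ ⬝ᵥ ψ := by
  simp only [normSq, dotProduct, Pi.star_apply, Complex.ofReal_sum, Complex.ofReal_pow]
  refine Finset.sum_congr rfl fun z _ => ?_
  rw [Complex.star_def, Complex.conj_mul']

theorem normSq_mulVec {ι : Type} [Fintype ι] [DecidableEq ι] {A : Matrix ι ι ℂ} (hA : Aᴴ * A = 1)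
    (ψ : ι → ℂ) : normSq (A *ᵥ ψ) = normSq ψ := by
  have h : (normSq (A *ᵥ ψ) : ℂ) = normSq ψ := by
    rw [ofReal_normSq, ofReal_normSq, star_mulVec, ← Matrix.dotProduct_mulVec,
      Matrix.mulVec_mulVec, hA, Matrix.one_mulVec]
  exact_mod_cast h

theorem normSq_smul {ι : Type} [Fintype ι] (c : ℂ) (ψ : ι → ℂ) :
    normSq (c • ψ) = ‖c‖ ^ 2 * normSq ψ := by
  simp [normSq, Finset.mul_sum, mul_pow]

theorem normSq_single {ι : Type} [Fintype ι] [DecidableEq ι] (s : ι) :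
    normSq (Pi.single s 1 : ι → ℂ) = 1 := by
  rw [normSq, Finset.sum_eq_single s]
  · simp
  · intro z _ hz
    simp [hz]
  · simp

theorem normSq_run {U : Matrix (Bits (Fin ℓ)) (Bits (Fin ℓ)) ℂ} (hU : Uᴴ * U = 1)
    (p : List (Op (LW ℓ w))) (ψ : Bits (LW ℓ w) → ℂ) : normSq (run U p ψ) = normSq ψ := by
  induction p generalizing ψ with
  | nil => rfl
  | cons o p ih => rw [run_cons, ih, normSq_mulVec (Op.mat_unitary hU o)]

theorem run_smul (U : Matrix (Bits (Fin ℓ)) (Bits (Fin ℓ)) ℂ) (p : List (Op (LW ℓ w))) (c : ℂ)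
    (ψ : Bits (LW ℓ w) → ℂ) : run U p (c • ψ) = c • run U p ψ := by
  induction p generalizing ψ with
  | nil => rfl
  | cons o p ih => rw [run_cons, Matrix.mulVec_smul, ih, run_cons]

/-- Without queries, the reversed program is the transpose. -/
theorem dotProduct_run_reverse (U : Matrix (Bits (Fin ℓ)) (Bits (Fin ℓ)) ℂ)
    {p : List (Op (LW ℓ w))} (hp : Op.query ∉ p) (f g : Bits (LW ℓ w) → ℂ) :
    f ⬝ᵥ run U p.reverse g = run U p f ⬝ᵥ g := by
  induction p generalizing f with
  | nil => rfl
  | cons o p ih =>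
    rw [List.mem_cons, not_or] at hp
    rw [List.reverse_cons, run_append, run_cons, run_nil, run_cons, ← ih hp.2,
      Matrix.dotProduct_mulVec, ← Matrix.mulVec_transpose, Op.mat_transpose U (Ne.symm hp.1)]

end Unitarity

/-! ### Projection onto the value 0 of a flag qubit -/

section Restriction

variable {ℓ w : ℕ}

/-- The component of a state vector in which the qubit `q` has the value `0`. -/
def restrict {Q : Type} (q : Q) (ψ : Bits Q → ℂ) : Bits Q → ℂ :=
  fun z => if z q = 0 then ψ z else 0

/-- The qubit `q` is not changed in the computational basis. -/
def Op.Avoids (q : LW ℓ w) : Op (LW ℓ w) → Prop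
  | .h i => i ≠ q
  | .t _ => True
  | .cnot _ j => j ≠ q
  | .query => ∀ i, q ≠ Sum.inl i

/-- The operation is block diagonal with respect to the value of `q`, so it commutes with the
projection onto `q = 0`. A flag can therefore be treated as if it were measured when written,
although it is read only at the end. -/
theorem Op.Avoids.mulVec_restrict {q : LW ℓ w} {o : Op (LW ℓ w)} (ho : o.Avoids q)
    (U : Matrix (Bits (Fin ℓ)) (Bits (Fin ℓ)) ℂ) (ψ : Bits (LW ℓ w) → ℂ) :
    o.mat U *ᵥ restrict q ψ = restrict q (o.mat U *ᵥ ψ) := by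
  cases o with
  | h i =>
    have hi : q ≠ i := Ne.symm ho
    rw [mat_h_mulVec, mat_h_mulVec]
    funext z
    simp only [restrict, Function.update_of_ne hi]
    split_ifs <;> simp
  | t i =>
    rw [mat_t_mulVec, mat_t_mulVec]
    funext z
    simp only [restrict]
    split_ifs <;> simp
  | cnot i j =>
    by_cases hij : i = j
    · simp [Op.mat, hij]
    · have hj : q ≠ j := Ne.symm ho
      rw [mat_cnot_mulVec U hij, mat_cnot_mulVec U hij]
      funext z
      simp only [restrict, Function.update_of_ne hj]
  | query =>
    obtain q | q := q
    · exact absurd rfl (ho q)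
    · rw [mat_query_mulVec, mat_query_mulVec]
      funext z
      have h : ∀ y, restrict (Sum.inr q) ψ (Sum.elim y (z ∘ Sum.inr)) =
          if z (Sum.inr q) = 0 then ψ (Sum.elim y (z ∘ Sum.inr)) else 0 := fun _ => rfl
      rw [Finset.sum_congr rfl fun y _ => congrArg _ (h y)]
      by_cases hz : z (Sum.inr q) = 0
      · simp [restrict, hz]
      · simp [restrict, hz]

theorem run_restrict {q : LW ℓ w} {p : List (Op (LW ℓ w))} (hp : ∀ o ∈ p, o.Avoids q)
    (U : Matrix (Bits (Fin ℓ)) (Bits (Fin ℓ)) ℂ) (ψ : Bits (LW ℓ w) → ℂ) :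
    run U p (restrict q ψ) = restrict q (run U p ψ) := by
  induction p generalizing ψ with
  | nil => rfl
  | cons o p ih =>
    rw [List.forall_mem_cons] at hp
    rw [run_cons, hp.1.mulVec_restrict, ih hp.2, run_cons]

/-- The state vector is supported on `q = 0`. -/
def ZeroAt {Q : Type} (q : Q) (ψ : Bits Q → ℂ) : Prop := ∀ z, z q ≠ 0 → ψ z = 0

theorem zeroAt_iff {Q : Type} (q : Q) (ψ : Bits Q → ℂ) : ZeroAt q ψ ↔ restrict q ψ = ψ := by
  constructor
  · intro h
    funext z
    by_cases hz : z q = 0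
    · simp [restrict, hz]
    · simp [restrict, hz, h z hz]
  · intro h z hz
    rw [← h]
    simp [restrict, hz]

theorem ZeroAt.run {q : LW ℓ w} {p : List (Op (LW ℓ w))} (hp : ∀ o ∈ p, o.Avoids q)
    (U : Matrix (Bits (Fin ℓ)) (Bits (Fin ℓ)) ℂ) {ψ : Bits (LW ℓ w) → ℂ} (hψ : ZeroAt q ψ) :
    ZeroAt q (run U p ψ) := by
  rw [zeroAt_iff] at hψ ⊢
  rw [← run_restrict hp, hψ]

end Restriction

/-! ### The comparison of two applications of the oracle -/

section Comparison

variable {ℓ w : ℕ} (A : Fin ℓ ↪ Fin w)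

/-- All bits of `L` and of the register `A` are set to zero. -/
def zeroLA (z : Bits (LW ℓ w)) : Bits (LW ℓ w) :=
  Sum.elim 0 fun j => if ∃ i, A i = j then 0 else z (Sum.inr j)

/-- The state vector that is given by a matrix on `L ⊗ A` and by `φ` on the other qubits. -/
def tens (M : Matrix (Bits (Fin ℓ)) (Bits (Fin ℓ)) ℂ) (φ : Bits (LW ℓ w) → ℂ) :
    Bits (LW ℓ w) → ℂ :=
  fun z => M (z ∘ Sum.inl) (fun i => z (Sum.inr (A i))) * φ (zeroLA A z)

/-- The qubit `q` belongs neither to `L` nor to `A`. -/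
def OffLA (q : LW ℓ w) : Prop := ∀ i, q ≠ Sum.inl i ∧ q ≠ Sum.inr (A i)

/-- The state vector is zero on `L` and `A`. -/
def ZeroLA (φ : Bits (LW ℓ w) → ℂ) : Prop :=
  ∀ i, ZeroAt (Sum.inl i) φ ∧ ZeroAt (Sum.inr (A i)) φ

variable {A}

theorem zeroLA_of_zero {z : Bits (LW ℓ w)} (hL : ∀ i, z (Sum.inl i) = 0)
    (hA : ∀ i, z (Sum.inr (A i)) = 0) : zeroLA A z = z := by
  funext q
  obtain q | q := q
  · exact (hL q).symm
  · change (if ∃ i, A i = q then 0 else z (Sum.inr q)) = _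
    split_ifs with h
    · obtain ⟨i, rfl⟩ := h
      exact (hA i).symm
    · rfl

theorem update_inl_comp (z : Bits (LW ℓ w)) (i : Fin ℓ) (b : Fin 2) :
    Function.update z (Sum.inl i) b ∘ Sum.inl = Function.update (z ∘ Sum.inl) i b :=
  Function.update_comp_eq_of_injective z Sum.inl_injective i b

theorem update_inr_comp (z : Bits (LW ℓ w)) (j : Fin w) (b : Fin 2) :
    Function.update z (Sum.inr j) b ∘ Sum.inl = z ∘ Sum.inl := by
  funext i; simp

theorem update_inr_reg (z : Bits (LW ℓ w)) (i : Fin ℓ) (b : Fin 2) :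
    (fun k => Function.update z (Sum.inr (A i)) b (Sum.inr (A k))) =
      Function.update (fun k => z (Sum.inr (A k))) i b :=
  Function.update_comp_eq_of_injective z (Sum.inr_injective.comp A.injective) i b

theorem update_inl_reg (z : Bits (LW ℓ w)) (i : Fin ℓ) (b : Fin 2) :
    (fun k => Function.update z (Sum.inl i) b (Sum.inr (A k))) = fun k => z (Sum.inr (A k)) := by
  funext k; simp

theorem zeroLA_update_inl (z : Bits (LW ℓ w)) (i : Fin ℓ) (b : Fin 2) :
    zeroLA A (Function.update z (Sum.inl i) b) = zeroLA A z := by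
  funext q
  obtain q | q := q <;> simp [zeroLA]

theorem zeroLA_update_inr (z : Bits (LW ℓ w)) (i : Fin ℓ) (b : Fin 2) :
    zeroLA A (Function.update z (Sum.inr (A i)) b) = zeroLA A z := by
  funext q
  obtain q | q := q
  · rfl
  · simp only [zeroLA, Sum.elim_inr]
    split_ifs with h
    · rfl
    · rw [Function.update_of_ne]
      rintro hq
      exact h ⟨i, (Sum.inr_injective hq).symm⟩

variable (U : Matrix (Bits (Fin ℓ)) (Bits (Fin ℓ)) ℂ)
  (M : Matrix (Bits (Fin ℓ)) (Bits (Fin ℓ)) ℂ) (φ : Bits (LW ℓ w) → ℂ)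

theorem mat_h_mulVec_tens (i : Fin ℓ) :
    (Op.h (Sum.inl i)).mat U *ᵥ tens A M φ =
      tens A (Matrix.of fun x y => ∑ b, _root_.hadamard (x i) b * M (Function.update x i b) y) φ := by
  rw [mat_h_mulVec]
  funext z
  simp only [tens, Matrix.of_apply, update_inl_comp, update_inl_reg, zeroLA_update_inl,
    Finset.sum_mul, mul_assoc, Function.comp_apply]

theorem mat_cnot_mulVec_tens (i : Fin ℓ) :
    (Op.cnot (Sum.inl i) (Sum.inr (A i))).mat U *ᵥ tens A M φ =
      tens A (Matrix.of fun x y => M x (Function.update y i (y i + x i))) φ := by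
  rw [mat_cnot_mulVec U Sum.inl_ne_inr]
  funext z
  simp only [tens, Matrix.of_apply, update_inr_comp, update_inr_reg, zeroLA_update_inr,
    Function.comp_apply]

theorem run_pauliX_tens (i : Fin ℓ) :
    run U (pauliX (Sum.inl i)) (tens A M φ) =
      tens A (Matrix.of fun x y => M (Function.update x i (x i + 1)) y) φ := by
  rw [run_pauliX]
  funext z
  simp only [tens, Matrix.of_apply, update_inl_comp, update_inl_reg, zeroLA_update_inl,
    Function.comp_apply]

theorem run_pauliZ_tens (i : Fin ℓ) :
    run U (pauliZ (Sum.inl i)) (tens A M φ) =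
      tens A (Matrix.of fun x y => (if x i = 1 then -1 else 1) * M x y) φ := by
  rw [run_pauliZ]
  funext z
  simp only [tens, Matrix.of_apply, Function.comp_apply, mul_assoc]

theorem mat_query_mulVec_tens :
    Op.query.mat U *ᵥ tens A M φ = tens A (U * M) φ := by
  rw [mat_query_mulVec]
  funext z
  have h : ∀ y : Bits (Fin ℓ), zeroLA A (Sum.elim y (z ∘ Sum.inr)) = zeroLA A z := fun y => by
    funext q
    obtain q | q := q <;> rfl
  have h2 : ∀ y : Bits (Fin ℓ), tens A M φ (Sum.elim y (z ∘ Sum.inr)) =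
      M y (fun i => z (Sum.inr (A i))) * φ (zeroLA A z) := fun y => by
    rw [← h y]; rfl
  rw [Finset.sum_congr rfl fun y _ => congrArg _ (h2 y)]
  simp only [tens, Matrix.mul_apply, Finset.sum_mul, mul_assoc]

theorem tens_single {φ : Bits (LW ℓ w) → ℂ} (hφ : ZeroLA A φ) :
    tens A (Matrix.single 0 0 1) φ = φ := by
  funext z
  rw [tens, Matrix.single_apply]
  split_ifs with h
  · rw [one_mul, zeroLA_of_zero (fun i => congrFun h.1.symm i) fun i => congrFun h.2.symm i]
  · rw [zero_mul]
    by_contra h'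
    apply h
    constructor
    · funext i
      by_contra hz
      exact h' ((hφ i).1 z (Ne.symm hz)).symm
    · funext i
      by_contra hz
      exact h' ((hφ i).2 z (Ne.symm hz)).symm

variable (A) in
/-- The preparation of Bell pairs of qubits of `L` and `A`. -/
def bellOps (l : List (Fin ℓ)) : List (Op (LW ℓ w)) :=
  l.flatMap fun i => [.h (Sum.inl i), .cnot (Sum.inl i) (Sum.inr (A i))]

theorem run_bellOps_aux {φ : Bits (LW ℓ w) → ℂ} (hφ : ZeroLA A φ) (l : List (Fin ℓ))
    (hl : l.Nodup) :
    run U (bellOps A l) φ = tens A (Matrix.of fun x y =>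
      if ∀ i, if i ∈ l then x i = y i else x i = 0 ∧ y i = 0
      then (1 / (Real.sqrt 2 : ℂ)) ^ l.length else 0) φ := by
  -- Induction from the end of the list makes the new pair the last to be acted on, so its gates
  -- apply to a state that is already known.
  induction l using List.reverseRecOn with
  | nil =>
    conv_lhs => rw [← tens_single hφ]
    change tens _ _ _ = _
    congr 1
    ext x y
    simp only [Matrix.single_apply, Matrix.of_apply, List.not_mem_nil, if_false, List.length_nil,
      pow_zero, forall_and]
    refine if_congr ?_ rfl rfl
    simp only [eq_comm (a := (0 : Bits (Fin ℓ))), funext_iff, Pi.zero_apply]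
  | append_singleton l i ih =>
    have hl' := List.nodup_append.mp hl
    have hi : i ∉ l := fun h => hl'.2.2 i h i (by simp) rfl
    have hb : bellOps A (l ++ [i]) =
        bellOps A l ++ [.h (Sum.inl i), .cnot (Sum.inl i) (Sum.inr (A i))] := by
      simp [bellOps]
    rw [hb, run_append, ih hl'.1, run_cons, run_cons, run_nil, mat_h_mulVec_tens,
      mat_cnot_mulVec_tens]
    congr 1
    ext x y
    simp only [Matrix.of_apply, Fin.sum_univ_two]
    -- Before the new gates the pair `i` is in the state zero. Hence the summand `b = 1` of the
    -- Hadamard gate vanishes, and in the summand `b = 0` the CNOT turns the condition on `A i` into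
    -- `x i = y i`.
    have h1 : ¬ ∀ k, if k ∈ l then Function.update x i 1 k = Function.update y i (y i + x i) k
        else Function.update x i 1 k = 0 ∧ Function.update y i (y i + x i) k = 0 := by
      intro h
      simpa [hi] using h i
    have h2 : (∀ k, if k ∈ l then Function.update x i 0 k = Function.update y i (y i + x i) k
        else Function.update x i 0 k = 0 ∧ Function.update y i (y i + x i) k = 0) ↔
        ∀ k, if k ∈ l ++ [i] then x k = y k else x k = 0 ∧ y k = 0 := by
      refine forall_congr' fun k => ?_
      by_cases hk : k = i
      · subst hk
        have : ∀ a b : Fin 2, b + a = 0 ↔ a = b := by decide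
        simp [hi, this]
      · simp [hk]
    rw [if_neg h1, if_congr h2 rfl rfl, mul_zero, add_zero, hadamard_apply]
    simp [pow_succ', mul_ite]

theorem run_bellOps {φ : Bits (LW ℓ w) → ℂ} (hφ : ZeroLA A φ) :
    run U (bellOps A (List.finRange ℓ)) φ = tens A ((1 / (Real.sqrt 2 : ℂ)) ^ ℓ • 1) φ := by
  rw [run_bellOps_aux U hφ _ (List.nodup_finRange ℓ)]
  congr 1
  ext x y
  simp [Matrix.one_apply, funext_iff]

variable (A) in
/-- The program `p` prepares the matrix `B` on `L ⊗ A`. -/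
structure Prepares (B : Matrix (Bits (Fin ℓ)) (Bits (Fin ℓ)) ℂ) (p : List (Op (LW ℓ w))) :
    Prop where
  query_notMem : Op.query ∉ p
  avoids : ∀ q, OffLA A q → ∀ o ∈ p, o.Avoids q
  run_eq : ∀ U φ, ZeroLA A φ → run U p φ = tens A ((1 / (Real.sqrt 2 : ℂ)) ^ ℓ • B) φ

theorem OffLA.bellOps {q : LW ℓ w} (hq : OffLA A q) (l : List (Fin ℓ)) :
    ∀ o ∈ bellOps A l, o.Avoids q := by
  intro o ho
  simp only [_root_.bellOps, List.mem_flatMap, List.mem_cons, List.not_mem_nil, or_false] at ho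
  obtain ⟨i, _, rfl | rfl⟩ := ho
  · exact (hq i).1.symm
  · exact (hq i).2.symm

theorem query_notMem_bellOps (l : List (Fin ℓ)) : Op.query ∉ bellOps A l := by
  simp [bellOps]

theorem prepares_one : Prepares A 1 (bellOps A (List.finRange ℓ)) where
  query_notMem := query_notMem_bellOps _
  avoids _ hq := hq.bellOps _
  run_eq U _ hφ := run_bellOps U hφ

theorem mem_pauliX {Q : Type} {i : Q} {o : Op Q} (ho : o ∈ pauliX i) : o = .h i ∨ o = .t i := by
  simp only [pauliX, pauliZ, List.mem_cons, List.mem_append, List.mem_replicate,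
    List.not_mem_nil, or_false] at ho
  tauto

theorem mem_pauliZ {Q : Type} {i : Q} {o : Op Q} (ho : o ∈ pauliZ i) : o = .t i :=
  (List.mem_replicate.mp ho).2

end Comparison

section SymplecticPreparation

variable {m w : ℕ} (A : Fin (m + 1) ↪ Fin w)

/-- The preparation of the symplectic form on `L ⊗ A`. -/
def sympOps : List (Op (LW (m + 1) w)) :=
  bellOps A (List.finRange (m + 1)) ++ (pauliX (Sum.inl 0) ++ pauliZ (Sum.inl 0))

/-- Since `iσ^y = Z X`, the matrix `J` arises from the identity by `X` and then `Z` on the first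
qubit of `L`. -/
theorem prepares_matJ : Prepares A (matJ (m + 1)) (sympOps A) where
  query_notMem h := by
    rw [sympOps, List.mem_append, List.mem_append] at h
    obtain h | h | h := h
    · exact query_notMem_bellOps _ h
    · obtain h | h := mem_pauliX h <;> cases h
    · cases mem_pauliZ h
  avoids q hq o ho := by
    rw [sympOps, List.mem_append, List.mem_append] at ho
    obtain h | h | h := ho
    · exact hq.bellOps _ o h
    · obtain rfl | rfl := mem_pauliX h
      · exact (hq 0).1.symm
      · trivial
    · obtain rfl := mem_pauliZ h
      trivial
  run_eq U φ hφ := by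
    rw [sympOps, run_append, run_append, run_bellOps U hφ, run_pauliX_tens, run_pauliZ_tens]
    congr 1
    ext x y
    simp only [Matrix.of_apply, Matrix.smul_apply, matJ, Matrix.one_apply, smul_eq_mul]
    have key : Function.update x 0 (x 0 + 1) = y ↔ x 0 + 1 = y 0 ∧ Fin.tail x = Fin.tail y := by
      simp only [funext_iff, Fin.tail]
      constructor
      · intro h
        exact ⟨by simpa using h 0, fun i => by simpa using h i.succ⟩
      · rintro ⟨h0, h⟩ i
        refine Fin.cases ?_ (fun j => ?_) i
        · simpa using h0
        · simpa using h j
    rw [if_congr key rfl rfl]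
    by_cases ht : Fin.tail x = Fin.tail y <;>
      rcases Fin.exists_fin_two.mp ⟨x 0, rfl⟩ with hx | hx <;>
      rcases Fin.exists_fin_two.mp ⟨y 0, rfl⟩ with hy | hy <;> simp [ht, hx, hy]

end SymplecticPreparation

/-! ### Exchange of registers, and the amplitude of one comparison -/

section Swap

variable {ℓ w : ℕ} (A : Fin ℓ ↪ Fin w)

/-- The exchange of qubits of `L` with those of the register `A`. -/
def swapOps (l : List (Fin ℓ)) : List (Op (LW ℓ w)) :=
  l.flatMap fun i => [.cnot (Sum.inl i) (Sum.inr (A i)), .cnot (Sum.inr (A i)) (Sum.inl i),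
    .cnot (Sum.inl i) (Sum.inr (A i))]

/-- The permutation of the qubits that is effected by `swapOps`. -/
def swapIdx : List (Fin ℓ) → LW ℓ w → LW ℓ w
  | [], q => q
  | i :: l, q => swapIdx l (Equiv.swap (Sum.inl i) (Sum.inr (A i)) q)

theorem swapIdx_off {l : List (Fin ℓ)} {q : LW ℓ w}
    (hq : ∀ i ∈ l, q ≠ Sum.inl i ∧ q ≠ Sum.inr (A i)) : swapIdx A l q = q := by
  induction l with
  | nil => rfl
  | cons i l ih =>
    rw [List.forall_mem_cons] at hq
    rw [swapIdx, Equiv.swap_apply_of_ne_of_ne hq.1.1 hq.1.2, ih hq.2]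

theorem swapIdx_mem {l : List (Fin ℓ)} (hl : l.Nodup) {i : Fin ℓ} (hi : i ∈ l) :
    swapIdx A l (Sum.inl i) = Sum.inr (A i) ∧ swapIdx A l (Sum.inr (A i)) = Sum.inl i := by
  induction l with
  | nil => simp at hi
  | cons j l ih =>
    rw [List.nodup_cons] at hl
    by_cases hij : i = j
    · subst hij
      have hne : ∀ k ∈ l, i ≠ k := fun k hk h => hl.1 (h ▸ hk)
      rw [swapIdx, swapIdx, Equiv.swap_apply_left, Equiv.swap_apply_right]
      exact ⟨swapIdx_off A fun k hk => ⟨Sum.inr_ne_inl, fun h =>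
        hne k hk (A.injective (Sum.inr_injective h))⟩,
        swapIdx_off A fun k hk => ⟨fun h => hne k hk (Sum.inl_injective h), Sum.inl_ne_inr⟩⟩
    · have hi' : i ∈ l := (List.mem_cons.mp hi).resolve_left hij
      rw [swapIdx, swapIdx, Equiv.swap_apply_of_ne_of_ne (by simpa using hij) Sum.inl_ne_inr,
        Equiv.swap_apply_of_ne_of_ne Sum.inr_ne_inl (by simpa using hij)]
      exact ih hl.2 hi'

variable (U : Matrix (Bits (Fin ℓ)) (Bits (Fin ℓ)) ℂ)

theorem run_swap (a b : LW ℓ w) (hab : a ≠ b) (ψ : Bits (LW ℓ w) → ℂ) :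
    run U [.cnot a b, .cnot b a, .cnot a b] ψ = fun z => ψ (z ∘ Equiv.swap a b) := by
  rw [run_cons, run_cons, run_cons, run_nil, mat_cnot_mulVec U hab, mat_cnot_mulVec U hab.symm,
    mat_cnot_mulVec U hab]
  funext z
  dsimp only
  congr 1
  have h1 : ∀ x y : Fin 2, x + (y + x) = y := by decide
  have h2 : ∀ x y : Fin 2, y + x + y = x := by decide
  funext q
  by_cases hqa : q = a
  · subst hqa
    simp [hab, hab.symm, h1]
  · by_cases hqb : q = b
    · subst hqb
      simp [hab, hab.symm, h1, h2]
    · simp [hqa, hqb, Equiv.swap_apply_of_ne_of_ne]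

theorem run_swapOps (l : List (Fin ℓ)) (ψ : Bits (LW ℓ w) → ℂ) :
    run U (swapOps A l) ψ = fun z => ψ (z ∘ swapIdx A l) := by
  induction l generalizing ψ with
  | nil => rfl
  | cons i l ih =>
    have : swapOps A (i :: l) = [.cnot (Sum.inl i) (Sum.inr (A i)),
      .cnot (Sum.inr (A i)) (Sum.inl i), .cnot (Sum.inl i) (Sum.inr (A i))] ++ swapOps A l := rfl
    rw [this, run_append, run_swap U _ _ Sum.inl_ne_inr, ih]
    rfl

/-- The oracle acts on `L` only; transposition is what brings the second index of the matrix within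
its reach. -/
theorem run_swapOps_tens (M : Matrix (Bits (Fin ℓ)) (Bits (Fin ℓ)) ℂ) (φ : Bits (LW ℓ w) → ℂ) :
    run U (swapOps A (List.finRange ℓ)) (tens A M φ) = tens A Mᵀ φ := by
  rw [run_swapOps]
  funext z
  have h := fun i => swapIdx_mem A (List.nodup_finRange ℓ) (List.mem_finRange i)
  have h1 : (z ∘ swapIdx A (List.finRange ℓ)) ∘ Sum.inl = fun i => z (Sum.inr (A i)) :=
    funext fun i => congrArg z (h i).1
  have h2 : (fun i => (z ∘ swapIdx A (List.finRange ℓ)) (Sum.inr (A i))) = z ∘ Sum.inl :=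
    funext fun i => congrArg z (h i).2
  have h3 : zeroLA A (z ∘ swapIdx A (List.finRange ℓ)) = zeroLA A z := by
    funext q
    obtain q | q := q
    · rfl
    · simp only [zeroLA, Sum.elim_inr, Function.comp_apply]
      split_ifs with hq
      · rfl
      · rw [swapIdx_off]
        exact fun i _ => ⟨Sum.inr_ne_inl, fun h => hq ⟨i, (Sum.inr_injective h).symm⟩⟩
  simp only [tens, h1, h2, h3, Matrix.transpose_apply]

variable {A} in
theorem OffLA.swapOps {q : LW ℓ w} (hq : OffLA A q) (l : List (Fin ℓ)) :
    ∀ o ∈ swapOps A l, o.Avoids q := by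
  intro o ho
  simp only [_root_.swapOps, List.mem_flatMap, List.mem_cons, List.not_mem_nil, or_false] at ho
  obtain ⟨i, _, rfl | rfl | rfl⟩ := ho
  · exact (hq i).2.symm
  · exact (hq i).1.symm
  · exact (hq i).2.symm

theorem zeroAt_inl_swapOps {ψ : Bits (LW ℓ w) → ℂ} (i : Fin ℓ)
    (hψ : ZeroAt (Sum.inr (A i)) ψ) :
    ZeroAt (Sum.inl i) (run U (swapOps A (List.finRange ℓ)) ψ) := by
  intro z hz
  rw [run_swapOps]
  refine hψ _ ?_
  rwa [Function.comp_apply, (swapIdx_mem A (List.nodup_finRange ℓ) (List.mem_finRange i)).2]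

/-- The two applications of the oracle to the two halves of the prepared state, and the reversed
preparation. -/
def compareOps (p : List (Op (LW ℓ w))) : List (Op (LW ℓ w)) :=
  p ++ ([.query] ++ (swapOps A (List.finRange ℓ) ++ ([.query] ++ p.reverse)))

/-- The amplitude for finding the prepared state again. -/
def amp (B : Matrix (Bits (Fin ℓ)) (Bits (Fin ℓ)) ℂ) (U : Matrix (Bits (Fin ℓ)) (Bits (Fin ℓ)) ℂ) :
    ℂ :=
  (1 / 2 : ℂ) ^ ℓ * (Bᵀ * (U * Bᵀ * Uᵀ)).trace

/-- Only basis states that agree with `z` outside `L` and `A` contribute. They are parametrised by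
their values on `L` and `A` (`glue`), and the sum over these is the bilinear trace form. -/
theorem sum_tens_mul_tens (M N : Matrix (Bits (Fin ℓ)) (Bits (Fin ℓ)) ℂ)
    (φ : Bits (LW ℓ w) → ℂ) {z : Bits (LW ℓ w)} (hL : ∀ i, z (Sum.inl i) = 0)
    (hA : ∀ i, z (Sum.inr (A i)) = 0) :
    tens A M (Pi.single z 1) ⬝ᵥ tens A N φ = (Mᵀ * N).trace * φ z := by
  let glue : Bits (Fin ℓ) × Bits (Fin ℓ) → Bits (LW ℓ w) := fun v =>
    Sum.elim v.1 (Function.extend A v.2 (z ∘ Sum.inr))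
  have hg1 : ∀ v, glue v ∘ Sum.inl = v.1 := fun v => rfl
  have hg2 : ∀ v, (fun i => glue v (Sum.inr (A i))) = v.2 := fun v =>
    funext fun i => A.injective.extend_apply _ _ _
  have hg3 : ∀ v, zeroLA A (glue v) = z := fun v => by
    conv_rhs => rw [← zeroLA_of_zero hL hA]
    funext q
    obtain q | q := q
    · rfl
    · simp only [zeroLA, Sum.elim_inr, glue]
      split_ifs with hq
      · rfl
      · exact Function.extend_apply' _ _ _ hq
  have hsum : ∑ v : Bits (Fin ℓ) × Bits (Fin ℓ), M v.1 v.2 * N v.1 v.2 * φ z =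
      tens A M (Pi.single z 1) ⬝ᵥ tens A N φ := by
    refine Finset.sum_of_injOn glue ?_ ?_ ?_ ?_
    · intro v _ v' _ h
      refine Prod.ext ?_ ?_
      · rw [← hg1 v, h, hg1]
      · rw [← hg2 v, h, hg2]
    · intro v _
      simp
    · intro y _ hy
      have : zeroLA A y ≠ z := by
        intro h
        apply hy
        refine ⟨(y ∘ Sum.inl, fun i => y (Sum.inr (A i))), by simp, ?_⟩
        funext q
        obtain q | q := q
        · rfl
        · simp only [glue, Sum.elim_inr]
          by_cases hq : ∃ i, A i = q
          · obtain ⟨i, rfl⟩ := hq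
            exact A.injective.extend_apply _ _ _
          · rw [Function.extend_apply' _ _ _ hq, ← h]
            simp [zeroLA, hq]
      simp [tens, this]
    · intro v _
      simp only [tens, hg1, hg2, hg3, Pi.single_eq_same]
      ring
  rw [← hsum, ← Finset.sum_mul, Fintype.sum_prod_type, Finset.sum_comm]
  simp only [Matrix.trace, Matrix.diag, Matrix.mul_apply, Matrix.transpose_apply]

/-- After the second query the matrix is `U Bᵀ Uᵀ` up to normalisation. Only components with `L` and
`A` at zero are needed, because all others set a flag. -/
theorem run_compareOps {B : Matrix (Bits (Fin ℓ)) (Bits (Fin ℓ)) ℂ} {p : List (Op (LW ℓ w))}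
    (hp : Prepares A B p) {φ : Bits (LW ℓ w) → ℂ} (hφ : ZeroLA A φ) {z : Bits (LW ℓ w)}
    (hL : ∀ i, z (Sum.inl i) = 0) (hA : ∀ i, z (Sum.inr (A i)) = 0) :
    run U (compareOps A p) φ z = amp B U * φ z := by
  have hs : ∀ (M : Matrix (Bits (Fin ℓ)) (Bits (Fin ℓ)) ℂ) (ψ : Bits (LW ℓ w) → ℂ),
      run U [.query] (tens A M ψ) = tens A (U * M) ψ := fun M ψ => mat_query_mulVec_tens U M ψ
  have hz : ZeroLA A (Pi.single z 1 : Bits (LW ℓ w) → ℂ) := by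
    refine fun i => ⟨fun y hy => ?_, fun y hy => ?_⟩
    · rw [Pi.single_eq_of_ne]
      rintro rfl
      exact hy (hL i)
    · rw [Pi.single_eq_of_ne]
      rintro rfl
      exact hy (hA i)
  rw [compareOps, run_append, run_append, run_append, run_append, hp.run_eq U φ hφ, hs,
    run_swapOps_tens, hs]
  -- The component at `z` is the pairing with the basis vector at `z`; the reversed preparation is
  -- moved to that side as a transpose, where it prepares `B` again. The pairing is bilinear, so no
  -- complex conjugate of `B` appears.
  refine (single_one_dotProduct z _).symm.trans ?_
  rw [dotProduct_run_reverse U hp.query_notMem,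
    hp.run_eq U _ hz, sum_tens_mul_tens A _ _ _ hL hA, amp]
  congr 1
  simp only [Matrix.transpose_smul, Matrix.transpose_mul, Matrix.mul_smul, Matrix.smul_mul,
    Matrix.trace_smul, smul_smul, smul_eq_mul, ← mul_pow, hadamard_sq]
  congr 2
  simp only [Matrix.mul_assoc]

variable {A} in
theorem OffLA.compareOps {q : LW ℓ w} (hq : OffLA A q)
    {B : Matrix (Bits (Fin ℓ)) (Bits (Fin ℓ)) ℂ} {p : List (Op (LW ℓ w))}
    (hp : Prepares A B p) : ∀ o ∈ compareOps A p, o.Avoids q := by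
  intro o ho
  simp only [_root_.compareOps, List.mem_append, List.mem_reverse, List.mem_singleton] at ho
  obtain h | rfl | h | rfl | h := ho
  · exact hp.avoids q hq o h
  · exact fun i => (hq i).1
  · exact hq.swapOps _ o h
  · exact fun i => (hq i).1
  · exact hp.avoids q hq o h

end Swap

/-! ### Recording whether some qubit is set -/

section Chain

variable {ℓ w : ℕ} (r : ℕ → LW ℓ w)

/-- The chain of OR gates that collects the qubits of a list in the flags `r`. -/
def chainOps : List (LW ℓ w) → ℕ → List (Op (LW ℓ w))
  | [], _ => []
  | q :: l, k => orGate (r k) q (r (k + 1)) ++ chainOps l (k + 1)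

theorem mem_orGate {Q : Type} {a b c : Q} {o : Op Q} (ho : o ∈ orGate a b c) :
    o = .h c ∨ (∃ i, o = .t i) ∨ (∃ i, o = .cnot i c) ∨ o = .cnot a b := by
  simp only [orGate, toffoli, ccz, List.mem_cons, List.mem_append, List.mem_replicate,
    List.not_mem_nil, or_false] at ho
  aesop

theorem chainOps_avoids {q : LW ℓ w} (l : List (LW ℓ w)) (k : ℕ)
    (hl : ∀ x ∈ l, x ≠ q) (hr : ∀ j, k < j → j ≤ k + l.length → r j ≠ q) :
    ∀ o ∈ chainOps r l k, o.Avoids q := by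
  induction l generalizing k with
  | nil => simp [chainOps]
  | cons x l ih =>
    rw [List.forall_mem_cons] at hl
    rw [List.length_cons] at hr
    intro o ho
    rw [chainOps, List.mem_append] at ho
    have hk := hr (k + 1) (by omega) (by omega)
    obtain ho | ho := ho
    · obtain rfl | ⟨i, rfl⟩ | ⟨i, rfl⟩ | rfl := mem_orGate ho
      · exact hk
      · trivial
      · exact hk
      · exact hl.1
    · exact ih (k + 1) hl.2 (fun j h1 h2 => hr j (by omega) (by omega)) o ho

/-- Along the chain a flag once set stays set. If the last flag is 0, all earlier ones are 0 as
well; on such basis states every gate acts trivially, so the amplitude is unchanged. -/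
theorem run_chainOps (U : Matrix (Bits (Fin ℓ)) (Bits (Fin ℓ)) ℂ) {N : ℕ}
    (hr : Set.InjOn r (Set.Iic N)) (l : List (LW ℓ w)) (k : ℕ) (hk : k + l.length ≤ N)
    (hl : ∀ x ∈ l, ∀ j, x ≠ r j) {ψ : Bits (LW ℓ w) → ℂ}
    (hψ : ∀ j, k < j → j ≤ k + l.length → ZeroAt (r j) ψ) {z : Bits (LW ℓ w)}
    (hz : z (r (k + l.length)) = 0) :
    run U (chainOps r l k) ψ z = if z (r k) = 0 ∧ ∀ x ∈ l, z x = 0 then ψ z else 0 := by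
  induction l generalizing k ψ with
  | nil =>
    rw [List.length_nil, add_zero] at hz
    simp [chainOps, hz]
  | cons x l ih =>
    rw [List.forall_mem_cons] at hl
    rw [List.length_cons] at hk hψ hz
    have hne : ∀ j, j ≤ N → j ≠ k + 1 → r j ≠ r (k + 1) := fun j hj hjk h =>
      hjk (hr (Set.mem_Iic.mpr hj) (Set.mem_Iic.mpr (by omega)) h)
    have h1 := run_orGate U (hl.1 k).symm (hne k (by omega) (by omega)) (hl.1 (k + 1)) ψ
    have hψ1 : ∀ j, k + 1 < j → j ≤ k + 1 + l.length →
        ZeroAt (r j) (run U (orGate (r k) x (r (k + 1))) ψ) := by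
      intro j hj1 hj2 y hy
      rw [h1]
      refine hψ j (by omega) (by omega) _ ?_
      rwa [Function.update_of_ne (hne j (by omega) (by omega))]
    rw [chainOps, run_append, ih (k + 1) (by omega) hl.2 hψ1 (by rwa [show k + 1 + l.length =
      k + (l.length + 1) by omega]), h1]
    have h0 := hψ (k + 1) (by omega) (by omega)
    -- The first gate leaves `z` fixed if neither control is set. Otherwise it maps `z` to a basis
    -- state with `r (k + 1)` set, where `ψ` vanishes because that flag is fresh.
    by_cases hz1 : z (r (k + 1)) = 0
    · dsimp only
      by_cases hor : z (r k) = 0 ∧ z x = 0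
      · have hu : Function.update z (r (k + 1)) 0 = z := by
          rw [← hz1, Function.update_eq_self]
        rw [hz1, if_pos hor, add_zero, hu]
        exact if_congr ⟨fun h => ⟨hor.1, List.forall_mem_cons.mpr ⟨hor.2, h.2⟩⟩,
          fun h => ⟨rfl, (List.forall_mem_cons.mp h.2).2⟩⟩ rfl rfl
      · have hu : ψ (Function.update z (r (k + 1)) 1) = 0 := h0 _ (by simp)
        rw [hz1, if_neg hor, zero_add, hu, ite_self, if_neg]
        exact fun h => hor ⟨h.1, (List.forall_mem_cons.mp h.2).1⟩
    · rw [if_neg (fun h => hz1 h.1), h0 z hz1, ite_self]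

end Chain

/-! ### Repeated comparisons -/

section Stage

variable {ℓ w : ℕ} (A : Fin ℓ ↪ Fin w) (r : ℕ → LW ℓ w) (p : List (Op (LW ℓ w)))

/-- The qubits of `L` and `A`. -/
def srcs : List (LW ℓ w) :=
  (List.finRange ℓ).map Sum.inl ++ (List.finRange ℓ).map fun i => Sum.inr (A i)

theorem length_srcs : (srcs A).length = 2 * ℓ := by simp [srcs]; omega

theorem mem_srcs {q : LW ℓ w} : q ∈ srcs A ↔ ¬ OffLA A q := by
  simp only [srcs, OffLA, List.mem_append, List.mem_map, List.mem_finRange, true_and, not_forall,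
    not_and_or, not_not, ← exists_or, eq_comm]

/-- The program for `t` comparisons. -/
def stageOps : ℕ → List (Op (LW ℓ w))
  | 0 => []
  | t + 1 => stageOps t ++ (compareOps A p ++ chainOps r (srcs A) (2 * ℓ * t))

variable {A r p}

theorem stageOps_avoids {B : Matrix (Bits (Fin ℓ)) (Bits (Fin ℓ)) ℂ} (hp : Prepares A B p)
    {q : LW ℓ w} (hq : OffLA A q) (t : ℕ) (hr : ∀ j, j ≤ 2 * ℓ * t → r j ≠ q) :
    ∀ o ∈ stageOps A r p t, o.Avoids q := by
  induction t with
  | zero => simp [stageOps]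
  | succ t ih =>
    have ht : 2 * ℓ * t + 2 * ℓ = 2 * ℓ * (t + 1) := by ring
    intro o ho
    rw [stageOps, List.mem_append, List.mem_append] at ho
    obtain h | h | h := ho
    · exact ih (fun j hj => hr j (by omega)) o h
    · exact hq.compareOps hp o h
    · refine chainOps_avoids r _ _ ?_ ?_ o h
      · rintro x hx rfl
        exact (mem_srcs A).mp hx hq
      · intro j _ hj
        rw [length_srcs] at hj
        exact hr j (by omega)

/-- Each comparison uses `2ℓ` fresh flags, one for every qubit of `L` and `A`, and its chain starts
from the last flag of the preceding comparison. On the branch where this flag is 0 the state is `φ`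
again up to a factor, so the amplitudes multiply. -/
theorem run_stageOps (U : Matrix (Bits (Fin ℓ)) (Bits (Fin ℓ)) ℂ)
    {B : Matrix (Bits (Fin ℓ)) (Bits (Fin ℓ)) ℂ} (hp : Prepares A B p) {t : ℕ}
    (hr : Set.InjOn r (Set.Iic (2 * ℓ * t))) (hoff : ∀ j, OffLA A (r j))
    {φ : Bits (LW ℓ w) → ℂ} (hφ : ZeroLA A φ) (hφr : ∀ j, j ≤ 2 * ℓ * t → ZeroAt (r j) φ)
    (j : ℕ) (hj : j ≤ t) :
    (∀ i, 2 * ℓ * j < i → i ≤ 2 * ℓ * t → ZeroAt (r i) (run U (stageOps A r p j) φ)) ∧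
      restrict (r (2 * ℓ * j)) (run U (stageOps A r p j) φ) = amp B U ^ j • φ := by
  have hmono : ∀ {a b : ℕ}, a ≤ b → 2 * ℓ * a ≤ 2 * ℓ * b := fun h => Nat.mul_le_mul_left _ h
  have hav : ∀ i k, k < i → i ≤ 2 * ℓ * t → ∀ j, j ≤ k → r j ≠ r i := by
    intro i k hki hi j hjk h
    have := hr (Set.mem_Iic.mpr (by omega)) (Set.mem_Iic.mpr hi) h
    omega
  constructor
  · intro i hi hit
    exact (hφr i hit).run (stageOps_avoids hp (hoff i) j (hav i _ hi hit)) U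
  · induction j with
    | zero =>
      rw [pow_zero, one_smul]
      exact (zeroAt_iff _ _).mp (hφr _ (by simp))
    | succ j ih =>
      have ih := ih (by omega)
      have hjt := hmono hj
      have hjs : 2 * ℓ * j + 2 * ℓ = 2 * ℓ * (j + 1) := by ring
      set ψ := run U (stageOps A r p j) φ with hψ
      have hχ : ∀ i, 2 * ℓ * j < i → i ≤ 2 * ℓ * t →
          ZeroAt (r i) (run U (compareOps A p) ψ) := fun i hi hit =>
        ((hφr i hit).run (stageOps_avoids hp (hoff i) j (hav i _ hi hit)) U).run
          ((hoff i).compareOps hp) U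
      -- The comparison does not touch the flag, so projecting first is allowed; by induction it
      -- then acts on a multiple of `φ`.
      have hres : restrict (r (2 * ℓ * j)) (run U (compareOps A p) ψ) =
          amp B U ^ j • run U (compareOps A p) φ := by
        rw [← run_restrict ((hoff _).compareOps hp), ih, run_smul]
      rw [stageOps, run_append, run_append, ← hψ]
      funext z
      by_cases hz : z (r (2 * ℓ * (j + 1))) = 0
      · rw [restrict, if_pos hz, run_chainOps r U hr _ _ (by rw [length_srcs]; omega)
          (fun x hx k h => (mem_srcs A).mp hx (h ▸ hoff k))
          (fun i h1 h2 => hχ i h1 (by rw [length_srcs] at h2; omega))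
          (by rwa [length_srcs, hjs]), Pi.smul_apply, smul_eq_mul]
        split_ifs with h
        · have hL : ∀ i, z (Sum.inl i) = 0 := fun i => h.2 _ (by simp [srcs])
          have hA : ∀ i, z (Sum.inr (A i)) = 0 := fun i => h.2 _ (by simp [srcs])
          have h2 := congrFun hres z
          rw [restrict, if_pos h.1, Pi.smul_apply, run_compareOps A U hp hφ hL hA] at h2
          rw [h2, smul_eq_mul, pow_succ, mul_assoc]
        -- If the chain rejects `z`, then a qubit of `L` or `A`, or the old flag, is set; there `φ`
        -- vanishes as well.
        · have hφz : φ z = 0 := by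
            by_contra hφz
            apply h
            constructor
            · by_contra h'
              exact hφz (hφr _ (by omega) z h')
            · intro x hx
              by_contra h'
              simp only [srcs, List.mem_append, List.mem_map, List.mem_finRange, true_and] at hx
              obtain ⟨i, rfl⟩ | ⟨i, rfl⟩ := hx
              · exact hφz ((hφ i).1 z h')
              · exact hφz ((hφ i).2 z h')
          rw [hφz, mul_zero]
      · rw [restrict, if_neg hz, Pi.smul_apply, hφr _ hjt z hz, smul_zero]

end Stage

/-! ### The complete program -/

section Resources

variable {ℓ w : ℕ}

theorem numQueries_eq_zero {Q : Type} {p : List (Op Q)} (hp : Op.query ∉ p) :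
    numQueries p = 0 := by
  induction p with
  | nil => rfl
  | cons o p ih =>
    rw [List.mem_cons, not_or] at hp
    rw [numQueries_cons, ih hp.2]
    cases o with
    | query => exact absurd rfl hp.1
    | _ => rfl

theorem numQueries_chainOps (r : ℕ → LW ℓ w) (l : List (LW ℓ w)) (k : ℕ) :
    numQueries (chainOps r l k) = 0 := by
  induction l generalizing k with
  | nil => rfl
  | cons q l ih =>
    rw [chainOps, numQueries_append, ih, numQueries_eq_zero]
    intro h
    obtain h | ⟨i, h⟩ | ⟨i, h⟩ | h := mem_orGate h <;> cases h

theorem numQueries_swapOps (A : Fin ℓ ↪ Fin w) (l : List (Fin ℓ)) :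
    numQueries (swapOps A l) = 0 :=
  numQueries_eq_zero (by simp [swapOps])

theorem numQueries_stageOps {A : Fin ℓ ↪ Fin w} {r : ℕ → LW ℓ w} {p : List (Op (LW ℓ w))}
    (hp : Op.query ∉ p) (t : ℕ) : numQueries (stageOps A r p t) = 2 * t := by
  induction t with
  | zero => rfl
  | succ t ih =>
    have hq : numQueries ([Op.query] : List (Op (LW ℓ w))) = 1 := rfl
    simp only [stageOps, compareOps, numQueries_append, ih, numQueries_chainOps,
      numQueries_swapOps, numQueries_eq_zero hp,
      numQueries_eq_zero (fun h => hp (List.mem_reverse.mp h)), hq]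
    ring

theorem length_chainOps (r : ℕ → LW ℓ w) (l : List (LW ℓ w)) (k : ℕ) :
    (chainOps r l k).length = 35 * l.length := by
  induction l generalizing k with
  | nil => rfl
  | cons q l ih =>
    rw [chainOps, List.length_append, ih, List.length_cons]
    simp [orGate, toffoli, ccz]
    ring

theorem length_swapOps (A : Fin ℓ ↪ Fin w) (l : List (Fin ℓ)) :
    (swapOps A l).length = 3 * l.length := by
  simp [swapOps, List.length_flatMap, mul_comm]

theorem length_bellOps (A : Fin ℓ ↪ Fin w) (l : List (Fin ℓ)) :
    (bellOps A l).length = 2 * l.length := by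
  simp [bellOps, List.length_flatMap, mul_comm]

theorem length_stageOps (A : Fin ℓ ↪ Fin w) (r : ℕ → LW ℓ w) (p : List (Op (LW ℓ w))) (t : ℕ) :
    (stageOps A r p t).length = t * (2 * p.length + 73 * ℓ + 2) := by
  induction t with
  | zero => simp [stageOps]
  | succ t ih =>
    simp only [stageOps, compareOps, List.length_append, ih, length_chainOps, length_srcs,
      length_swapOps, List.length_finRange, List.length_reverse, List.length_singleton]
    ring

end Resources

/-! ### Probabilities of the output flags -/

section Flags

variable {ℓ w : ℕ}

/-- The probability of finding the value `1` in the qubit `q`. -/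
def flagWeight {Q : Type} [Fintype Q] [DecidableEq Q] (q : Q) (ψ : Bits Q → ℂ) : ℝ :=
  ∑ z : Bits Q, if z q = 1 then ‖ψ z‖ ^ 2 else 0

theorem flagWeight_pauliX (U : Matrix (Bits (Fin ℓ)) (Bits (Fin ℓ)) ℂ) (q : LW ℓ w)
    (ψ : Bits (LW ℓ w) → ℂ) :
    flagWeight q (run U (pauliX q) ψ) = normSq (restrict q ψ) := by
  let flip : Bits (LW ℓ w) ≃ Bits (LW ℓ w) := Function.Involutive.toPerm
    (fun z => Function.update z q (z q + 1)) (fun z => by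
      have : ∀ a : Fin 2, a + 1 + 1 = a := by decide
      simp [this])
  rw [normSq, ← flip.sum_comp, flagWeight, run_pauliX]
  refine Finset.sum_congr rfl fun z _ => ?_
  have h : (flip z) q = z q + 1 := Function.update_self ..
  have h' : ∀ a : Fin 2, a = 1 ↔ a + 1 = 0 := by decide
  rw [restrict, h]
  by_cases hz : z q = 1
  · rw [if_pos hz, if_pos ((h' _).mp hz)]
    rfl
  · rw [if_neg hz, if_neg (fun h => hz ((h' _).mpr h))]
    simp

theorem pauliX_avoids {q q' : LW ℓ w} (h : q ≠ q') : ∀ o ∈ pauliX q, o.Avoids q' := by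
  intro o ho
  obtain rfl | rfl := mem_pauliX ho
  · exact h
  · trivial

theorem flagWeight_pauliX_pauliX {U : Matrix (Bits (Fin ℓ)) (Bits (Fin ℓ)) ℂ} (hU : Uᴴ * U = 1)
    {q q' : LW ℓ w} (h : q ≠ q') (ψ : Bits (LW ℓ w) → ℂ) :
    flagWeight q (run U (pauliX q) (run U (pauliX q') ψ)) = normSq (restrict q ψ) := by
  rw [flagWeight_pauliX, ← run_restrict (pauliX_avoids h.symm), normSq_run hU]

theorem run_pauliX_comm (U : Matrix (Bits (Fin ℓ)) (Bits (Fin ℓ)) ℂ) {q q' : LW ℓ w} (h : q ≠ q')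
    (ψ : Bits (LW ℓ w) → ℂ) :
    run U (pauliX q) (run U (pauliX q') ψ) = run U (pauliX q') (run U (pauliX q) ψ) := by
  simp only [run_pauliX]
  funext z
  rw [Function.update_of_ne h.symm, Function.update_of_ne h, Function.update_comm h]

end Flags

theorem zeroAt_single {Q : Type} [Fintype Q] [DecidableEq Q] (q : Q) :
    ZeroAt q (Pi.single 0 1 : Bits Q → ℂ) := by
  intro z hz
  rw [Pi.single_eq_of_ne]
  rintro rfl
  exact hz rfl

theorem exists_prepares_matJ {ℓ w : ℕ} (hℓ : ℓ ≠ 0) (A : Fin ℓ ↪ Fin w) :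
    ∃ p, Prepares A (matJ ℓ) p ∧ p.length = 2 * ℓ + 10 := by
  obtain ⟨m, rfl⟩ := Nat.exists_eq_succ_of_ne_zero hℓ
  exact ⟨_, prepares_matJ A, by simp [sympOps, length_bellOps, pauliX, pauliZ]⟩

/-- A program with boundedly many queries whose two output qubits are set with the probabilities
`|amp J U| ^ (2 t)` and `|amp 1 U| ^ (2 t)`. -/
theorem exists_program (t ℓ : ℕ) (hℓ : ℓ ≠ 0) :
    ∃ (w : ℕ) (p : List (Op (LW ℓ w))) (out : Fin 2 ↪ Fin w),
      p.length ≤ (178 * t + 15) * ℓ ∧ numQueries p = 4 * t ∧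
      ∀ U : Matrix (Bits (Fin ℓ)) (Bits (Fin ℓ)) ℂ, Uᴴ * U = 1 →
        normSq (run U p (Pi.single 0 1)) = 1 ∧
        flagWeight (Sum.inr (out 0)) (run U p (Pi.single 0 1)) = (‖amp (matJ ℓ) U‖ ^ t) ^ 2 ∧
        flagWeight (Sum.inr (out 1)) (run U p (Pi.single 0 1)) = (‖amp 1 U‖ ^ t) ^ 2 := by
  -- One flag for each qubit of `L` and `A` in each of `t` comparisons; flag 0 is the initial value
  -- of the chain, whence `N + 1` qubits.
  obtain ⟨N, hN⟩ : ∃ N, N = 2 * ℓ * t := ⟨_, rfl⟩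
  obtain ⟨w, ⟨e⟩⟩ : ∃ w, Nonempty
      ((Fin ℓ ⊕ Fin ℓ) ⊕ (Fin ℓ ⊕ (Fin (N + 1) ⊕ Fin (N + 1))) ≃ Fin w) :=
    ⟨_, ⟨Fintype.equivFin _⟩⟩
  let A₁ : Fin ℓ ↪ Fin w := ⟨fun i => e (.inl (.inl i)), fun i j h => by simpa using h⟩
  let S : Fin ℓ ↪ Fin w := ⟨fun i => e (.inl (.inr i)), fun i j h => by simpa using h⟩
  let A₂ : Fin ℓ ↪ Fin w := ⟨fun i => e (.inr (.inl i)), fun i j h => by simpa using h⟩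
  have hA₁ : ∀ i, A₁ i = e (.inl (.inl i)) := fun _ => rfl
  have hS : ∀ i, S i = e (.inl (.inr i)) := fun _ => rfl
  have hA₂ : ∀ i, A₂ i = e (.inr (.inl i)) := fun _ => rfl
  let r₁ : ℕ → LW ℓ w := fun k => .inr (e (.inr (.inr (.inl (Fin.ofNat (N + 1) k)))))
  let r₂ : ℕ → LW ℓ w := fun k => .inr (e (.inr (.inr (.inr (Fin.ofNat (N + 1) k)))))
  have hofNat : ∀ i j, i ≤ N → j ≤ N → Fin.ofNat (N + 1) i = Fin.ofNat (N + 1) j → i = j := by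
    intro i j hi hj h
    have := congrArg Fin.val h
    simpa [Nat.mod_eq_of_lt (Nat.lt_succ_of_le hi), Nat.mod_eq_of_lt (Nat.lt_succ_of_le hj)]
      using this
  have hr₁ : Set.InjOn r₁ (Set.Iic (2 * ℓ * t)) := fun i hi j hj h => hofNat i j (hN ▸ hi) (hN ▸ hj) (by simpa [r₁] using h)
  have hr₂ : Set.InjOn r₂ (Set.Iic (2 * ℓ * t)) := fun i hi j hj h => hofNat i j (hN ▸ hi) (hN ▸ hj) (by simpa [r₂] using h)
  have h11 : ∀ j, OffLA A₁ (r₁ j) := fun j i => ⟨by simp [r₁], by simp [r₁, hA₁]⟩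
  have h12 : ∀ j, OffLA A₁ (r₂ j) := fun j i => ⟨by simp [r₂], by simp [r₂, hA₁]⟩
  have h21 : ∀ j, OffLA A₂ (r₁ j) := fun j i => ⟨by simp [r₁], by simp [r₁, hA₂]⟩
  have h22 : ∀ j, OffLA A₂ (r₂ j) := fun j i => ⟨by simp [r₂], by simp [r₂, hA₂]⟩
  have hS1 : ∀ j, OffLA S (r₁ j) := fun j i => ⟨by simp [r₁], by simp [r₁, hS]⟩
  have hS2 : ∀ j, OffLA S (r₂ j) := fun j i => ⟨by simp [r₂], by simp [r₂, hS]⟩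
  have h1S : ∀ i, OffLA A₁ (.inr (S i)) := fun j i => ⟨by simp, by simp [hS, hA₁]⟩
  have h1A : ∀ i, OffLA A₁ (.inr (A₂ i)) := fun j i => ⟨by simp, by simp [hA₂, hA₁]⟩
  have hSA : ∀ i, OffLA S (.inr (A₂ i)) := fun j i => ⟨by simp, by simp [hA₂, hS]⟩
  have hr12 : ∀ i j, r₁ i ≠ r₂ j := fun i j => by simp [r₁, r₂]
  have hr1S : ∀ i j, r₁ i ≠ .inr (S j) := fun i j => by simp [r₁, hS]
  have hr1A : ∀ i j, r₁ i ≠ .inr (A₂ j) := fun i j => by simp [r₁, hA₂]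
  have hpr₁ : Prepares A₁ 1 (bellOps A₁ (List.finRange ℓ)) := prepares_one
  obtain ⟨p₂, hpr₂, hlen₂⟩ := exists_prepares_matJ hℓ A₂
  let s₁ := stageOps A₁ r₁ (bellOps A₁ (List.finRange ℓ)) t
  let s₂ := stageOps A₂ r₂ p₂ t
  -- After the first stage `L` need not be zero on the branches with a set flag. Exchanging it with
  -- the untouched register `S` gives the second stage a clean `L`.
  let sw := swapOps S (List.finRange ℓ)
  let p := s₁ ++ (sw ++ (s₂ ++ (pauliX (r₁ N) ++ pauliX (r₂ N))))
  -- The first output bit belongs to the test with `J` and the second to the test with `1`, so that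
  -- orthogonal reads 01 and symplectic 10.
  let out : Fin 2 ↪ Fin w := ⟨![e (.inr (.inr (.inr (Fin.ofNat (N + 1) N)))),
    e (.inr (.inr (.inl (Fin.ofNat (N + 1) N))))], by
      intro i j
      fin_cases i <;> fin_cases j <;> simp⟩
  refine ⟨w, p, out, ?_, ?_, fun U hU => ⟨?_, ?_, ?_⟩⟩
  -- The length is `t (77ℓ + 2) + t (77ℓ + 22) + 3ℓ + 12`; with `ℓ ≥ 1` this gives `154 + 24 = 178`
  -- and `3 + 12 = 15`.
  · have hX : ∀ q : LW ℓ w, (pauliX q).length = 6 := fun q => by simp [pauliX, pauliZ]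
    simp only [p, s₁, s₂, sw, List.length_append, length_stageOps, length_swapOps, length_bellOps,
      List.length_finRange, hlen₂, hX]
    have h1 : t * 24 ≤ t * 24 * ℓ := Nat.le_mul_of_pos_right _ (by omega)
    have h2 : 1 ≤ ℓ := by omega
    nlinarith
  · have hX : ∀ q : LW ℓ w, numQueries (pauliX q) = 0 := fun q => numQueries_eq_zero fun h => by
      obtain h | h := mem_pauliX h <;> cases h
    simp only [p, s₁, s₂, sw, numQueries_append, numQueries_stageOps hpr₁.query_notMem,
      numQueries_stageOps hpr₂.query_notMem, numQueries_swapOps, hX]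
    ring
  · rw [normSq_run hU, normSq_single]
  · have hp : run U p (Pi.single 0 1) = run U (pauliX (r₂ N)) (run U (pauliX (r₁ N))
        (run U s₂ (run U sw (run U s₁ (Pi.single 0 1))))) := by
      simp only [p, run_append]
    rw [hp]
    change flagWeight (r₂ N) _ = _
    rw [flagWeight_pauliX_pauliX hU (hr12 _ _).symm]
    have hφ : ZeroLA A₂ (run U sw (run U s₁ (Pi.single 0 1))) := by
      refine fun i => ⟨?_, ?_⟩
      · refine zeroAt_inl_swapOps S U i ?_
        exact (zeroAt_single _).run (stageOps_avoids hpr₁ (h1S i) t fun j _ => hr1S j i) U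
      · refine ZeroAt.run ((hSA i).swapOps _) U ?_
        exact (zeroAt_single _).run (stageOps_avoids hpr₁ (h1A i) t fun j _ => hr1A j i) U
    have hφr : ∀ j, j ≤ 2 * ℓ * t → ZeroAt (r₂ j) (run U sw (run U s₁ (Pi.single 0 1))) := by
      refine fun j _ => ZeroAt.run ((hS2 j).swapOps _) U ?_
      exact (zeroAt_single _).run (stageOps_avoids hpr₁ (h12 j) t fun i _ => hr12 i j) U
    rw [hN, (run_stageOps U hpr₂ hr₂ h22 hφ hφr t le_rfl).2, normSq_smul, normSq_run hU,
      normSq_run hU, normSq_single, mul_one, norm_pow]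
  · have hp : run U p (Pi.single 0 1) = run U (pauliX (r₁ N)) (run U (pauliX (r₂ N))
        (run U s₂ (run U sw (run U s₁ (Pi.single 0 1))))) := by
      simp only [p, run_append]
      exact run_pauliX_comm U (hr12 _ _).symm _
    rw [hp]
    change flagWeight (r₁ N) _ = _
    -- All later operations avoid the first flag and preserve norms, so its weight is the one right
    -- after the first stage.
    rw [flagWeight_pauliX_pauliX hU (hr12 _ _),
      ← run_restrict (stageOps_avoids hpr₂ (h21 N) t fun j _ => (hr12 N j).symm), normSq_run hU,
      ← run_restrict ((hS1 N).swapOps _), normSq_run hU, hN,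
      (run_stageOps U hpr₁ hr₁ h11 (fun i => ⟨zeroAt_single _, zeroAt_single _⟩)
        (fun j _ => zeroAt_single _) t le_rfl).2, normSq_smul, normSq_single, mul_one, norm_pow]

/-! ### Haar averages of the amplitudes -/

section Bessel

variable {ι : Type} [Fintype ι] [DecidableEq ι]

theorem trace_eq_zero_of_anticommute {P X : Matrix ι ι ℂ} (hX : X * X = 1)
    (h : X * P = -(P * X)) : P.trace = 0 := by
  have h1 : P.trace = -P.trace := by
    calc P.trace = (X * (X * P)).trace := by rw [← Matrix.mul_assoc, hX, Matrix.one_mul]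
      _ = (X * P * X).trace := Matrix.trace_mul_comm _ _
      _ = -P.trace := by
        rw [h, Matrix.neg_mul, Matrix.mul_assoc, hX, Matrix.mul_one, Matrix.trace_neg]
  exact self_eq_neg.mp h1

/-- Bessel's inequality for two orthogonal unitaries. -/
theorem norm_sq_trace_add_le {E F M : Matrix ι ι ℂ} (hE : Eᴴ * E = 1) (hF : Fᴴ * F = 1)
    (hM : Mᴴ * M = 1) (hEF : (Eᴴ * F).trace = 0) :
    ‖(Eᴴ * M).trace‖ ^ 2 + ‖(Fᴴ * M).trace‖ ^ 2 ≤ (Fintype.card ι : ℝ) ^ 2 := by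
  set a := (Eᴴ * M).trace with ha
  set b := (Fᴴ * M).trace with hb
  set d : ℝ := (Fintype.card ι : ℝ) with hd
  have hd0 : 0 ≤ d := by positivity
  have ha' : (Mᴴ * E).trace = star a := by
    rw [ha, ← Matrix.trace_conjTranspose, Matrix.conjTranspose_mul, Matrix.conjTranspose_conjTranspose]
  have hb' : (Mᴴ * F).trace = star b := by
    rw [hb, ← Matrix.trace_conjTranspose, Matrix.conjTranspose_mul, Matrix.conjTranspose_conjTranspose]
  have hFE : (Fᴴ * E).trace = 0 := by
    rw [← Matrix.conjTranspose_conjTranspose (Fᴴ * E), Matrix.trace_conjTranspose,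
      Matrix.conjTranspose_mul, Matrix.conjTranspose_conjTranspose, hEF, star_zero]
  have h1 : ((1 : Matrix ι ι ℂ)).trace = (d : ℂ) := by
    rw [Matrix.trace_one, hd]; simp
  -- The squared Hilbert–Schmidt norm of `d M - a E - b F`, where `E`, `F`, `M` each have squared
  -- norm `d`.
  have key : (((d : ℂ) • M - a • E - b • F)ᴴ * ((d : ℂ) • M - a • E - b • F)).trace =
      ((d * (d ^ 2 - ‖a‖ ^ 2 - ‖b‖ ^ 2) : ℝ) : ℂ) := by
    have hsa : star a * a = (‖a‖ : ℂ) ^ 2 := by rw [Complex.star_def, Complex.conj_mul']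
    have hsb : star b * b = (‖b‖ : ℂ) ^ 2 := by rw [Complex.star_def, Complex.conj_mul']
    have hsd : star (d : ℂ) = d := Complex.conj_ofReal d
    simp only [Matrix.conjTranspose_sub, Matrix.conjTranspose_smul, Matrix.sub_mul,
      Matrix.mul_sub, Matrix.smul_mul, Matrix.mul_smul, Matrix.trace_sub, Matrix.trace_smul,
      hE, hF, hM, hEF, hFE, ha', hb', ← ha, ← hb, h1, smul_eq_mul, hsd]
    push_cast
    linear_combination (-(d : ℂ)) * hsa - d * hsb
  have hpos : 0 ≤ d * (d ^ 2 - ‖a‖ ^ 2 - ‖b‖ ^ 2) := by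
    have := (Matrix.posSemidef_conjTranspose_mul_self
      ((d : ℂ) • M - a • E - b • F)).trace_nonneg
    rw [key] at this
    exact_mod_cast this
  rcases hd0.eq_or_lt with h0 | h0
  · have hc : IsEmpty ι := by
      rw [← Fintype.card_eq_zero_iff]
      have : (Fintype.card ι : ℝ) = 0 := h0.symm
      exact_mod_cast this
    have ha0 : a = 0 := by simp [ha, Matrix.trace]
    have hb0 : b = 0 := by simp [hb, Matrix.trace]
    rw [ha0, hb0]
    simp [sq_nonneg]
  · nlinarith [nonneg_of_mul_nonneg_right hpos h0]

end Bessel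

/-! ### Projections of a plane vector on several lines -/

section Angles

/-- The coefficient vectors are unit vectors at the angle `φ - φ'`, and the sum of the projections
on two such lines has largest eigenvalue `1 + |cos (φ - φ')|`. The coefficients being real, real and
imaginary parts are treated separately. -/
theorem norm_sq_add_norm_sq_le {α β : ℂ} (h : ‖α‖ ^ 2 + ‖β‖ ^ 2 ≤ 1) {φ φ' d : ℝ}
    (hd : |Real.cos (φ - φ')| ≤ d) (hd1 : d < 1) :
    ‖(Real.cos φ : ℂ) * α + Real.sin φ * β‖ ^ 2 + ‖(Real.cos φ' : ℂ) * α + Real.sin φ' * β‖ ^ 2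
      ≤ 1 + d := by
  have key : ∀ a b : ℝ, (Real.cos φ * a + Real.sin φ * b) ^ 2 +
      (Real.cos φ' * a + Real.sin φ' * b) ^ 2 ≤ (1 + d) * (a ^ 2 + b ^ 2) := by
    intro a b
    have h1 := Real.sin_sq_add_cos_sq φ
    have h2 := Real.sin_sq_add_cos_sq φ'
    have h3 := Real.cos_sub φ φ'
    set c := Real.cos φ
    set s := Real.sin φ
    set c' := Real.cos φ'
    set s' := Real.sin φ'
    set e := Real.cos (φ - φ')
    set p := c * a + s * b with hp
    set q := c' * a + s' * b with hq
    -- The vector is recovered from its two projections by inverting their Gram matrix, whose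
    -- determinant is `1 - e²`.
    have hid : (a ^ 2 + b ^ 2) * (1 - e ^ 2) = p ^ 2 + q ^ 2 - 2 * e * (p * q) := by
      have h4 : 1 - e ^ 2 = (c * s' - s * c') ^ 2 := by
        rw [h3]
        linear_combination -(s' ^ 2 + c' ^ 2) * h1 - h2
      have h5 : a * (c * s' - s * c') = s' * p - s * q := by rw [hp, hq]; ring
      have h6 : b * (c * s' - s * c') = c * q - c' * p := by rw [hp, hq]; ring
      rw [h4, h3]
      linear_combination (a * (c * s' - s * c') + (s' * p - s * q)) * h5 +
        (b * (c * s' - s * c') + (c * q - c' * p)) * h6 + p ^ 2 * h2 + q ^ 2 * h1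
    have he : 2 * e * (p * q) ≤ |e| * (p ^ 2 + q ^ 2) := by
      rcases abs_cases e with ⟨h, h'⟩ | ⟨h, h'⟩ <;> rw [h]
      · nlinarith [mul_nonneg h' (sq_nonneg (p - q))]
      · nlinarith [mul_nonneg (neg_nonneg.mpr h'.le) (sq_nonneg (p + q))]
    have hmul : (p ^ 2 + q ^ 2) * (1 - |e|) ≤ (1 + |e|) * (a ^ 2 + b ^ 2) * (1 - |e|) := by
      have : (1 + |e|) * (a ^ 2 + b ^ 2) * (1 - |e|) = (a ^ 2 + b ^ 2) * (1 - e ^ 2) := by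
        rw [← sq_abs e]; ring
      rw [this, hid]
      linarith
    have h7 := le_of_mul_le_mul_right hmul (by linarith)
    exact h7.trans (mul_le_mul_of_nonneg_right (by linarith) (by positivity))
  have hn : ∀ x y : ℝ, ‖(x : ℂ) * α + y * β‖ ^ 2 =
      (x * α.re + y * β.re) ^ 2 + (x * α.im + y * β.im) ^ 2 := fun x y => by
    rw [Complex.sq_norm, Complex.normSq_apply]
    simp
    ring
  rw [Complex.sq_norm, Complex.sq_norm, Complex.normSq_apply, Complex.normSq_apply] at h
  rw [hn, hn]
  have hd0 : 0 ≤ d := (abs_nonneg _).trans hd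
  nlinarith [key α.re β.re, key α.im β.im]

/-- No two of the numbers can both exceed `c`, so all but one are at most `c`. -/
theorem sum_pow_le {m : ℕ} {x : Fin m → ℝ} {c : ℝ} (h0 : ∀ k, 0 ≤ x k) (h1 : ∀ k, x k ≤ 1)
    (hc : 0 ≤ c) (h2 : ∀ k l, k ≠ l → x k ^ 2 + x l ^ 2 ≤ 2 * c ^ 2) (t : ℕ) :
    ∑ k, x k ^ t ≤ 1 + m * c ^ t := by
  -- The exceptional index is a natural number, so that a default value exists also for `m = 0`.
  obtain ⟨k, hk⟩ : ∃ k : ℕ, ∀ l : Fin m, (l : ℕ) ≠ k → x l ≤ c := by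
    by_cases h : ∃ k, c < x k
    · obtain ⟨k, hk⟩ := h
      refine ⟨k, fun l hl => ?_⟩
      by_contra! hl'
      have := h2 k l (fun h => hl (congrArg _ h.symm))
      nlinarith
    · push Not at h
      exact ⟨0, fun l _ => h l⟩
  have h3 : ∀ l : Fin m, x l ^ t ≤ (if (l : ℕ) = k then 1 else 0) + c ^ t := by
    intro l
    split_ifs with hl
    · exact (pow_le_one₀ (h0 l) (h1 l)).trans (by linarith [pow_nonneg hc t])
    · rw [zero_add]
      exact pow_le_pow_left₀ (h0 l) (hk l hl) t
  refine (Finset.sum_le_sum fun l _ => h3 l).trans ?_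
  rw [Finset.sum_add_distrib]
  gcongr
  · have h4 : (∑ l : Fin m, if (l : ℕ) = k then (1 : ℝ) else 0) =
        ((Finset.univ.filter fun l : Fin m => (l : ℕ) = k).card : ℝ) := by simp
    rw [h4]
    exact_mod_cast Finset.card_le_one.mpr fun a ha b hb => by
      simp only [Finset.mem_filter, Finset.mem_univ, true_and] at ha hb
      exact Fin.ext (ha.trans hb.symm)
  · simp

/-- Two distinct angles `kπ/m` differ by less than `π`, so the sine of the difference is nonzero;
there are finitely many pairs. -/
theorem exists_cos_bound {m : ℕ} (hm : 0 < m) : ∃ d : ℝ, 0 ≤ d ∧ d < 1 ∧ ∀ k l : Fin m, k ≠ l →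
    |Real.cos (k * (Real.pi / m) - l * (Real.pi / m))| ≤ d := by
  have hm' : (0 : ℝ) < m := by exact_mod_cast hm
  have hlt : ∀ k l : Fin m, k < l → |Real.cos (k * (Real.pi / m) - l * (Real.pi / m))| < 1 := by
    intro k l h
    have h1 : (k : ℝ) < l := by exact_mod_cast h
    have h2 : (l : ℝ) < m := by exact_mod_cast l.2
    have h3 : (0 : ℝ) ≤ k := by positivity
    have hs : 0 < Real.sin (l * (Real.pi / m) - k * (Real.pi / m)) := by
      rw [← sub_mul]
      apply Real.sin_pos_of_pos_of_lt_pi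
      · have := Real.pi_pos
        have : 0 < (l : ℝ) - k := by linarith
        positivity
      · rw [mul_div_assoc', div_lt_iff₀ hm', mul_comm]
        exact mul_lt_mul_of_pos_left (by linarith) Real.pi_pos
    rw [← Real.cos_neg, neg_sub]
    rw [← sq_lt_one_iff_abs_lt_one]
    nlinarith [Real.sin_sq_add_cos_sq (l * (Real.pi / m) - k * (Real.pi / m))]
  have hne : ∀ k l : Fin m, k ≠ l →
      |Real.cos (k * (Real.pi / m) - l * (Real.pi / m))| < 1 := by
    intro k l h
    rcases lt_or_gt_of_ne h with h | h
    · exact hlt k l h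
    · rw [← Real.cos_neg, neg_sub]
      exact hlt l k h
  let f : {p : Fin m × Fin m // p.1 ≠ p.2} → ℝ := fun p =>
    |Real.cos (p.1.1 * (Real.pi / m) - p.1.2 * (Real.pi / m))|
  by_cases hN : Nonempty {p : Fin m × Fin m // p.1 ≠ p.2}
  · obtain ⟨p, hp⟩ := Finite.exists_max f
    exact ⟨f p, abs_nonneg _, hne _ _ p.2, fun k l h => hp ⟨(k, l), h⟩⟩
  · exact ⟨0, le_rfl, one_pos, fun k l h => absurd ⟨⟨(k, l), h⟩⟩ hN⟩

end Angles

/-! ### Averaging over rotations within the group -/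

section Rotation

variable {ℓ : ℕ}

/-- The group contains the rotations that are generated by the involution `P`, and these rotate
the matrix `B` into an orthogonal direction. -/
structure Rotates (i : Fin 3) (B P : Matrix (Bits (Fin ℓ)) (Bits (Fin ℓ)) ℂ) : Prop where
  unitary : B * Bᴴ = 1
  isHermitian : Pᴴ = P
  sq_eq_one : P * P = 1
  trace_eq_zero : P.trace = 0
  transpose_mul : Pᵀ * Bᵀ = Bᵀ * P
  exists_mem : ∀ a b : ℝ, a ^ 2 + b ^ 2 = 1 →
    ∃ g : symmetryGroup ℓ i, g.1.1 = (a : ℂ) • 1 + ((b : ℂ) * Complex.I) • P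

instance (i : Fin 3) : (haar ℓ i).IsMulLeftInvariant := by
  unfold haar
  infer_instance

theorem continuous_amp (B : Matrix (Bits (Fin ℓ)) (Bits (Fin ℓ)) ℂ) (i : Fin 3) :
    Continuous fun U : symmetryGroup ℓ i => amp B U.1.1 := by
  have hv : Continuous fun U : symmetryGroup ℓ i => U.1.1 :=
    continuous_subtype_val.comp continuous_subtype_val
  unfold amp
  exact continuous_const.mul
    (continuous_const.mul ((hv.mul continuous_const).mul hv.matrix_transpose)).matrix_trace

theorem integrable_of_continuous {E : Type} [NormedAddCommGroup E] [SecondCountableTopology E]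
    {i : Fin 3} {f : symmetryGroup ℓ i → E}
    (hf : Continuous f) : Integrable f (haar ℓ i) :=
  hf.integrable_of_hasCompactSupport (HasCompactSupport.of_compactSpace f)

/-- By cyclicity of the trace `gᵀ` moves in front of `Bᵀ`, and `transpose_mul` turns it into `g`
behind `Bᵀ`. So `g²` appears, the rotation by twice the angle. -/
theorem amp_rotate {i : Fin 3} {B P : Matrix (Bits (Fin ℓ)) (Bits (Fin ℓ)) ℂ}
    (h : Rotates i B P) (U : Matrix (Bits (Fin ℓ)) (Bits (Fin ℓ)) ℂ) (θ : ℝ) :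
    amp B (((Real.cos θ : ℂ) • 1 + ((Real.sin θ : ℂ) * Complex.I) • P) * U) =
      Real.cos (2 * θ) * amp B U +
        Real.sin (2 * θ) * (Complex.I * ((1 / 2 : ℂ) ^ ℓ * (Bᵀ * P * (U * Bᵀ * Uᵀ)).trace)) := by
  set g := (Real.cos θ : ℂ) • 1 + ((Real.sin θ : ℂ) * Complex.I) • P with hg
  have h1 : gᵀ * Bᵀ = Bᵀ * g := by
    simp only [hg, Matrix.transpose_add, Matrix.transpose_smul, Matrix.transpose_one,
      Matrix.add_mul, Matrix.mul_add, Matrix.smul_mul, Matrix.mul_smul, h.transpose_mul,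
      Matrix.one_mul, Matrix.mul_one]
  have h2 : g * g = (Real.cos (2 * θ) : ℂ) • 1 + ((Real.sin (2 * θ) : ℂ) * Complex.I) • P := by
    simp only [hg, Matrix.add_mul, Matrix.mul_add, Matrix.smul_mul, Matrix.mul_smul, h.sq_eq_one,
      Matrix.one_mul, Matrix.mul_one]
    have e1 : (Real.cos (2 * θ) : ℂ) = (Real.cos θ : ℂ) * Real.cos θ +
        (Real.sin θ * Complex.I) * (Real.sin θ * Complex.I) := by
      rw [Real.cos_two_mul, Real.cos_sq']
      push_cast
      linear_combination (-(Complex.sin θ) ^ 2) * Complex.I_sq - Complex.sin_sq_add_cos_sq (θ : ℂ)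
    have e2 : (Real.sin (2 * θ) : ℂ) = 2 * Real.sin θ * Real.cos θ := by
      rw [Real.sin_two_mul]; push_cast; ring
    rw [e1, e2]
    module
  have h3 : (Bᵀ * (g * U * Bᵀ * (g * U)ᵀ)).trace = (Bᵀ * (g * g) * (U * Bᵀ * Uᵀ)).trace := by
    calc (Bᵀ * (g * U * Bᵀ * (g * U)ᵀ)).trace = ((Bᵀ * g * (U * Bᵀ * Uᵀ)) * gᵀ).trace := by
          simp only [Matrix.transpose_mul, Matrix.mul_assoc]
      _ = ((gᵀ * Bᵀ) * g * (U * Bᵀ * Uᵀ)).trace := by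
          rw [Matrix.trace_mul_comm]
          simp only [Matrix.mul_assoc]
      _ = _ := by
          rw [h1]
          simp only [Matrix.mul_assoc]
  rw [amp, amp, h3, h2]
  simp only [Matrix.add_mul, Matrix.mul_add, Matrix.smul_mul, Matrix.mul_smul, Matrix.mul_one,
    Matrix.trace_add, Matrix.trace_smul, smul_eq_mul]
  ring

/-- Both terms are normalised Hilbert–Schmidt products of the unitary `U Bᵀ Uᵀ` with the adjoints of
`Bᵀ` and `Bᵀ P`. These two are orthogonal because `P` has trace zero, and Bessel's inequality
applies. -/
theorem norm_sq_amp_add_le {i : Fin 3} {B P : Matrix (Bits (Fin ℓ)) (Bits (Fin ℓ)) ℂ}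
    (h : Rotates i B P) {U : Matrix (Bits (Fin ℓ)) (Bits (Fin ℓ)) ℂ} (hU : Uᴴ * U = 1) :
    ‖amp B U‖ ^ 2 +
      ‖Complex.I * ((1 / 2 : ℂ) ^ ℓ * (Bᵀ * P * (U * Bᵀ * Uᵀ)).trace)‖ ^ 2 ≤ 1 := by
  have hB : Bᵀ * Bᵀᴴ = 1 := by
    have := congrArg Matrix.transpose (mul_eq_one_comm.mp h.unitary)
    rw [Matrix.transpose_mul, Matrix.transpose_one] at this
    exact this
  have hB' : Bᵀᴴ * Bᵀ = 1 := mul_eq_one_comm.mp hB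
  have hUT : Uᵀᴴ * Uᵀ = 1 := by
    have := congrArg Matrix.transpose (mul_eq_one_comm.mp hU)
    rw [Matrix.transpose_mul, Matrix.transpose_one] at this
    exact this
  have hM : (U * Bᵀ * Uᵀ)ᴴ * (U * Bᵀ * Uᵀ) = 1 := by
    calc _ = Uᵀᴴ * (Bᵀᴴ * (Uᴴ * U) * Bᵀ) * Uᵀ := by
          simp only [Matrix.conjTranspose_mul, Matrix.mul_assoc]
      _ = 1 := by rw [hU, Matrix.mul_one, hB', Matrix.mul_one, hUT]
  have hF : ((Bᵀ * P)ᴴ)ᴴ * (Bᵀ * P)ᴴ = 1 := by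
    calc _ = Bᵀ * (P * P) * Bᵀᴴ := by
          rw [Matrix.conjTranspose_conjTranspose, Matrix.conjTranspose_mul, h.isHermitian]
          simp only [Matrix.mul_assoc]
      _ = 1 := by rw [h.sq_eq_one, Matrix.mul_one, hB]
  have hEF : ((Bᵀᴴ)ᴴ * (Bᵀ * P)ᴴ).trace = 0 := by
    rw [Matrix.conjTranspose_conjTranspose, Matrix.conjTranspose_mul, h.isHermitian,
      Matrix.trace_mul_comm, Matrix.mul_assoc, hB', Matrix.mul_one, h.trace_eq_zero]
  have key := norm_sq_trace_add_le (E := Bᵀᴴ) (F := (Bᵀ * P)ᴴ)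
    (by rw [Matrix.conjTranspose_conjTranspose, hB]) hF hM hEF
  simp only [Matrix.conjTranspose_conjTranspose] at key
  have hcard : (Fintype.card (Bits (Fin ℓ)) : ℝ) = 2 ^ ℓ := by simp
  have hhalf : ‖(1 / 2 : ℂ) ^ ℓ‖ = (1 / 2) ^ ℓ := by simp
  rw [hcard] at key
  rw [amp, norm_mul, norm_mul, norm_mul, Complex.norm_I, hhalf, one_mul, mul_pow, mul_pow,
    ← mul_add]
  calc ((1 / 2 : ℝ) ^ ℓ) ^ 2 * _ ≤ ((1 / 2 : ℝ) ^ ℓ) ^ 2 * ((2 : ℝ) ^ ℓ) ^ 2 := by gcongr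
    _ = 1 := by rw [← mul_pow, ← mul_pow]; norm_num

/-- Powers of the amplitude are small on average, uniformly in the number of qubits. -/
theorem exists_integral_amp_le {m : ℕ} (hm : 0 < m) : ∃ c : ℝ, 0 ≤ c ∧ c < 1 ∧
    ∀ (ℓ : ℕ) (i : Fin 3) (B P : Matrix (Bits (Fin ℓ)) (Bits (Fin ℓ)) ℂ), Rotates i B P → ∀ t : ℕ,
      ∫ U, ‖amp B U.1.1‖ ^ t ∂(haar ℓ i) ≤ 1 / m + c ^ t := by
  obtain ⟨d, hd0, hd1, hd⟩ := exists_cos_bound hm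
  have hm' : (0 : ℝ) < m := by exact_mod_cast hm
  have hsq : Real.sqrt ((1 + d) / 2) ^ 2 = (1 + d) / 2 := Real.sq_sqrt (by linarith)
  -- Two of the squared moduli add up to at most `1 + d = 2c²`.
  refine ⟨Real.sqrt ((1 + d) / 2), Real.sqrt_nonneg _, ?_, fun ℓ i B P h t => ?_⟩
  · rw [Real.sqrt_lt' one_pos]
    linarith
  · set c := Real.sqrt ((1 + d) / 2)
    -- Half angles, because the amplitude is quadratic in `U` and doubles them.
    have hmem := fun k : Fin m => h.exists_mem (Real.cos (k * (Real.pi / m) / 2))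
      (Real.sin (k * (Real.pi / m) / 2)) (Real.cos_sq_add_sin_sq _)
    choose g hg using hmem
    have hint : ∀ k, Integrable (fun U => ‖amp B (g k * U).1.1‖ ^ t) (haar ℓ i) := fun k =>
      integrable_of_continuous
        (((continuous_amp B i).comp (continuous_const.mul continuous_id)).norm.pow t)
    have hsum : ∀ U : symmetryGroup ℓ i,
        ∑ k, ‖amp B (g k * U).1.1‖ ^ t ≤ 1 + m * c ^ t := by
      intro U
      have hU : U.1.1ᴴ * U.1.1 = 1 := Matrix.mem_unitaryGroup_iff'.mp U.1.2
      have hb := norm_sq_amp_add_le h hU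
      have hrot : ∀ k, amp B (g k * U).1.1 = _ := fun k => by
        have h1 : (g k * U).1.1 = (g k).1.1 * U.1.1 := rfl
        rw [h1, hg k, amp_rotate h, mul_div_cancel₀ _ (two_ne_zero' ℝ)]
      refine sum_pow_le (fun _ => norm_nonneg _) (fun k => ?_) (Real.sqrt_nonneg _)
        (fun k l hkl => ?_) t
      · have hV : (g k * U).1.1ᴴ * (g k * U).1.1 = 1 :=
          Matrix.mem_unitaryGroup_iff'.mp (g k * U).1.2
        have := norm_sq_amp_add_le h hV
        nlinarith [norm_nonneg (amp B (g k * U).1.1), sq_nonneg ‖Complex.I * ((1 / 2 : ℂ) ^ ℓ *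
          (Bᵀ * P * ((g k * U).1.1 * Bᵀ * (g k * U).1.1ᵀ)).trace)‖]
      · rw [hrot, hrot, hsq]
        exact (norm_sq_add_norm_sq_le hb (hd k l hkl) hd1).trans (by linarith)
    -- By left invariance each translate has the same average, so the pointwise bound on the sum
    -- bounds `m` times the average.
    have h1 : (m : ℝ) * ∫ U, ‖amp B U.1.1‖ ^ t ∂(haar ℓ i) =
        ∫ U, ∑ k, ‖amp B (g k * U).1.1‖ ^ t ∂(haar ℓ i) := by
      rw [integral_finsetSum _ fun k _ => hint k]
      have : ∀ k, ∫ U, ‖amp B (g k * U).1.1‖ ^ t ∂(haar ℓ i) =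
          ∫ U, ‖amp B U.1.1‖ ^ t ∂(haar ℓ i) := fun k =>
        integral_mul_left_eq_self (fun U : symmetryGroup ℓ i => ‖amp B U.1.1‖ ^ t) (g k)
      rw [Finset.sum_congr rfl fun k _ => this k]
      simp
    have h2 : ∫ U, ∑ k, ‖amp B (g k * U).1.1‖ ^ t ∂(haar ℓ i) ≤ 1 + m * c ^ t := by
      have := integral_mono (integrable_finsetSum _ fun k _ => hint k)
        (integrable_const (1 + m * c ^ t)) hsum
      simpa using this
    rw [← h1] at h2
    rw [← mul_le_mul_iff_right₀ hm', mul_add, mul_one_div_cancel hm'.ne']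
    exact h2

end Rotation

/-! ### Rotations in the three groups -/

section Pauli

theorem pauli_x_sq : !![(0 : ℂ), 1; 1, 0] * !![0, 1; 1, 0] = 1 := by
  simp [Matrix.one_fin_two]

theorem pauli_z_sq : !![(1 : ℂ), 0; 0, -1] * !![1, 0; 0, -1] = 1 := by
  simp [Matrix.one_fin_two]

theorem pauli_y_sq :
    !![(0 : ℂ), -Complex.I; Complex.I, 0] * !![0, -Complex.I; Complex.I, 0] = 1 := by
  simp [Matrix.one_fin_two]

theorem pauli_z_transpose : !![(1 : ℂ), 0; 0, -1]ᵀ = !![1, 0; 0, -1] := by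
  ext i j
  fin_cases i <;> fin_cases j <;> simp

theorem pauli_z_conjTranspose : !![(1 : ℂ), 0; 0, -1]ᴴ = !![1, 0; 0, -1] := by
  ext i j
  fin_cases i <;> fin_cases j <;> simp

theorem pauli_y_transpose : !![(0 : ℂ), -Complex.I; Complex.I, 0]ᵀ =
    -!![0, -Complex.I; Complex.I, 0] := by
  ext i j
  fin_cases i <;> fin_cases j <;> simp

theorem pauli_y_conjTranspose : !![(0 : ℂ), -Complex.I; Complex.I, 0]ᴴ =
    !![0, -Complex.I; Complex.I, 0] := by
  ext i j
  fin_cases i <;> fin_cases j <;> simp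

theorem pauli_x_mul_z : !![(0 : ℂ), 1; 1, 0] * !![1, 0; 0, -1] =
    -(!![1, 0; 0, -1] * !![0, 1; 1, 0]) := by
  ext i j
  fin_cases i <;> fin_cases j <;> simp

theorem pauli_z_mul_j : !![(1 : ℂ), 0; 0, -1] * !![0, 1; -1, 0] =
    -(!![0, 1; -1, 0] * !![1, 0; 0, -1]) := by
  ext i j
  fin_cases i <;> fin_cases j <;> simp

theorem matJ_succ (m : ℕ) : matJ (m + 1) = oneQubitGate 0 !![(0 : ℂ), 1; -1, 0] := by
  ext x y
  simp only [matJ, oneQubitGate, Matrix.of_apply]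
  have h : Fin.tail x = Fin.tail y ↔ ∀ j, j ≠ 0 → x j = y j := by
    simp only [funext_iff, Fin.tail]
    constructor
    · intro h j hj
      obtain ⟨k, rfl⟩ := Fin.exists_succ_eq.mpr hj
      exact h k
    · exact fun h k => h k.succ (Fin.succ_ne_zero k)
  by_cases ht : Fin.tail x = Fin.tail y
  · rw [if_pos ht, if_pos (h.mp ht)]
  · rw [if_neg ht, if_neg (mt h.mpr ht)]

theorem matJ_transpose (ℓ : ℕ) : (matJ ℓ)ᵀ = -matJ ℓ := by
  cases ℓ with
  | zero => simp [matJ]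
  | succ m =>
    rw [matJ_succ, oneQubitGate_transpose, ← oneQubitGate_neg]
    congr 1
    ext i j
    fin_cases i <;> fin_cases j <;> simp

theorem matJ_conjTranspose (ℓ : ℕ) : (matJ ℓ)ᴴ = -matJ ℓ := by
  cases ℓ with
  | zero => simp [matJ]
  | succ m =>
    rw [matJ_succ, oneQubitGate_conjTranspose, ← oneQubitGate_neg]
    congr 1
    ext i j
    fin_cases i <;> fin_cases j <;> simp

theorem matJ_unitary {ℓ : ℕ} (hℓ : ℓ ≠ 0) : matJ ℓ * (matJ ℓ)ᴴ = 1 := by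
  rw [matJ_conjTranspose, Matrix.mul_neg, matJ_mul_matJ ℓ hℓ, neg_neg]

end Pauli

/-! ### Involutions that generate rotations, and the amplitudes of modulus 1 -/

section RotationGroups

variable {ℓ : ℕ}

theorem exists_rotation {P : Matrix (Bits (Fin ℓ)) (Bits (Fin ℓ)) ℂ} (hP : Pᴴ = P)
    (hP2 : P * P = 1) {a b : ℝ} (hab : a ^ 2 + b ^ 2 = 1) :
    ∃ g : UGroup ℓ, g.1 = (a : ℂ) • 1 + ((b : ℂ) * Complex.I) • P := by
  refine ⟨⟨(a : ℂ) • 1 + ((b : ℂ) * Complex.I) • P, ?_⟩, rfl⟩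
  rw [Matrix.mem_unitaryGroup_iff']
  have hab' : (a : ℂ) * a + b * b = 1 := by
    rw [← pow_two, ← pow_two]; exact_mod_cast hab
  have hs : star ((b : ℂ) * Complex.I) = -(b * Complex.I) := by simp
  have hsa : star (a : ℂ) = a := Complex.conj_ofReal a
  have hI : -((b : ℂ) * Complex.I * (b * Complex.I)) = b * b := by
    linear_combination (-(b : ℂ) ^ 2) * Complex.I_sq
  have h1 : (1 : Matrix (Bits (Fin ℓ)) (Bits (Fin ℓ)) ℂ) = ((a : ℂ) * a + b * b) • 1 := by
    rw [hab', one_smul]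
  rw [Matrix.star_eq_conjTranspose]
  simp only [Matrix.conjTranspose_add, Matrix.conjTranspose_smul, Matrix.conjTranspose_one, hP,
    hs, hsa, Matrix.add_mul, Matrix.mul_add, Matrix.smul_mul, Matrix.mul_smul, Matrix.one_mul,
    Matrix.mul_one, hP2]
  conv_rhs => rw [h1, ← hI]
  module

theorem rotates_unitary {B P : Matrix (Bits (Fin ℓ)) (Bits (Fin ℓ)) ℂ} (hB : B * Bᴴ = 1)
    (hP : Pᴴ = P) (hP2 : P * P = 1) (htr : P.trace = 0) (hPB : Pᵀ * Bᵀ = Bᵀ * P) :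
    Rotates 0 B P where
  unitary := hB
  isHermitian := hP
  sq_eq_one := hP2
  trace_eq_zero := htr
  transpose_mul := hPB
  exists_mem a b hab := by
    obtain ⟨g, hg⟩ := exists_rotation hP hP2 hab
    exact ⟨⟨g, Subgroup.mem_top g⟩, hg⟩

/-- A Hermitian matrix with `Pᵀ = -P` is purely imaginary, so `i P`, and with it the rotation, is
real. -/
theorem rotates_orthogonal {B P : Matrix (Bits (Fin ℓ)) (Bits (Fin ℓ)) ℂ} (hB : B * Bᴴ = 1)
    (hP : Pᴴ = P) (hP2 : P * P = 1) (htr : P.trace = 0) (hPB : Pᵀ * Bᵀ = Bᵀ * P)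
    (hPT : Pᵀ = -P) : Rotates 1 B P where
  unitary := hB
  isHermitian := hP
  sq_eq_one := hP2
  trace_eq_zero := htr
  transpose_mul := hPB
  exists_mem a b hab := by
    obtain ⟨g, hg⟩ := exists_rotation hP hP2 hab
    refine ⟨⟨g, ?_⟩, hg⟩
    change g.1.map star = g.1
    have h1 : g.1.map star = g.1ᴴᵀ := rfl
    have hs : star ((b : ℂ) * Complex.I) = -(b * Complex.I) := by simp
    have hsa : star (a : ℂ) = a := Complex.conj_ofReal a
    rw [h1, hg]
    simp only [Matrix.conjTranspose_add, Matrix.conjTranspose_smul, Matrix.conjTranspose_one, hP,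
      hs, hsa, Matrix.transpose_add, Matrix.transpose_smul, Matrix.transpose_one,
      Matrix.transpose_neg, hPT, neg_smul, smul_neg, neg_neg]

/-- For symmetric `P`, anticommuting with `J` is the condition `P J + J Pᵀ = 0` that places `i P` in
the symplectic Lie algebra. -/
theorem rotates_symplectic {B P : Matrix (Bits (Fin ℓ)) (Bits (Fin ℓ)) ℂ} (hB : B * Bᴴ = 1)
    (hP : Pᴴ = P) (hP2 : P * P = 1) (htr : P.trace = 0) (hPB : Pᵀ * Bᵀ = Bᵀ * P)
    (hPT : Pᵀ = P) (hPJ : P * matJ ℓ = -(matJ ℓ * P)) : Rotates 2 B P where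
  unitary := hB
  isHermitian := hP
  sq_eq_one := hP2
  trace_eq_zero := htr
  transpose_mul := hPB
  exists_mem a b hab := by
    obtain ⟨g, hg⟩ := exists_rotation hP hP2 hab
    refine ⟨⟨g, ?_⟩, hg⟩
    change g.1 * matJ ℓ * g.1ᵀ = matJ ℓ
    have hab' : (a : ℂ) * a + b * b = 1 := by
      rw [← pow_two, ← pow_two]; exact_mod_cast hab
    have hI : -((b : ℂ) * Complex.I * (b * Complex.I)) = b * b := by
      linear_combination (-(b : ℂ) ^ 2) * Complex.I_sq
    have hJ : matJ ℓ = ((a : ℂ) * a + b * b) • matJ ℓ := by rw [hab', one_smul]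
    have hPJP : P * matJ ℓ * P = -matJ ℓ := by
      rw [hPJ, Matrix.neg_mul, Matrix.mul_assoc, hP2, Matrix.mul_one]
    rw [hg]
    simp only [Matrix.transpose_add, Matrix.transpose_smul, Matrix.transpose_one, hPT,
      Matrix.add_mul, Matrix.mul_add, Matrix.smul_mul, Matrix.mul_smul, Matrix.one_mul,
      Matrix.mul_one, hPJP]
    rw [hPJ]
    conv_rhs => rw [hJ, ← hI]
    module

theorem oneQubitGate_z {Q : Type} [Fintype Q] [DecidableEq Q] (q : Q) :
    (oneQubitGate q !![(1 : ℂ), 0; 0, -1])ᴴ = oneQubitGate q !![1, 0; 0, -1] ∧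
    (oneQubitGate q !![(1 : ℂ), 0; 0, -1])ᵀ = oneQubitGate q !![1, 0; 0, -1] ∧
    oneQubitGate q !![(1 : ℂ), 0; 0, -1] * oneQubitGate q !![1, 0; 0, -1] = 1 ∧
    (oneQubitGate q !![(1 : ℂ), 0; 0, -1]).trace = 0 := by
  refine ⟨?_, ?_, ?_, ?_⟩
  · rw [oneQubitGate_conjTranspose, pauli_z_conjTranspose]
  · rw [oneQubitGate_transpose, pauli_z_transpose]
  · rw [oneQubitGate_mul, pauli_z_sq, oneQubitGate_one]
  · apply trace_eq_zero_of_anticommute (X := oneQubitGate q !![0, 1; 1, 0])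
    · rw [oneQubitGate_mul, pauli_x_sq, oneQubitGate_one]
    · rw [oneQubitGate_mul, oneQubitGate_mul, pauli_x_mul_z, oneQubitGate_neg]

theorem exists_rotates_unitary_one (hℓ : 2 ≤ ℓ) :
    ∃ P, Rotates (ℓ := ℓ) 0 1 P := by
  obtain ⟨h1, h2, h3, h4⟩ := oneQubitGate_z (⟨1, by omega⟩ : Fin ℓ)
  exact ⟨_, rotates_unitary (by simp) h1 h3 h4 (by simp [h2])⟩

/-- A symmetric `P` must commute with `J`. As `J` acts on the first qubit, `Z` on the second one
does. -/
theorem exists_rotates_unitary_matJ (hℓ : 2 ≤ ℓ) :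
    ∃ P, Rotates (ℓ := ℓ) 0 (matJ ℓ) P := by
  obtain ⟨m, rfl⟩ : ∃ m, ℓ = m + 2 := ⟨ℓ - 2, by omega⟩
  obtain ⟨h1, h2, h3, h4⟩ := oneQubitGate_z (1 : Fin (m + 2))
  refine ⟨_, rotates_unitary (matJ_unitary (by omega)) h1 h3 h4 ?_⟩
  rw [h2, matJ_transpose, Matrix.mul_neg, Matrix.neg_mul, matJ_succ,
    oneQubitGate_comm (by simp)]

/-- Here `P = Z ⊗ Y`: the factor `Y` makes it antisymmetric, and `Z` makes it anticommute with `J`,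
as `transpose_mul` then requires. Two qubits are essential: on one qubit `U J Uᵀ = det(U) J`, and
the amplitude for `J` has modulus 1 throughout `U(2)`. -/
theorem exists_rotates_orthogonal (hℓ : 2 ≤ ℓ) :
    ∃ P, Rotates (ℓ := ℓ) 1 (matJ ℓ) P := by
  obtain ⟨m, rfl⟩ : ∃ m, ℓ = m + 2 := ⟨ℓ - 2, by omega⟩
  have h01 : (0 : Fin (m + 2)) ≠ 1 := by simp
  obtain ⟨h1, h2, h3, -⟩ := oneQubitGate_z (0 : Fin (m + 2))
  set Z := oneQubitGate (0 : Fin (m + 2)) !![(1 : ℂ), 0; 0, -1] with hZ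
  set X := oneQubitGate (0 : Fin (m + 2)) !![(0 : ℂ), 1; 1, 0] with hX
  set Y := oneQubitGate (1 : Fin (m + 2)) !![(0 : ℂ), -Complex.I; Complex.I, 0] with hY
  have hYY : Y * Y = 1 := by rw [hY, oneQubitGate_mul, pauli_y_sq, oneQubitGate_one]
  have hYT : Yᵀ = -Y := by rw [hY, oneQubitGate_transpose, pauli_y_transpose, oneQubitGate_neg]
  have hYH : Yᴴ = Y := by rw [hY, oneQubitGate_conjTranspose, pauli_y_conjTranspose]
  have hZY : Z * Y = Y * Z := oneQubitGate_comm h01 _ _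
  have hXY : X * Y = Y * X := oneQubitGate_comm h01 _ _
  have hJY : matJ (m + 2) * Y = Y * matJ (m + 2) := by
    rw [matJ_succ]; exact oneQubitGate_comm h01 _ _
  have hZJ : Z * matJ (m + 2) = -(matJ (m + 2) * Z) := by
    rw [matJ_succ, hZ, oneQubitGate_mul, oneQubitGate_mul, pauli_z_mul_j, oneQubitGate_neg]
  have hXZ : X * Z = -(Z * X) := by
    rw [hX, hZ, oneQubitGate_mul, oneQubitGate_mul, pauli_x_mul_z, oneQubitGate_neg]
  have hPT : (Z * Y)ᵀ = -(Z * Y) := by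
    rw [Matrix.transpose_mul, h2, hYT, Matrix.neg_mul, hZY]
  refine ⟨Z * Y, rotates_orthogonal (matJ_unitary (by omega)) ?_ ?_ ?_ ?_ hPT⟩
  · rw [Matrix.conjTranspose_mul, h1, hYH, hZY]
  · calc Z * Y * (Z * Y) = Z * (Y * Z) * Y := by simp only [Matrix.mul_assoc]
      _ = Z * Z * (Y * Y) := by rw [← hZY]; simp only [Matrix.mul_assoc]
      _ = 1 := by rw [h3, hYY, Matrix.one_mul]
  · apply trace_eq_zero_of_anticommute (X := X)
    · rw [hX, oneQubitGate_mul, pauli_x_sq, oneQubitGate_one]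
    · rw [← Matrix.mul_assoc, hXZ, Matrix.neg_mul, Matrix.mul_assoc, hXY, Matrix.mul_assoc]
  · rw [hPT, matJ_transpose, neg_mul_neg, Matrix.neg_mul]
    calc Z * Y * matJ (m + 2) = Z * (Y * matJ (m + 2)) := Matrix.mul_assoc _ _ _
      _ = -(matJ (m + 2) * (Z * Y)) := by
        rw [← hJY, ← Matrix.mul_assoc, hZJ, Matrix.neg_mul, Matrix.mul_assoc]

theorem exists_rotates_symplectic (hℓ : ℓ ≠ 0) :
    ∃ P, Rotates (ℓ := ℓ) 2 1 P := by
  obtain ⟨m, rfl⟩ := Nat.exists_eq_succ_of_ne_zero hℓ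
  obtain ⟨h1, h2, h3, h4⟩ := oneQubitGate_z (0 : Fin (m + 1))
  refine ⟨_, rotates_symplectic (by simp) h1 h3 h4 (by simp [h2]) h2 ?_⟩
  rw [matJ_succ, oneQubitGate_mul, oneQubitGate_mul, pauli_z_mul_j, oneQubitGate_neg]

theorem half_pow_mul_card (ℓ : ℕ) : (1 / 2 : ℂ) ^ ℓ * (Fintype.card (Bits (Fin ℓ)) : ℂ) = 1 := by
  simp

theorem norm_amp_orthogonal (U : symmetryGroup ℓ 1) : ‖amp 1 U.1.1‖ = 1 := by
  have h1 : U.1.1.map star = U.1.1 := U.2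
  have h2 : U.1.1ᵀ = U.1.1ᴴ := by
    conv_lhs => rw [← h1]
    rfl
  have h3 : U.1.1 * U.1.1ᴴ = 1 := Matrix.mem_unitaryGroup_iff.mp U.1.2
  rw [amp, Matrix.transpose_one, Matrix.mul_one, Matrix.one_mul, h2, h3, Matrix.trace_one,
    half_pow_mul_card, norm_one]

theorem norm_amp_symplectic (hℓ : ℓ ≠ 0) (U : symmetryGroup ℓ 2) : ‖amp (matJ ℓ) U.1.1‖ = 1 := by
  have h1 : U.1.1 * matJ ℓ * U.1.1ᵀ = matJ ℓ := U.2
  rw [amp, matJ_transpose, Matrix.mul_neg, Matrix.neg_mul, Matrix.neg_mul, Matrix.mul_neg,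
    neg_neg, h1,
    matJ_mul_matJ ℓ hℓ, Matrix.trace_neg, mul_neg, norm_neg, Matrix.trace_one, half_pow_mul_card,
    norm_one]

end RotationGroups

/-! ### Dependence of the amplitudes on the unitary -/

section Perturbation

theorem norm_mul_apply_le {ι : Type} [Fintype ι] {X Y : Matrix ι ι ℂ} {a b : ℝ} (ha : 0 ≤ a)
    (hX : ∀ x y, ‖X x y‖ ≤ a) (hY : ∀ x y, ‖Y x y‖ ≤ b) (x y : ι) :
    ‖(X * Y) x y‖ ≤ Fintype.card ι * (a * b) := by
  rw [Matrix.mul_apply]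
  refine (norm_sum_le _ _).trans ?_
  have : ∀ k ∈ Finset.univ, ‖X x k * Y k y‖ ≤ a * b := fun k _ => by
    rw [norm_mul]
    exact mul_le_mul (hX _ _) (hY _ _) (norm_nonneg _) ha
  simpa using Finset.sum_le_sum this

/-- The difference telescopes into two terms with one factor `V - U` each. Entries of unitaries are
at most 1; three matrix products and the trace cost a factor `2^ℓ` each, and the normalisation gives
one back. -/
theorem norm_amp_sub_le {ℓ : ℕ} {B : Matrix (Bits (Fin ℓ)) (Bits (Fin ℓ)) ℂ} (hB : B * Bᴴ = 1)
    (U V : UGroup ℓ) {δ : ℝ} (hδ : ∀ x y, ‖V.1 x y - U.1 x y‖ ≤ δ) :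
    ‖amp B V.1 - amp B U.1‖ ≤ 2 * (2 ^ ℓ) ^ 3 * δ := by
  have hδ0 : 0 ≤ δ := (norm_nonneg _).trans (hδ 0 0)
  have hu : ∀ (W : UGroup ℓ) x y, ‖W.1 x y‖ ≤ 1 := fun W => entry_norm_bound_of_unitary W.2
  have hBt : ∀ x y, ‖Bᵀ x y‖ ≤ 1 := fun x y =>
    entry_norm_bound_of_unitary (Matrix.mem_unitaryGroup_iff.mpr hB) y x
  have hc : (Fintype.card (Bits (Fin ℓ)) : ℝ) = 2 ^ ℓ := by simp
  set D : ℝ := 2 ^ ℓ with hD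
  have hD0 : 0 < D := by positivity
  have hd : ∀ x y, ‖(V.1 - U.1) x y‖ ≤ δ := hδ
  have h1 : ∀ x y, ‖((V.1 - U.1) * Bᵀ * V.1ᵀ) x y‖ ≤ D * (D * (δ * 1) * 1) := by
    rw [← hc]
    exact norm_mul_apply_le (by positivity) (norm_mul_apply_le hδ0 hd hBt) fun x y => hu V y x
  have h2 : ∀ x y, ‖(U.1 * Bᵀ * (V.1 - U.1)ᵀ) x y‖ ≤ D * (D * (1 * 1) * δ) := by
    rw [← hc]
    exact norm_mul_apply_le (by positivity) (norm_mul_apply_le zero_le_one (hu U) hBt)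
      fun x y => hd y x
  have h3 : V.1 * Bᵀ * V.1ᵀ - U.1 * Bᵀ * U.1ᵀ =
      (V.1 - U.1) * Bᵀ * V.1ᵀ + U.1 * Bᵀ * (V.1 - U.1)ᵀ := by
    rw [Matrix.transpose_sub]
    noncomm_ring
  have h4 : ∀ x y, ‖(V.1 * Bᵀ * V.1ᵀ - U.1 * Bᵀ * U.1ᵀ) x y‖ ≤ 2 * D ^ 2 * δ := by
    intro x y
    rw [h3, Matrix.add_apply]
    refine (norm_add_le _ _).trans ((add_le_add (h1 x y) (h2 x y)).trans (le_of_eq ?_))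
    ring
  have h5 : ∀ x y, ‖(Bᵀ * (V.1 * Bᵀ * V.1ᵀ - U.1 * Bᵀ * U.1ᵀ)) x y‖ ≤
      D * (1 * (2 * D ^ 2 * δ)) := by
    rw [← hc]
    refine norm_mul_apply_le zero_le_one hBt ?_
    rwa [hc]
  have h6 : amp B V.1 - amp B U.1 =
      (1 / 2 : ℂ) ^ ℓ * (Bᵀ * (V.1 * Bᵀ * V.1ᵀ - U.1 * Bᵀ * U.1ᵀ)).trace := by
    rw [Matrix.mul_sub, Matrix.trace_sub, amp, amp]
    ring
  have h7 : ‖(Bᵀ * (V.1 * Bᵀ * V.1ᵀ - U.1 * Bᵀ * U.1ᵀ)).trace‖ ≤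
      D * (D * (1 * (2 * D ^ 2 * δ))) := by
    refine (norm_sum_le _ _).trans ?_
    have := Finset.sum_le_sum fun x (_ : x ∈ Finset.univ) => h5 x x
    rw [Finset.sum_const, Finset.card_univ, nsmul_eq_mul, hc] at this
    exact this
  have h8 : ‖(1 / 2 : ℂ) ^ ℓ‖ = D⁻¹ := by simp [hD]
  rw [h6, norm_mul, h8]
  calc D⁻¹ * _ ≤ D⁻¹ * (D * (D * (1 * (2 * D ^ 2 * δ)))) := by gcongr
    _ = 2 * D ^ 3 * δ := by field_simp

end Perturbation

/-! ### Trace norm and reduced states -/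

section TraceNorm

theorem sum_eigenvalues_conjTranspose_mul_self {ι : Type} [Fintype ι] [DecidableEq ι]
    (A : Matrix ι ι ℂ) :
    ∑ i, (isHermitian_conjTranspose_mul_self A).eigenvalues i = ∑ s, ∑ t, ‖A s t‖ ^ 2 := by
  have h := (isHermitian_conjTranspose_mul_self A).trace_eq_sum_eigenvalues
  have h2 : (Aᴴ * A).trace = ((∑ s, ∑ t, ‖A s t‖ ^ 2 : ℝ) : ℂ) := by
    rw [Finset.sum_comm]
    simp only [Matrix.trace, Matrix.diag, Matrix.mul_apply, Matrix.conjTranspose_apply]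
    push_cast
    refine Finset.sum_congr rfl fun s _ => Finset.sum_congr rfl fun t _ => ?_
    rw [Complex.star_def, Complex.conj_mul']
  rw [h2] at h
  apply Complex.ofReal_injective
  rw [Complex.ofReal_sum]
  exact h.symm

/-- Cauchy–Schwarz on the singular values bounds the trace norm by the Hilbert–Schmidt norm, which
is a sum over entries. -/
theorem traceNorm_le {ι : Type} [Fintype ι] [DecidableEq ι] {A : Matrix ι ι ℂ} {η : ℝ}
    (h : ∀ s t, ‖A s t‖ ≤ η) :
    traceNorm A ^ 2 ≤ (Fintype.card ι : ℝ) ^ 3 * η ^ 2 := by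
  have hpos : ∀ i, 0 ≤ (isHermitian_conjTranspose_mul_self A).eigenvalues i :=
    (Matrix.posSemidef_conjTranspose_mul_self A).eigenvalues_nonneg
  have h1 : traceNorm A ^ 2 ≤ Fintype.card ι *
      ∑ i, Real.sqrt ((isHermitian_conjTranspose_mul_self A).eigenvalues i) ^ 2 := by
    rw [traceNorm, ← Finset.card_univ]
    exact sq_sum_le_card_mul_sum_sq
  simp only [Real.sq_sqrt (hpos _), sum_eigenvalues_conjTranspose_mul_self] at h1
  have h2 : ∑ s, ∑ t, ‖A s t‖ ^ 2 ≤ ∑ _s : ι, ∑ _t : ι, η ^ 2 :=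
    Finset.sum_le_sum fun s _ => Finset.sum_le_sum fun t _ =>
      pow_le_pow_left₀ (norm_nonneg _) (h s t) 2
  simp only [Finset.sum_const, Finset.card_univ, nsmul_eq_mul] at h2
  calc traceNorm A ^ 2 ≤ Fintype.card ι * (Fintype.card ι * (Fintype.card ι * η ^ 2)) :=
        h1.trans (by gcongr)
    _ = _ := by ring

theorem traceNorm_le_third {A : Matrix (Bits (Fin 2)) (Bits (Fin 2)) ℂ}
    (h : ∀ s t, ‖A s t‖ ≤ 1 / 24) : traceNorm A ≤ 1 / 3 := by
  have h1 := traceNorm_le h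
  have h2 : (Fintype.card (Bits (Fin 2)) : ℝ) = 4 := by simp
  rw [h2] at h1
  -- `4³ / 24² = (1/3)²`.
  exact (abs_le_of_sq_le_sq' (h1.trans (by norm_num)) (by norm_num)).2

end TraceNorm

/-! ### From output probabilities to entries of the output density matrix -/

section ReducedState

variable {ℓ w q : ℕ} (out : Fin q ↪ Fin w)

/-- The probability that the output qubits do not have the values `s`. -/
def errorWeight (s : Bits (Fin q)) (ψ : Bits (LW ℓ w) → ℂ) : ℝ :=
  ∑ z : Bits (LW ℓ w), if ∀ k, z (Sum.inr (out k)) = s k then 0 else ‖ψ z‖ ^ 2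

/-- Two basis states have the output values `s` and `t` and agree elsewhere. -/
def Matches (s t : Bits (Fin q)) (z z' : Bits (LW ℓ w)) : Prop :=
  (∀ k, z (Sum.inr (out k)) = s k) ∧ (∀ k, z' (Sum.inr (out k)) = t k) ∧
    (∀ j, (∀ k, j ≠ Sum.inr (out k)) → z j = z' j)

variable {out}

theorem Matches.unique {s t : Bits (Fin q)} {z y y' : Bits (LW ℓ w)} (h : Matches out s t z y)
    (h' : Matches out s t z y') : y = y' := by
  funext j
  by_cases hj : ∃ k, j = Sum.inr (out k)
  · obtain ⟨k, rfl⟩ := hj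
    rw [h.2.1, h'.2.1]
  · push Not at hj
    rw [← h.2.2 j hj, ← h'.2.2 j hj]

theorem Matches.symm {s t : Bits (Fin q)} {z y : Bits (LW ℓ w)} (h : Matches out s t z y) :
    Matches out t s y z :=
  ⟨h.2.1, h.1, fun j hj => (h.2.2 j hj).symm⟩

open Classical in
theorem sum_matches_le (s t : Bits (Fin q)) (f : Bits (LW ℓ w) → ℝ) (hf : ∀ z, 0 ≤ f z) :
    ∑ z, ∑ z', (if Matches out s t z z' then f z else 0) ≤
      ∑ z, if ∀ k, z (Sum.inr (out k)) = s k then f z else 0 := by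
  refine Finset.sum_le_sum fun z _ => ?_
  by_cases hz : ∃ y, Matches out s t z y
  · obtain ⟨y, hy⟩ := hz
    rw [Finset.sum_eq_single y]
    · rw [if_pos hy, if_pos hy.1]
    · intro y' _ hy'
      exact if_neg fun h => hy' (h.unique hy)
    · simp
  · push Not at hz
    rw [Finset.sum_eq_zero fun y _ => if_neg (hz y)]
    split_ifs
    · exact hf z
    · exact le_rfl

-- Cauchy–Schwarz over matching pairs of basis states; each basis state has at most one partner, so
-- the pairs contribute no more than the probabilities of `s` and `t`.
open Classical in
theorem norm_reducedState_sq_le (s t : Bits (Fin q)) (ψ : Bits (LW ℓ w) → ℂ) :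
    ‖reducedState out ψ s t‖ ^ 2 ≤
      (∑ z, if ∀ k, z (Sum.inr (out k)) = s k then ‖ψ z‖ ^ 2 else 0) *
        ∑ z, if ∀ k, z (Sum.inr (out k)) = t k then ‖ψ z‖ ^ 2 else 0 := by
  let u : Bits (LW ℓ w) × Bits (LW ℓ w) → ℝ := fun v =>
    if Matches out s t v.1 v.2 then ‖ψ v.1‖ else 0
  let v : Bits (LW ℓ w) × Bits (LW ℓ w) → ℝ := fun v =>
    if Matches out s t v.1 v.2 then ‖ψ v.2‖ else 0
  have h1 : ‖reducedState out ψ s t‖ ≤ ∑ p, u p * v p := by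
    rw [Fintype.sum_prod_type, reducedState, Matrix.of_apply]
    refine (norm_sum_le _ _).trans (Finset.sum_le_sum fun z _ =>
      (norm_sum_le _ _).trans (Finset.sum_le_sum fun z' _ => ?_))
    split_ifs with h
    · have h' : Matches out s t z z' := h
      simp [u, v, h']
    · have h' : ¬ Matches out s t z z' := h
      simp [u, v, h']
  have h2 : ∑ p, u p ^ 2 ≤ ∑ z, if ∀ k, z (Sum.inr (out k)) = s k then ‖ψ z‖ ^ 2 else 0 := by
    rw [Fintype.sum_prod_type]
    refine le_trans (le_of_eq ?_) (sum_matches_le s t (fun z => ‖ψ z‖ ^ 2) fun z => by positivity)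
    simp only [u, ite_pow, ne_eq, OfNat.ofNat_ne_zero, not_false_eq_true, zero_pow]
  have h3 : ∑ p, v p ^ 2 ≤ ∑ z, if ∀ k, z (Sum.inr (out k)) = t k then ‖ψ z‖ ^ 2 else 0 := by
    rw [Fintype.sum_prod_type, Finset.sum_comm]
    refine le_trans (le_of_eq ?_) (sum_matches_le t s (fun z => ‖ψ z‖ ^ 2) fun z => by positivity)
    simp only [v, ite_pow, ne_eq, OfNat.ofNat_ne_zero, not_false_eq_true, zero_pow]
    exact Finset.sum_congr rfl fun y _ => Finset.sum_congr rfl fun z _ =>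
      if_congr ⟨Matches.symm, Matches.symm⟩ rfl rfl
  calc ‖reducedState out ψ s t‖ ^ 2 ≤ (∑ p, u p * v p) ^ 2 :=
        pow_le_pow_left₀ (norm_nonneg _) h1 2
    _ ≤ (∑ p, u p ^ 2) * ∑ p, v p ^ 2 := Finset.sum_mul_sq_le_sq_mul_sq _ _ _
    _ ≤ _ := mul_le_mul h2 h3 (Finset.sum_nonneg fun p _ => sq_nonneg _)
        (Finset.sum_nonneg fun p _ => by positivity)

theorem sum_correct_add_errorWeight (s : Bits (Fin q)) (ψ : Bits (LW ℓ w) → ℂ) :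
    (∑ z, if ∀ k, z (Sum.inr (out k)) = s k then ‖ψ z‖ ^ 2 else 0) + errorWeight out s ψ =
      normSq ψ := by
  rw [errorWeight, ← Finset.sum_add_distrib, normSq]
  refine Finset.sum_congr rfl fun z _ => ?_
  split_ifs <;> simp

theorem reducedState_self (s : Bits (Fin q)) (ψ : Bits (LW ℓ w) → ℂ) :
    reducedState out ψ s s =
      ((∑ z, if ∀ k, z (Sum.inr (out k)) = s k then ‖ψ z‖ ^ 2 else 0 : ℝ) : ℂ) := by
  rw [reducedState, Matrix.of_apply, Complex.ofReal_sum]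
  refine Finset.sum_congr rfl fun z _ => ?_
  rw [Finset.sum_eq_single z]
  · simp only [implies_true, and_true, and_self]
    split_ifs
    · rw [Complex.star_def, Complex.mul_conj']
      push_cast
      rfl
    · simp
  · intro y _ hy
    refine if_neg fun h => hy ?_
    have h' : Matches out s s z z := ⟨h.1, h.1, fun _ _ => rfl⟩
    exact Matches.unique (out := out) h h'
  · simp

theorem errorWeight_nonneg (s : Bits (Fin q)) (ψ : Bits (LW ℓ w) → ℂ) :
    0 ≤ errorWeight out s ψ :=
  Finset.sum_nonneg fun z _ => by split_ifs <;> positivity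

/-- All entries of the output differ from those of the pure state `s` by at most the square root
of the error probability. -/
theorem norm_reducedState_sub_le (r s t : Bits (Fin q)) {ψ : Bits (LW ℓ w) → ℂ}
    (hψ : normSq ψ = 1) :
    ‖reducedState out ψ s t - ketBra r s t‖ ≤ Real.sqrt (errorWeight out r ψ) := by
  set c : Bits (Fin q) → ℝ := fun s =>
    ∑ z, if ∀ k, z (Sum.inr (out k)) = s k then ‖ψ z‖ ^ 2 else 0 with hc
  have hc0 : ∀ s, 0 ≤ c s := fun s => Finset.sum_nonneg fun z _ => by split_ifs <;> positivity
  have hsum : ∀ s, c s + errorWeight out s ψ = 1 := fun s =>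
    (sum_correct_add_errorWeight s ψ).trans hψ
  have he := errorWeight_nonneg (out := out) r ψ
  have hc1 : ∀ s, c s ≤ 1 := fun s => by
    have := hsum s
    have := errorWeight_nonneg (out := out) s ψ
    linarith
  have hcs : ∀ s, s ≠ r → c s ≤ errorWeight out r ψ := by
    intro s hs
    refine Finset.sum_le_sum fun z _ => ?_
    by_cases h : ∀ k, z (Sum.inr (out k)) = s k
    · rw [if_pos h, if_neg]
      intro h'
      exact hs (funext fun k => (h k).symm.trans (h' k))
    · rw [if_neg h]
      split_ifs <;> positivity
  by_cases hst : s = r ∧ t = r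
  · rw [hst.1, hst.2]
    rw [reducedState_self, ketBra, Matrix.single_apply, if_pos ⟨rfl, rfl⟩]
    have h1 : ((c r : ℝ) : ℂ) - 1 = ((-(errorWeight out r ψ) : ℝ) : ℂ) := by
      rw [eq_sub_of_add_eq (hsum r)]; push_cast; ring
    change ‖((c r : ℝ) : ℂ) - 1‖ ≤ _
    rw [h1, Complex.norm_real, norm_neg, Real.norm_of_nonneg he]
    -- The deviation of this diagonal entry is the error probability itself, which is at most 1 and
    -- so at most its square root.
    refine Real.le_sqrt_of_sq_le ?_
    nlinarith [hsum r, hc0 r]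
  · rw [ketBra, Matrix.single_apply, if_neg (fun h => hst ⟨h.1.symm, h.2.symm⟩), sub_zero]
    -- At least one of `s`, `t` is a wrong answer, so the product of the two probabilities is at
    -- most the error probability.
    refine Real.le_sqrt_of_sq_le ((norm_reducedState_sq_le s t ψ).trans ?_)
    change c s * c t ≤ _
    by_cases hs : s = r
    · have ht : t ≠ r := fun h => hst ⟨hs, h⟩
      calc c s * c t ≤ 1 * errorWeight out r ψ := mul_le_mul (hc1 s) (hcs t ht) (hc0 t) zero_le_one
        _ = _ := one_mul _
    · calc c s * c t ≤ errorWeight out r ψ * 1 := mul_le_mul (hcs s hs) (hc1 t) (hc0 t) he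
        _ = _ := mul_one _

/-- Union bound over the two output qubits. -/
theorem errorWeight_le {ℓ w : ℕ} {out : Fin 2 ↪ Fin w} (s : Bits (Fin 2))
    {ψ : Bits (LW ℓ w) → ℂ} (hψ : normSq ψ = 1) :
    errorWeight out s ψ ≤ ∑ k, if s k = 1 then 1 - flagWeight (Sum.inr (out k)) ψ
      else flagWeight (Sum.inr (out k)) ψ := by
  have h : ∀ k, (if s k = 1 then 1 - flagWeight (Sum.inr (out k)) ψ
      else flagWeight (Sum.inr (out k)) ψ) =
      ∑ z : Bits (LW ℓ w), if z (Sum.inr (out k)) = s k then 0 else ‖ψ z‖ ^ 2 := by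
    intro k
    have h2 : ∀ a : Fin 2, a ≠ 1 → a = 0 := by decide
    have h3 : ∀ a : Fin 2, a ≠ 0 → a = 1 := by decide
    split_ifs with hk
    · rw [← hψ, normSq, flagWeight, ← Finset.sum_sub_distrib, hk]
      refine Finset.sum_congr rfl fun z _ => ?_
      split_ifs <;> simp
    · rw [flagWeight, h2 _ hk]
      refine Finset.sum_congr rfl fun z _ => ?_
      by_cases hz : z (Sum.inr (out k)) = 0
      · simp [hz]
      · simp [h3 _ hz]
  simp only [h]
  rw [Finset.sum_comm]
  refine Finset.sum_le_sum fun z _ => ?_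
  split_ifs with hz
  · exact Finset.sum_nonneg fun k _ => by split_ifs <;> positivity
  · push Not at hz
    obtain ⟨k, hk⟩ := hz
    refine le_trans (le_of_eq (if_neg hk).symm) (Finset.single_le_sum
      (f := fun k => if z (Sum.inr (out k)) = s k then 0 else ‖ψ z‖ ^ 2)
      (fun k _ => ?_) (Finset.mem_univ k))
    split_ifs <;> positivity

end ReducedState

/-! ### Continuity of the output in the unitary, for integrability -/

section Continuity

variable {ℓ w : ℕ}

theorem continuous_mat (o : Op (LW ℓ w)) :
    Continuous fun U : Matrix (Bits (Fin ℓ)) (Bits (Fin ℓ)) ℂ => o.mat U := by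
  cases o with
  | query =>
    refine continuous_matrix fun z z' => ?_
    simp only [Op.mat, liftL, Matrix.of_apply]
    split_ifs
    · exact continuous_id.matrix_elem _ _
    · exact continuous_const
  | _ => exact continuous_const

theorem continuous_run {X : Type} [TopologicalSpace X]
    {u : X → Matrix (Bits (Fin ℓ)) (Bits (Fin ℓ)) ℂ} (hu : Continuous u) (p : List (Op (LW ℓ w)))
    {f : X → Bits (LW ℓ w) → ℂ} (hf : Continuous f) : Continuous fun x => run (u x) p (f x) := by
  induction p generalizing f with
  | nil => exact hf
  | cons o p ih => exact ih (((continuous_mat o).comp hu).matrix_mulVec hf)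

theorem continuous_reducedState {X : Type} [TopologicalSpace X] {q : ℕ} (out : Fin q ↪ Fin w)
    {f : X → Bits (LW ℓ w) → ℂ} (hf : Continuous f) (s t : Bits (Fin q)) :
    Continuous fun x => reducedState out (f x) s t := by
  simp only [reducedState, Matrix.of_apply]
  refine continuous_finsetSum _ fun z _ => continuous_finsetSum _ fun z' _ => ?_
  split_ifs
  · exact ((continuous_apply z).comp hf).mul ((continuous_apply z').comp hf).star
  · exact continuous_const

end Continuity

/-! ### The symmetry distinction problem -/

section Distinction

theorem pow_le_pow_add {x y ε : ℝ} (hx : 0 ≤ x) (hx1 : x ≤ 1) (hy : 0 ≤ y) (hy1 : y ≤ 1)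
    (hε : 0 ≤ ε) (h : x ≤ y + ε) (t : ℕ) : x ^ t ≤ y ^ t + t * ε := by
  induction t with
  | zero => simp
  | succ t ih =>
    have h1 : y ^ t ≤ 1 := pow_le_one₀ hy hy1
    have h2 : 0 ≤ y ^ t := pow_nonneg hy t
    have h3 : 0 ≤ t * ε := by positivity
    calc x ^ (t + 1) = x * x ^ t := pow_succ' x t
      _ ≤ x * (y ^ t + t * ε) := by gcongr
      _ ≤ (y + ε) * y ^ t + t * ε := by nlinarith
      _ ≤ y ^ (t + 1) + (t + 1 : ℕ) * ε := by
        push_cast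
        rw [pow_succ']
        nlinarith

theorem norm_amp_le_one {ℓ : ℕ} {i : Fin 3} {B P : Matrix (Bits (Fin ℓ)) (Bits (Fin ℓ)) ℂ}
    (h : Rotates i B P) (U : UGroup ℓ) : ‖amp B U.1‖ ≤ 1 := by
  have := norm_sq_amp_add_le h (Matrix.mem_unitaryGroup_iff'.mp U.2)
  nlinarith [norm_nonneg (amp B U.1), sq_nonneg ‖Complex.I * ((1 / 2 : ℂ) ^ ℓ *
    (Bᵀ * P * (U.1 * Bᵀ * U.1ᵀ)).trace)‖]

/-- A bound for the square root of the error probability, for the group `i`. -/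
def errorAmp (t : ℕ) {ℓ : ℕ} (i : Fin 3) (U : UGroup ℓ) : ℝ :=
  ![‖amp (matJ ℓ) U.1‖ ^ t + ‖amp 1 U.1‖ ^ t, ‖amp (matJ ℓ) U.1‖ ^ t, ‖amp 1 U.1‖ ^ t] i

theorem continuous_errorAmp (t ℓ : ℕ) (i : Fin 3) :
    Continuous fun U : symmetryGroup ℓ i => errorAmp t i U.1 := by
  have h := fun (B : Matrix (Bits (Fin ℓ)) (Bits (Fin ℓ)) ℂ) (i : Fin 3) =>
    (continuous_amp B i).norm.pow t
  fin_cases i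
  · exact (h _ _).add (h _ _)
  · exact h _ _
  · exact h _ _

/-- For each group `errorAmp` contains only amplitudes that some rotation of the group moves. With
`m > 4/η` and `c^t < η/4` each averages to at most `η/2`, and there are at most two; neither choice
involves `ℓ`. -/
theorem exists_integral_errorAmp_le {η : ℝ} (hη : 0 < η) : ∃ t : ℕ, ∀ (ℓ : ℕ) (i : Fin 3), 2 ≤ ℓ →
    ∫ U, errorAmp t i U.1 ∂(haar ℓ i) ≤ η := by
  obtain ⟨m, hm⟩ := exists_nat_gt (4 / η)
  have hm0 : (0 : ℝ) < m := (by positivity : (0 : ℝ) < 4 / η).trans hm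
  obtain ⟨c, hc0, hc1, hc⟩ := exists_integral_amp_le (Nat.cast_pos.mp hm0)
  obtain ⟨t, ht⟩ := exists_pow_lt_of_lt_one (by positivity : 0 < η / 4) hc1
  have hm' : 1 / (m : ℝ) ≤ η / 4 := by
    rw [div_lt_iff₀ hη] at hm
    rw [div_le_iff₀ hm0]
    linarith
  have key : ∀ {ℓ : ℕ} {i : Fin 3} {B : Matrix (Bits (Fin ℓ)) (Bits (Fin ℓ)) ℂ},
      (∃ P, Rotates i B P) → ∫ U, ‖amp B U.1.1‖ ^ t ∂(haar ℓ i) ≤ η / 2 := by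
    rintro ℓ i B ⟨P, hP⟩
    exact (hc ℓ i B P hP t).trans (by linarith)
  refine ⟨t, fun ℓ i hℓ => ?_⟩
  fin_cases i
  · have h1 := key (exists_rotates_unitary_matJ hℓ)
    have h2 := key (exists_rotates_unitary_one hℓ)
    refine le_trans (le_of_eq (integral_add
      (integrable_of_continuous ((continuous_amp (matJ ℓ) 0).norm.pow t))
      (integrable_of_continuous ((continuous_amp 1 0).norm.pow t)))) ?_
    exact (add_le_add h1 h2).trans (by linarith)
  · exact (key (exists_rotates_orthogonal hℓ)).trans (by linarith)
  · exact (key (exists_rotates_symplectic (by omega))).trans (by linarith)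

theorem sqrt_le_add {e a s : ℝ} (ha : 0 ≤ a) (hs : 0 ≤ s) (h : e ≤ a ^ 2 + s ^ 2) :
    Real.sqrt e ≤ a + s :=
  Real.sqrt_le_iff.mpr ⟨add_nonneg ha hs, by nlinarith [mul_nonneg ha hs]⟩

/-- The error probability of the program, for an approximation `V` of an element `U` of the
group `i`. -/
theorem sqrt_errorWeight_le {t ℓ w : ℕ} (hℓ : 2 ≤ ℓ) {out : Fin 2 ↪ Fin w}
    {ψ : Bits (LW ℓ w) → ℂ} {i : Fin 3} (U : symmetryGroup ℓ i) {V : UGroup ℓ} {ε : ℝ} (hε : 0 ≤ ε)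
    (h1 : normSq ψ = 1)
    (h2 : flagWeight (Sum.inr (out 0)) ψ = (‖amp (matJ ℓ) V.1‖ ^ t) ^ 2)
    (h3 : flagWeight (Sum.inr (out 1)) ψ = (‖amp 1 V.1‖ ^ t) ^ 2)
    (hJ : ‖amp (matJ ℓ) V.1 - amp (matJ ℓ) U.1.1‖ ≤ ε)
    (hO : ‖amp 1 V.1 - amp 1 U.1.1‖ ≤ ε) :
    Real.sqrt (errorWeight out (answer i) ψ) ≤
      errorAmp t i U.1 + (2 * t * ε + Real.sqrt (2 * t * ε)) := by
  have hew := errorWeight_le (out := out) (answer i) h1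
  rw [Fin.sum_univ_two, h2, h3] at hew
  obtain ⟨P, hP⟩ := exists_rotates_unitary_matJ hℓ
  obtain ⟨P', hP'⟩ := exists_rotates_unitary_one hℓ
  have hV := norm_amp_le_one hP V
  have hV' := norm_amp_le_one hP' V
  have hU := norm_amp_le_one hP U.1
  have hU' := norm_amp_le_one hP' U.1
  have hJ1 := norm_sub_norm_le (amp (matJ ℓ) V.1) (amp (matJ ℓ) U.1.1)
  have hO1 := norm_sub_norm_le (amp 1 V.1) (amp 1 U.1.1)
  have hJ2 := norm_sub_norm_le (amp (matJ ℓ) U.1.1) (amp (matJ ℓ) V.1)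
  have hO2 := norm_sub_norm_le (amp 1 U.1.1) (amp 1 V.1)
  rw [norm_sub_rev] at hJ2 hO2
  have hpJ := pow_le_pow_add (norm_nonneg _) hV (norm_nonneg _) hU hε (by linarith) t
  have hpO := pow_le_pow_add (norm_nonneg _) hV' (norm_nonneg _) hU' hε (by linarith) t
  -- The exponent `2t` is that of the success probability, which must stay near 1 when `V` replaces
  -- an element with amplitude of modulus 1.
  have hpJ' := pow_le_pow_add (norm_nonneg _) hU (norm_nonneg _) hV hε (by linarith) (t * 2)
  have hpO' := pow_le_pow_add (norm_nonneg _) hU' (norm_nonneg _) hV' hε (by linarith) (t * 2)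
  rw [pow_mul, pow_mul, Nat.cast_mul, Nat.cast_two] at hpJ' hpO'
  have htε : 0 ≤ t * ε := by positivity
  have hs := Real.sq_sqrt (by linarith : 0 ≤ 2 * t * ε)
  have hs0 := Real.sqrt_nonneg (2 * t * ε)
  have ha0 := pow_nonneg (norm_nonneg (amp (matJ ℓ) V.1)) t
  have hb0 := pow_nonneg (norm_nonneg (amp 1 V.1)) t
  clear hJ1 hJ2 hO1 hO2 h2 h3 hJ hO hP hP' h1
  generalize Real.sqrt (2 * t * ε) = s at *
  generalize ‖amp (matJ ℓ) V.1‖ ^ t = a at *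
  generalize ‖amp 1 V.1‖ ^ t = b at *
  generalize errorWeight out (answer i) ψ = e at *
  fin_cases i
  · have hew : e ≤ a ^ 2 + b ^ 2 := hew
    have := sqrt_le_add ha0 hb0 hew
    change Real.sqrt e ≤ ‖amp (matJ ℓ) U.1.1‖ ^ t + ‖amp 1 U.1.1‖ ^ t + _
    linarith
  -- The test with `1` succeeds with certainty for the exact `U`, so `1 - b² ≤ 2 t ε`; only the
  -- other test contributes an amplitude.
  · have hew : e ≤ a ^ 2 + (1 - b ^ 2) := hew
    have h4 : ‖amp 1 U.1.1‖ = 1 := norm_amp_orthogonal U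
    rw [h4, one_pow, one_pow] at hpO'
    have := sqrt_le_add ha0 hs0 (hew.trans (by linarith))
    change Real.sqrt e ≤ ‖amp (matJ ℓ) U.1.1‖ ^ t + _
    linarith
  · have hew : e ≤ 1 - a ^ 2 + b ^ 2 := hew
    have h4 : ‖amp (matJ ℓ) U.1.1‖ = 1 := norm_amp_symplectic (by omega) U
    rw [h4, one_pow, one_pow] at hpJ'
    have := sqrt_le_add hb0 hs0 (hew.trans (by linarith))
    change Real.sqrt e ≤ ‖amp 1 U.1.1‖ ^ t + _
    linarith

/-- Averaging is done entry by entry, before passing to the trace norm; this is why the bound on the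
square root of the error is kept linear in the amplitudes. -/
theorem traceNorm_integral_sub_le {ℓ : ℕ} {i : Fin 3} {s₀ : Bits (Fin 2)}
    {F : symmetryGroup ℓ i → Matrix (Bits (Fin 2)) (Bits (Fin 2)) ℂ} {G : symmetryGroup ℓ i → ℝ}
    {A : Matrix (Bits (Fin 2)) (Bits (Fin 2)) ℂ}
    (hA : ∀ s t, A s t = ∫ U, F U s t ∂(haar ℓ i))
    (hF : ∀ s t, Integrable (fun U => F U s t) (haar ℓ i)) (hG : Integrable G (haar ℓ i))
    (hFG : ∀ U s t, ‖F U s t - ketBra s₀ s t‖ ≤ G U) (hG1 : ∫ U, G U ∂(haar ℓ i) ≤ 1 / 24) :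
    traceNorm (A - ketBra s₀) ≤ 1 / 3 := by
  refine traceNorm_le_third fun s t => ?_
  have h : (A - ketBra s₀) s t = ∫ U, (F U s t - ketBra s₀ s t) ∂(haar ℓ i) := by
    rw [integral_sub (hF s t) (integrable_const _), ← hA]
    simp
  rw [h]
  exact (norm_integral_le_of_norm_le hG (Filter.Eventually.of_forall fun U => hFG U s t)).trans hG1

/-- The integrand factors through the finite set of descriptions, so measurability of the encoding
suffices and the sum is the integral against the image measure. -/
theorem sum_measureReal_mul {ℓ n : ℕ} {i : Fin 3} {enc : UGroup ℓ → Bits (Fin n)}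
    (henc : Measurable enc) (f : Bits (Fin n) → ℂ) :
    Integrable (fun U : symmetryGroup ℓ i => f (enc U.1)) (haar ℓ i) ∧
      ∑ a, (((haar ℓ i).real {U | enc U.1 = a} : ℝ) : ℂ) * f a =
        ∫ U, f (enc U.1) ∂(haar ℓ i) := by
  have hm : Measurable fun U : symmetryGroup ℓ i => enc U.1 := henc.comp measurable_subtype_coe
  have : IsProbabilityMeasure ((haar ℓ i).map fun U => enc U.1) :=
    Measure.isProbabilityMeasure_map hm.aemeasurable
  have hf : Integrable f ((haar ℓ i).map fun U => enc U.1) := Integrable.of_finite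
  refine ⟨hf.comp_measurable hm, ?_⟩
  rw [← integral_map hm.aemeasurable hf.aestronglyMeasurable, integral_fintype hf]
  refine Finset.sum_congr rfl fun a _ => ?_
  rw [map_measureReal_apply hm (measurableSet_singleton a), Complex.real_smul]
  rfl

/-- The claim amounts to `40000 t · 2^(3ℓ) ≤ 2^b`, and `40000 t ≤ 2^(40000 t)`. -/
theorem accuracy_bound {t ℓ b : ℕ} (hb : 3 * ℓ + 40000 * t ≤ b) :
    2 * t * (2 * (2 ^ ℓ) ^ 3 * (1 / 2 : ℝ) ^ b) ≤ 1 / 10000 := by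
  have h1 : (2 : ℝ) ^ (3 * ℓ + 40000 * t) ≤ 2 ^ b := pow_le_pow_right₀ one_le_two hb
  have h2 : (40000 * t : ℝ) ≤ 2 ^ (40000 * t) := by
    exact_mod_cast Nat.lt_two_pow_self.le
  have h3 : ((2 : ℝ) ^ ℓ) ^ 3 = 2 ^ (3 * ℓ) := by rw [← pow_mul, mul_comm]
  rw [pow_add, ← h3] at h1
  have h4 : (0 : ℝ) < (2 ^ ℓ) ^ 3 := by positivity
  have h5 : (40000 * t : ℝ) * (2 ^ ℓ) ^ 3 ≤ 2 ^ b := by nlinarith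
  rw [one_div, inv_pow]
  have h6 : (0 : ℝ) < 2 ^ b := by positivity
  rw [← mul_assoc, ← div_eq_mul_inv, div_le_iff₀ h6]
  linarith

end Distinction

end

theorem theorem5 (𝒢 : GateFamily) (h𝒢 : 𝒢.IsUniversal) :
    ∃ C : ℕ, ∀ ℓ : ℕ, 2 ≤ ℓ → ∃ Q : QUALM 𝒢 ℓ 0 2,
      Q.complexity ≤ C * ℓ ∧ Q.queryComplexity ≤ C ∧
      (∀ (i : Fin 3) (x : Bits (Fin 0)),
        traceNorm (idealOutput Q i x - ketBra (answer i)) ≤ 1 / 3) ∧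
      (∀ (n b : ℕ) (d : Description ℓ n b), C * 2 ^ ℓ ≤ b →
        Q.ImplementsWithError (symmetryOracle d) (fun i _ => answer i) (1 / 3)) := by
  obtain ⟨K, hK⟩ := h𝒢
  -- Another `1/50` is reserved for the finite accuracy, and `1/50 + 1/50 ≤ 1/24`, the entrywise
  -- error allowed for trace norm `1/3`.
  obtain ⟨t, ht⟩ := exists_integral_errorAmp_le (by norm_num : (0 : ℝ) < 1 / 50)
  -- The first summand bounds the symbols per qubit; `40000 t + 3` serves the accuracy, through `3ℓ
  -- + 40000 t ≤ C · 2^ℓ`, and exceeds the `4t` queries.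
  refine ⟨(K + 1) * (178 * t + 15) + 40000 * t + 3, fun ℓ hℓ => ?_⟩
  obtain ⟨w, p, out, hlen, hnum, hp⟩ := exists_program t ℓ (by omega)
  obtain ⟨Q, hQ1, hQ2, hQ⟩ := exists_qualm hK p out
  have hV := fun V : UGroup ℓ => hp V.1 (Matrix.mem_unitaryGroup_iff'.mp V.2)
  have hbound : ∀ (i : Fin 3) (U : symmetryGroup ℓ i) (V : UGroup ℓ) (ε : ℝ), 0 ≤ ε →
      2 * t * ε ≤ 1 / 10000 → ‖amp (matJ ℓ) V.1 - amp (matJ ℓ) U.1.1‖ ≤ ε →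
      ‖amp 1 V.1 - amp 1 U.1.1‖ ≤ ε → ∀ s s',
      ‖reducedState out (run V.1 p (Pi.single 0 1)) s s' - ketBra (answer i) s s'‖ ≤
        errorAmp t i U.1 + 1 / 50 := by
    intro i U V ε hε hε' hJ hO s s'
    obtain ⟨h1, h2, h3⟩ := hV V
    have hs : Real.sqrt (2 * t * ε) ≤ 1 / 100 :=
      Real.sqrt_le_iff.mpr ⟨by norm_num, hε'.trans (by norm_num)⟩
    have := sqrt_errorWeight_le hℓ U hε h1 h2 h3 hJ hO
    exact (norm_reducedState_sub_le (answer i) s s' h1).trans (by linarith)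
  have hint : ∀ i, Integrable (fun U : symmetryGroup ℓ i => errorAmp t i U.1) (haar ℓ i) := fun i =>
    integrable_of_continuous (continuous_errorAmp t ℓ i)
  have hG : ∀ i, Integrable (fun U : symmetryGroup ℓ i => errorAmp t i U.1 + 1 / 50) (haar ℓ i) :=
    fun i => (hint i).add (integrable_const _)
  have hG1 : ∀ i, ∫ U, errorAmp t i U.1 + 1 / 50 ∂(haar ℓ i) ≤ 1 / 24 := fun i => by
    rw [integral_add (hint i) (integrable_const _)]
    have := ht ℓ i hℓ
    simp only [integral_const, probReal_univ, one_smul]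
    linarith
  refine ⟨Q, ?_, ?_, fun i x => ?_, fun n b d hb i x => ?_⟩
  · refine hQ1.trans ((Nat.mul_le_mul_left _ hlen).trans ?_)
    rw [← mul_assoc]
    exact Nat.mul_le_mul_right _ (by omega)
  · rw [hQ2, hnum]
    omega
  · have hout : ∀ U : UGroup ℓ, Q.output (unitaryOracle U) x =
        reducedState out (run U.1 p (Pi.single 0 1)) := fun U => by
      rw [hQ 0 (fun _ => U) (unitaryOracle U) x rfl]
      simp [unitaryOracle]
    refine traceNorm_integral_sub_le (F := fun U => Q.output (unitaryOracle U.1) x)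
      (fun _ _ => rfl) (fun s s' => ?_) (hG i) (fun U s s' => ?_) (hG1 i)
    · simp only [hout]
      exact integrable_of_continuous (continuous_reducedState out (continuous_run
        (continuous_subtype_val.comp continuous_subtype_val) p continuous_const) s s')
    · rw [hout]
      -- The ideal oracle is the case `V = U` with error zero.
      exact hbound i U U.1 0 le_rfl (by norm_num) (by simp) (by simp) s s'
  · have hstate : ∀ a, (symmetryOracle d i).state a a =
        (((haar ℓ i).real {U | d.enc U.1 = a} : ℝ) : ℂ) := fun a => by
      change describedState d i a a = _
      rw [describedState_eq, Matrix.diagonal_apply_eq]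
    have hmix := fun s s' => sum_measureReal_mul (i := i) d.measurable_enc fun a =>
      reducedState out (run (d.dec a).1 p (Pi.single 0 1)) s s'
    have hb' : 3 * ℓ + 40000 * t ≤ b := by
      have h1 : ℓ ≤ 2 ^ ℓ := Nat.lt_two_pow_self.le
      have h2 : 1 ≤ 2 ^ ℓ := Nat.one_le_two_pow
      refine le_trans ?_ hb
      nlinarith [Nat.zero_le ((K + 1) * (178 * t + 15) * 2 ^ ℓ),
        Nat.mul_le_mul_left (40000 * t) h2]
    refine traceNorm_integral_sub_le
      (F := fun U => reducedState out (run (d.dec (d.enc U.1)).1 p (Pi.single 0 1)))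
      (fun s s' => ?_) (fun s s' => (hmix s s').1) (hG i) (fun U s s' => ?_) (hG1 i)
    · rw [hQ n d.dec (symmetryOracle d i) x rfl, Matrix.sum_apply, ← (hmix s s').2]
      simp only [Matrix.smul_apply, smul_eq_mul, hstate]
    -- Here `V = dec (enc U)`. It need not lie in the group of `U`; closeness of the two amplitudes
    -- is all that is used.
    · exact hbound i U _ _ (by positivity) (accuracy_bound hb')
        (norm_amp_sub_le (matJ_unitary (by omega)) U.1 _ (d.accurate U.1))
        (norm_amp_sub_le (by simp) U.1 _ (d.accurate U.1)) s s'
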